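/- Let $(\Omega,\mathcal F,\mathbb P)$ be a probability space, $n,d$ nonnegative integers, $\lambda\in\mathbb R^d$ with nonnegative entries, and $Q\in\mathbb R^{d\times d}$. Let $\tau^1,\dots,\tau^n$ be random times with values in $[0,\infty]$, and let $X=(X_t)_{t\ge 0}$ be a process with values in the set $\{e_1,\dots,e_d\}$ of standard basis vectors of $\mathbb R^d$. Put $$Y^i_t=\mathbf 1_{\{\tau^i\le t\}},\qquad N_t=\sum_{i=1}^n Y^i_t,\qquad \nu_t=\big(\mathbf 1_{\{N_t=0\}},\dots,\mathbf 1_{\{N_t=n\}}\big)^\top,\qquad \zeta_t=\nu_t\otimes X_t .$$ Let $\mathcal F^i_t=\sigma(X_u,Y^i_u: u\le t)$ and $\mathcal F_t=\sigma(X_u,Y^1_u,\dots,Y^n_u: u\le t)$. A càdlàg process $Z$, adapted to $(\mathcal F_t)$ and with values in the standard basis vectors of $\mathbb R^m$, is called an $(\mathcal F_t)$-Markov chain with generator $G\in\mathbb R^{m\times m}$ if there are column-stochastic matrices $(P_t)_{t\ge0}$ with $P_0=I$, $P_{s+t}=P_sP_t$ and $\lim_{h\downarrow0}h^{-1}(P_h-I)=G$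 such that, for all $s\le t$ and all $i$, almost surely $\mathbb P(Z_t=e_i\mid\mathcal F_s)=(P_{t-s})_{ij}$ on $\{Z_s=e_j\}$, for every $j$. (Thus $G_{ij}$, $i\ne j$, is the intensity of a transition from state $j$ to state $i$.) Assume that 1. $X$ is an $(\mathcal F_t)$-Markov chain with generator $Q$; 2. for each $i$ the process $m^i_t=Y^i_t-\int_0^t\lambda^\top X_s(1-Y^i_s)\,ds$ is a martingale with respect to $(\mathcal F^i_t)$; 3. $\tau^1,\dots,\tau^n$ are conditionally independent given the $\sigma$-algebra generated by the whole path of $X$; 4. almost surely, $X$ has no jump in common with any $Y^i$. Let $A\in\mathbb R^{(n+1)\times(n+1)}$, with rows and columns numbered $0,\dots,n$, have entries $A_{jj}=-(n-j)$ for $0\le j\le n$, $A_{j+1,j}=n-j$ for $0\le j<n$, and all other entries equal to $0$, and put $$\mathbf Q=A\otimes\mathrm{diag}(\lambda)+I_{n+1}\otimes Q .$$ Then $\zeta$ is an $(\mathcal F_t)$-Markov chain with generator $\mathbf Q$, and for all $0\le s\le t$, almost surely, $$\mathbb E[\zeta_t\mid\mathcal F_s]=\exp\big(\mathbf Q(t-s)\big)\,\zeta_s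 .$$ -/

import Mathlib

open MeasureTheory ProbabilityTheory Filter Topology
open scoped NNReal ENNReal Matrix Kronecker

namespace MMDefault

/-- The path `f` on `[0, ∞)` is right-continuous with left limits. -/
def IsCadlag {E : Type*} [TopologicalSpace E] (f : ℝ≥0 → E) : Prop :=
  ∀ t : ℝ≥0, ContinuousWithinAt f (Set.Ici t) t ∧ ∃ l : E, Tendsto f (𝓝[<] t) (𝓝 l)

/-- The jump `f t - f (t-)` of a path at time `t` (it is `0` at `t = 0`). -/
noncomputable def jump {E : Type*} [TopologicalSpace E] [Sub E] (f : ℝ≥0 → E) (t : ℝ≥0) : E :=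
  f t - Function.leftLim f t

/-- `P` is a transition semigroup on the finite state space `ι` with generator `G`.
Convention: `P t i j` is the probability of moving from state `j` to state `i` in time `t`, so
columns sum to one, and `G i j` (`i ≠ j`) is the intensity of a transition from `j` to `i`. -/
structure IsTransitionSemigroup {ι : Type*} [Fintype ι] [DecidableEq ι]
    (P : ℝ≥0 → Matrix ι ι ℝ) (G : Matrix ι ι ℝ) : Prop where
  nonneg : ∀ t i j, 0 ≤ P t i j
  col_sum : ∀ t j, ∑ i, P t i j = 1
  zero : P 0 = 1
  add : ∀ s t, P (s + t) = P s * P t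
  generator : Tendsto (fun h : ℝ≥0 => (h : ℝ)⁻¹ • (P h - 1)) (𝓝[>] 0) (𝓝 G)

/-- `Z` is a càdlàg time-homogeneous Markov chain with respect to the filtration `𝓕`, with values
in the standard basis vectors of `ℝ^ι` and with generator `G`. -/
structure IsMarkovChain {Ω : Type*} {mΩ : MeasurableSpace Ω} {ι : Type*} [Fintype ι]
    [DecidableEq ι] (μ : Measure Ω) (𝓕 : Filtration ℝ≥0 mΩ) (Z : ℝ≥0 → Ω → ι → ℝ)
    (G : Matrix ι ι ℝ) : Prop where
  adapted : StronglyAdapted 𝓕 Z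
  cadlag : ∀ ω, IsCadlag fun t => Z t ω
  basis : ∀ t ω, ∃ i, Z t ω = Pi.single i 1
  markov : ∃ P : ℝ≥0 → Matrix ι ι ℝ, IsTransitionSemigroup P G ∧
    ∀ s t : ℝ≥0, s ≤ t → ∀ i : ι, ∀ᵐ ω ∂μ, ∀ j : ι, Z s ω = Pi.single j 1 →
      (μ⟦{ω' | Z t ω' = Pi.single i 1} | 𝓕 s⟧) ω = P (t - s) i j

/-- The random times `τ i` are conditionally independent given the σ-algebra `𝓖`. (Taking some of
the `B i` to be everything gives the product formula for subfamilies.) -/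
def CondIndepTimes {Ω : Type*} {mΩ : MeasurableSpace Ω} {n : ℕ} (μ : Measure Ω)
    (𝓖 : MeasurableSpace Ω) (τ : Fin n → Ω → ℝ≥0∞) : Prop :=
  ∀ B : Fin n → Set ℝ≥0∞, (∀ i, MeasurableSet (B i)) →
    μ⟦⋂ i, τ i ⁻¹' B i | 𝓖⟧ =ᵐ[μ] fun ω => ∏ i, (μ⟦τ i ⁻¹' B i | 𝓖⟧) ω

section Model

variable {Ω : Type*} {mΩ : MeasurableSpace Ω} {n d : ℕ}

/-- The default indicator `Y_t = 1_{τ ≤ t}`. -/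
noncomputable def defaultInd (τ : Ω → ℝ≥0∞) (t : ℝ≥0) (ω : Ω) : ℝ :=
  Set.indicator {ω' | τ ω' ≤ (t : ℝ≥0∞)} 1 ω

lemma measurable_defaultInd {τ : Ω → ℝ≥0∞} (hτ : Measurable τ) (t : ℝ≥0) :
    Measurable (defaultInd τ t) :=
  measurable_const.indicator (measurableSet_le hτ measurable_const)

/-- The σ-algebra generated by the whole path of `X`. -/
@[reducible] def pathSigma (X : ℝ≥0 → Ω → Fin d → ℝ) : MeasurableSpace Ω :=
  ⨆ t, MeasurableSpace.comap (X t) inferInstance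

/-- The filtration generated by `X` and the default indicator of one obligor. -/
noncomputable def obligorFiltration (X : ℝ≥0 → Ω → Fin d → ℝ) (τ : Ω → ℝ≥0∞)
    (hX : ∀ t, Measurable (X t)) (hτ : Measurable τ) : Filtration ℝ≥0 mΩ :=
  Filtration.natural (fun t ω => (X t ω, defaultInd τ t ω)) fun t =>
    ((hX t).prodMk (measurable_defaultInd hτ t)).stronglyMeasurable

/-- The filtration generated by `X` and the default indicators of all obligors. -/
noncomputable def fullFiltration (X : ℝ≥0 → Ω → Fin d → ℝ) (τ : Fin n → Ω → ℝ≥0∞)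
    (hX : ∀ t, Measurable (X t)) (hτ : ∀ i, Measurable (τ i)) : Filtration ℝ≥0 mΩ :=
  Filtration.natural (fun t ω => (X t ω, fun i => defaultInd (τ i) t ω)) fun t =>
    ((hX t).prodMk (measurable_pi_lambda _ fun i =>
      measurable_defaultInd (hτ i) t)).stronglyMeasurable

/-- `m_t = Y_t - ∫₀ᵗ λᵀX_s (1 - Y_s) ds`, where `Y` is the default indicator of `τ`. -/
noncomputable def compensated (lam : Fin d → ℝ) (X : ℝ≥0 → Ω → Fin d → ℝ) (τ : Ω → ℝ≥0∞)
    (t : ℝ≥0) (ω : Ω) : ℝ :=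
  defaultInd τ t ω -
    ∫ s in (0 : ℝ)..t, (lam ⬝ᵥ X s.toNNReal ω) * (1 - defaultInd τ s.toNNReal ω)

/-- The number of defaults `N_t = ∑ᵢ Y^i_t` up to time `t`. -/
noncomputable def defaultCount (τ : Fin n → Ω → ℝ≥0∞) (t : ℝ≥0) (ω : Ω) : ℝ :=
  ∑ i, defaultInd (τ i) t ω

/-- The vector `ν_t` of the indicators `1_{N_t = k}`, `k = 0, …, n`. -/
noncomputable def nu (τ : Fin n → Ω → ℝ≥0∞) (t : ℝ≥0) (ω : Ω) (k : Fin (n + 1)) : ℝ :=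
  Set.indicator {ω' | defaultCount τ t ω' = (k : ℕ)} 1 ω

/-- `ζ_t = ν_t ⊗ X_t`. -/
noncomputable def zeta (X : ℝ≥0 → Ω → Fin d → ℝ) (τ : Fin n → Ω → ℝ≥0∞) (t : ℝ≥0) (ω : Ω)
    (p : Fin (n + 1) × Fin d) : ℝ :=
  nu τ t ω p.1 * X t ω p.2

end Model

/-- The `(n+1) × (n+1)` lower bidiagonal matrix with `A_{jj} = -(n-j)` and `A_{j+1,j} = n-j`,
rows and columns numbered `0, …, n`. -/
def deathMatrix (n : ℕ) : Matrix (Fin (n + 1)) (Fin (n + 1)) ℝ :=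
  Matrix.of fun i j =>
    if (i : ℕ) = j then -((n : ℝ) - (j : ℕ))
    else if (i : ℕ) = j + 1 then (n : ℝ) - (j : ℕ) else 0

/-- `𝐐 = A ⊗ diag(λ) + I ⊗ Q`. -/
def bigQ (n : ℕ) {d : ℕ} (lam : Fin d → ℝ) (Q : Matrix (Fin d) (Fin d) ℝ) :
    Matrix (Fin (n + 1) × Fin d) (Fin (n + 1) × Fin d) ℝ :=
  deathMatrix n ⊗ₖ Matrix.diagonal lam + (1 : Matrix (Fin (n + 1)) (Fin (n + 1)) ℝ) ⊗ₖ Q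

end MMDefault

/-! Everything is tested against bounded scalar weights. If `W` is known at time `u`, then `E[W X_v]
= exp((v-u)Q) E[W X_u]` (`IsMarkovChain.weightedMean_eq`), so conditional statements about `X`
become linear evolutions of vectors in `ℝ^d`.

One obligor: let `V` be known at time `u`. The compensator says that default removes mass from `E[V
1_{τ>t} X_t]` at the rate `diag(λ)`, up to products of an increment of `X` and an increment of `Y`
over the same interval. The sum of these along refining partitions tends to zero because there are
no common jumps. So this vector evolves with the generator `Q - diag(λ)` (`weightedMean_survival`).
By the Feynman–Kac formula (`weightedMean_exp_neg_intensityIntegral`) the weight `1_{τ>s} exp(-∫ₛᵗ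
λᵀX)` evolves in the same way. The difference of the two weights is zero at time `s`, hence has mean
zero on every event of the past of `X`, by induction over finitely many observation times. It then
has mean zero on every event of the whole path, because given `𝓕_t` the future of `X` depends on
`X_t` only. This gives `P(τ>t | X) = exp(-∫ₛᵗ λᵀX) P(τ>s | X)` (`condExp_survival`).

Several obligors: by conditional independence, the joint survival of `k` obligors over `[s, t]`
contributes the factor `exp(-k ∫ₛᵗ λᵀX)`, so the mean of `X` on this survival evolves with `Q - k
diag(λ)` (`weightedMean_prod_survival`).

Lumping: summing over all sets of `k` obligors gives `C(n - N_t, k) X_t`, a linear image of `ζ_t`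
under `choosePool`. The binomials `C(n - N, k)` form left eigenvectors of `A` with eigenvalue `-k`,
so `choosePool` intertwines `𝐐` with `Q - k diag(λ)` (`choosePool_mul_bigQ`), and the images for all
`k` determine the vector (`eq_zero_of_choosePool_mulVec`). Hence `E[1_G ζ_t] = exp(𝐐(t-s)) E[1_G
ζ_s]` for `G` in a π-system of survival events, and a π-λ argument extends this to all of `𝓕_s`. -/

namespace MMDefault

/-! ### Matrix exponentials and transition semigroups. -/

section Matrices

attribute [local instance] Matrix.linftyOpNormedRing Matrix.linftyOpNormedAlgebra

variable {ι κ : Type*} [Fintype ι] [DecidableEq ι] [Fintype κ] [DecidableEq κ]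

lemma hasDerivAt_exp_smul_matrix (G : Matrix ι ι ℝ) (t : ℝ) :
    HasDerivAt (fun u : ℝ => NormedSpace.exp (u • G)) (NormedSpace.exp (t • G) * G) t :=
  hasDerivAt_exp_smul_const G t

/-- The relation passes to powers and hence to the exponential series. `A` may be rectangular: it is
used for a row of ones and for the lumping matrices. -/
lemma exp_mul_eq_mul_exp (A : Matrix κ ι ℝ) (M : Matrix ι ι ℝ) (N : Matrix κ κ ℝ)
    (h : A * M = N * A) : A * NormedSpace.exp M = NormedSpace.exp N * A := by
  have hp : ∀ k : ℕ, A * M ^ k = N ^ k * A := by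
    intro k
    induction k with
    | zero => simp
    | succ k ih => rw [pow_succ, ← Matrix.mul_assoc, ih, Matrix.mul_assoc, h, ← Matrix.mul_assoc,
        pow_succ]
  have hM := NormedSpace.exp_series_hasSum_exp' (𝕂 := ℝ) M
  have hN := NormedSpace.exp_series_hasSum_exp' (𝕂 := ℝ) N
  have h1 := hM.map (AddMonoidHom.mk' (fun B : Matrix ι ι ℝ => A * B) fun x y =>
    Matrix.mul_add A x y) (by
      change Continuous fun B : Matrix ι ι ℝ => A * B
      fun_prop)
  have h2 := hN.map (AddMonoidHom.mk' (fun B : Matrix κ κ ℝ => B * A) fun x y =>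
    Matrix.add_mul x y A) (by
      change Continuous fun B : Matrix κ κ ℝ => B * A
      fun_prop)
  have he : (fun B : Matrix ι ι ℝ => A * B) ∘ (fun k : ℕ => ((k.factorial : ℝ)⁻¹) • M ^ k) =
      (fun B : Matrix κ κ ℝ => B * A) ∘ fun k : ℕ => ((k.factorial : ℝ)⁻¹) • N ^ k := by
    funext k
    simp [hp k]
  refine h1.unique ?_
  change HasSum ((fun B : Matrix ι ι ℝ => A * B) ∘ _) _
  rw [he]
  exact h2

/-- Adding a large multiple `c` of the identity makes all entries nonnegative, hence also all powers
and the exponential; the shift costs only the positive scalar `exp(-tc)`. -/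
lemma exp_nonneg_of_offDiag_nonneg {G : Matrix ι ι ℝ} (hG : ∀ i j, i ≠ j → 0 ≤ G i j) {t : ℝ}
    (ht : 0 ≤ t) (i j : ι) : 0 ≤ NormedSpace.exp (t • G) i j := by
  set c : ℝ := ∑ k, |G k k| with hc
  have hM : ∀ i j, 0 ≤ (t • (G + c • (1 : Matrix ι ι ℝ))) i j := by
    intro i j
    simp only [Matrix.smul_apply, Matrix.add_apply, smul_eq_mul]
    refine mul_nonneg ht ?_
    rcases eq_or_ne i j with rfl | hij
    · have : |G i i| ≤ c := Finset.single_le_sum (f := fun k => |G k k|)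
        (fun k _ => abs_nonneg _) (Finset.mem_univ i)
      simp only [Matrix.one_apply_eq, mul_one]
      linarith [neg_abs_le (G i i)]
    · simpa [Matrix.one_apply_ne hij] using hG i j hij
  have hpow : ∀ k : ℕ, ∀ i j, 0 ≤ ((t • (G + c • (1 : Matrix ι ι ℝ))) ^ k) i j := by
    intro k
    induction k with
    | zero => intro i j; rw [pow_zero, Matrix.one_apply]; split_ifs <;> norm_num
    | succ k ih =>
      intro i j
      rw [pow_succ, Matrix.mul_apply]
      exact Finset.sum_nonneg fun l _ => mul_nonneg (ih i l) (hM l j)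
  have hsum := NormedSpace.exp_series_hasSum_exp' (𝕂 := ℝ) (t • (G + c • (1 : Matrix ι ι ℝ)))
  have hij : 0 ≤ NormedSpace.exp (t • (G + c • (1 : Matrix ι ι ℝ))) i j := by
    have h1 := hsum.map (Matrix.entryAddMonoidHom ℝ i j)
      (by change Continuous fun B : Matrix ι ι ℝ => B i j; fun_prop)
    refine h1.nonneg fun k => ?_
    simpa using mul_nonneg (by positivity) (hpow k i j)
  have hsplit : t • G = t • (G + c • (1 : Matrix ι ι ℝ)) + (-(t * c)) • (1 : Matrix ι ι ℝ) := by
    rw [smul_add, smul_smul, neg_smul]; abel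
  have hexp1 : NormedSpace.exp ((-(t * c)) • (1 : Matrix ι ι ℝ)) =
      Real.exp (-(t * c)) • (1 : Matrix ι ι ℝ) := by
    have h := (NormedSpace.algebraMap_exp_comm (𝕂 := ℝ) (𝔸 := Matrix ι ι ℝ) (-(t * c))).symm
    rw [Algebra.algebraMap_eq_smul_one, Algebra.algebraMap_eq_smul_one,
      ← Real.exp_eq_exp_ℝ] at h
    exact h
  rw [hsplit, Matrix.exp_add_of_commute _ _ ((Commute.one_right _).smul_right _), hexp1,
    Matrix.mul_smul, Matrix.mul_one]
  exact mul_nonneg (Real.exp_pos _).le hij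

/-- The row of ones intertwines `t • G` with the `1 × 1` zero matrix, whose exponential is `1`. -/
lemma exp_col_sum {G : Matrix ι ι ℝ} (hG : ∀ j, ∑ i, G i j = 0) (t : ℝ) (j : ι) :
    ∑ i, NormedSpace.exp (t • G) i j = 1 := by
  let A : Matrix Unit ι ℝ := Matrix.of fun _ _ => 1
  have h : A * (t • G) = (0 : Matrix Unit Unit ℝ) * A := by
    ext a b
    simp [A, Matrix.mul_apply, ← Finset.mul_sum, hG]
  have := congrFun (congrFun (exp_mul_eq_mul_exp A _ _ h) ()) j
  simpa [A, Matrix.mul_apply, NormedSpace.exp_zero] using this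

lemma tendsto_inv_smul_exp_sub_one (G : Matrix ι ι ℝ) :
    Tendsto (fun h : ℝ≥0 => (h : ℝ)⁻¹ • (NormedSpace.exp ((h : ℝ) • G) - 1)) (𝓝[>] 0) (𝓝 G) := by
  have h := (hasDerivAt_exp_smul_matrix G 0).tendsto_slope_zero_right
  simp only [zero_add, zero_smul, NormedSpace.exp_zero, one_mul] at h
  have hc : Tendsto (fun h : ℝ≥0 => (h : ℝ)) (𝓝[>] 0) (𝓝[>] 0) := by
    refine tendsto_nhdsWithin_of_tendsto_nhds_of_eventually_within _ ?_ ?_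
    · exact (NNReal.continuous_coe.tendsto' 0 0 rfl).mono_left nhdsWithin_le_nhds
    · filter_upwards [self_mem_nhdsWithin] with x hx
      exact NNReal.coe_pos.2 hx
  exact h.comp hc

lemma isTransitionSemigroup_exp {G : Matrix ι ι ℝ} (hoff : ∀ i j, i ≠ j → 0 ≤ G i j)
    (hcol : ∀ j, ∑ i, G i j = 0) :
    IsTransitionSemigroup (fun t : ℝ≥0 => NormedSpace.exp ((t : ℝ) • G)) G where
  nonneg t i j := exp_nonneg_of_offDiag_nonneg hoff t.2 i j
  col_sum t j := exp_col_sum hcol t j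
  zero := by simp [NormedSpace.exp_zero]
  add s t := by
    rw [NNReal.coe_add, add_smul, Matrix.exp_add_of_commute]
    exact ((Commute.refl G).smul_left _).smul_right _
  generator := tendsto_inv_smul_exp_sub_one G

namespace IsTransitionSemigroup

variable {P : ℝ≥0 → Matrix ι ι ℝ} {G : Matrix ι ι ℝ}

lemma tendsto_entry (h : IsTransitionSemigroup P G) (i j : ι) :
    Tendsto (fun u : ℝ≥0 => (u : ℝ)⁻¹ * (P u i j - (1 : Matrix ι ι ℝ) i j)) (𝓝[>] 0)
      (𝓝 (G i j)) := by
  have := ((continuous_apply j).tendsto _).comp (((continuous_apply i).tendsto _).comp h.generator)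
  exact this

lemma offDiag_nonneg (h : IsTransitionSemigroup P G) (i j : ι) (hij : i ≠ j) : 0 ≤ G i j := by
  refine ge_of_tendsto (h.tendsto_entry i j) (Eventually.of_forall fun u => ?_)
  rw [Matrix.one_apply_ne hij, sub_zero]
  exact mul_nonneg (inv_nonneg.2 u.2) (h.nonneg u i j)

lemma generator_col_sum (h : IsTransitionSemigroup P G) (j : ι) : ∑ i, G i j = 0 := by
  have h1 := tendsto_finsetSum Finset.univ fun i _ => h.tendsto_entry i j
  refine tendsto_nhds_unique h1 (tendsto_const_nhds.congr fun u => ?_)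
  rw [← Finset.mul_sum, Finset.sum_sub_distrib, h.col_sum]
  simp [Matrix.one_apply]

/-- The semigroup law turns the derivative at `0` into the right-hand equation `P' = G P`. Then
`exp(-uG) P_u` is continuous with right derivative zero, hence constant. -/
lemma eq_exp (h : IsTransitionSemigroup P G) (t : ℝ≥0) :
    P t = NormedSpace.exp ((t : ℝ) • G) := by
  -- the difference quotients at `0` control the increments from the right
  have hbd : ∀ u, ‖P u‖ ≤ Fintype.card ι := by
    intro u
    rw [Matrix.linfty_opNorm_def]
    have : ((Finset.univ.sup fun i => ∑ j, ‖P u i j‖₊ : ℝ≥0) : ℝ) ≤ (Fintype.card ι : ℝ≥0) := by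
      rw [NNReal.coe_le_coe]
      refine Finset.sup_le fun i _ => ?_
      -- The norm is a maximal row sum, while it is the columns that sum to one; bounding each entry
      -- by `1` is enough.
      calc ∑ j, ‖P u i j‖₊ ≤ ∑ _j : ι, (1 : ℝ≥0) := by
            refine Finset.sum_le_sum fun j _ => ?_
            rw [← NNReal.coe_le_coe, coe_nnnorm, Real.norm_of_nonneg (h.nonneg u i j),
              NNReal.coe_one, ← h.col_sum u j]
            exact Finset.single_le_sum (f := fun i => P u i j) (fun k _ => h.nonneg u k j)
              (Finset.mem_univ i)
        _ = Fintype.card ι := by simp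
    simpa using this
  let p : ℝ → Matrix ι ι ℝ := fun u => P u.toNNReal
  have hlim : Tendsto (fun u : ℝ => u⁻¹ • (p u - 1)) (𝓝[>] 0) (𝓝 G) := by
    have hc : Tendsto Real.toNNReal (𝓝[>] 0) (𝓝[>] 0) := by
      refine tendsto_nhdsWithin_of_tendsto_nhds_of_eventually_within _ ?_ ?_
      · exact (continuous_real_toNNReal.tendsto' 0 0 (by simp)).mono_left nhdsWithin_le_nhds
      · filter_upwards [self_mem_nhdsWithin] with x hx
        exact Real.toNNReal_pos.2 hx
    refine (h.generator.comp hc).congr' ?_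
    filter_upwards [self_mem_nhdsWithin] with x hx
    simp [p, Real.coe_toNNReal x (le_of_lt hx)]
  have hsmall : Tendsto (fun u : ℝ => p u - 1) (𝓝[>] 0) (𝓝 0) := by
    have h0 : Tendsto (fun u : ℝ => u) (𝓝[>] 0) (𝓝 0) := nhdsWithin_le_nhds
    have := h0.smul hlim
    rw [zero_smul] at this
    refine this.congr' ?_
    filter_upwards [self_mem_nhdsWithin] with x hx
    rw [smul_smul, mul_inv_cancel₀ (ne_of_gt hx), one_smul]
  have hadd : ∀ a b : ℝ, 0 ≤ a → 0 ≤ b → p (a + b) = p a * p b := by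
    intro a b ha hb
    simp only [p, Real.toNNReal_add ha hb, h.add]
  have hderiv : ∀ x, 0 ≤ x → HasDerivWithinAt p (G * p x) (Set.Ici x) x := by
    intro x hx
    refine hasDerivWithinAt_Ioi_iff_Ici.1 ((hasDerivWithinAt_iff_tendsto_slope' (by simp)).2 ?_)
    have hsh : Tendsto (fun y : ℝ => y - x) (𝓝[>] x) (𝓝[>] 0) := by
      refine tendsto_nhdsWithin_of_tendsto_nhds_of_eventually_within _ ?_ ?_
      · exact ((continuous_id.sub continuous_const).tendsto' x 0 (by simp)).mono_left
          nhdsWithin_le_nhds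
      · filter_upwards [self_mem_nhdsWithin] with y hy
        exact sub_pos.2 (Set.mem_Ioi.1 hy)
    have := (hlim.comp hsh).mul_const (p x)
    refine this.congr' ?_
    filter_upwards [self_mem_nhdsWithin] with y hy
    have hy' : 0 ≤ y - x := (sub_pos.2 (Set.mem_Ioi.1 hy)).le
    have e : p y = p (y - x) * p x := by rw [← hadd _ _ hy' hx, sub_add_cancel]
    simp only [Function.comp, slope, vsub_eq_sub, e, smul_mul_assoc, sub_mul, one_mul]
  -- Left continuity does not come from the right derivative; it follows from `p x - p y = (p (x -
  -- y) - 1) * p y` and the uniform bound on `p`.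
  have hcont : ContinuousOn p (Set.Ici 0) := by
    intro x hx
    have hr : ContinuousWithinAt p (Set.Ici x) x := (hderiv x hx).continuousWithinAt
    have hl : ContinuousWithinAt p (Set.Icc 0 x) x := by
      refine Metric.continuousWithinAt_iff.2 ?_
      intro ε hε
      have hN : (0 : ℝ) < Fintype.card ι + 1 := by positivity
      have := Metric.tendsto_nhdsWithin_nhds.1 hsmall (ε / (Fintype.card ι + 1)) (by positivity)
      obtain ⟨δ, hδ, H⟩ := this
      refine ⟨δ, hδ, fun {y} hy hd => ?_⟩
      rcases eq_or_lt_of_le hy.2 with rfl | hlt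
      · simpa using hε
      have hH := H (x := x - y) (sub_pos.2 hlt) (by
        rw [dist_zero_right, Real.norm_of_nonneg (sub_pos.2 hlt).le]
        rw [Real.dist_eq, abs_sub_comm, abs_of_pos (sub_pos.2 hlt)] at hd
        exact hd)
      rw [dist_zero_right] at hH
      have e : p x = p (x - y) * p y := by
        rw [← hadd _ _ (sub_pos.2 hlt).le hy.1, sub_add_cancel]
      rw [dist_comm, dist_eq_norm, e, show p (x - y) * p y - p y = (p (x - y) - 1) * p y by
        rw [sub_mul, one_mul]]
      calc ‖(p (x - y) - 1) * p y‖ ≤ ‖p (x - y) - 1‖ * ‖p y‖ := norm_mul_le _ _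
        _ ≤ ‖p (x - y) - 1‖ * (Fintype.card ι + 1) := by
            gcongr
            exact (hbd _).trans (by linarith)
        _ < ε / (Fintype.card ι + 1) * (Fintype.card ι + 1) := by gcongr
        _ = ε := by field_simp
    have : Set.Ici (0 : ℝ) ⊆ Set.Icc 0 x ∪ Set.Ici x := by
      intro y hy
      rcases le_total y x with h | h
      · exact Or.inl ⟨hy, h⟩
      · exact Or.inr h
    exact (hl.union hr).mono this
  have hE : ∀ x : ℝ, HasDerivAt (fun u : ℝ => NormedSpace.exp (u • (-G)))
      (NormedSpace.exp (x • (-G)) * (-G)) x := fun x => hasDerivAt_exp_smul_matrix (-G) x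
  have hconst := constant_of_has_deriv_right_zero
    (f := fun u : ℝ => NormedSpace.exp (u • (-G)) * p u) (a := 0) (b := t)
    (ContinuousOn.mul (fun x _ => (hE x).continuousAt.continuousWithinAt)
      (hcont.mono Set.Icc_subset_Ici_self))
    (fun x hx => by
      have := (hE x).hasDerivWithinAt (s := Set.Ici x) |>.mul (hderiv x hx.1)
      convert! this using 1
      rw [mul_neg, neg_mul, mul_assoc, neg_add_cancel]) t (Set.right_mem_Icc.2 t.2)
  simp only [zero_smul, NormedSpace.exp_zero, one_mul] at hconst
  have h0 : p 0 = 1 := by simp [p, h.zero]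
  have ht : p t = P t := by simp [p]
  rw [h0, ht] at hconst
  have hinv : NormedSpace.exp ((t : ℝ) • G) * NormedSpace.exp ((t : ℝ) • (-G)) = 1 := by
    rw [← Matrix.exp_add_of_commute _ _
      ((((Commute.refl G).neg_right).smul_left _).smul_right _), smul_neg, add_neg_cancel,
      NormedSpace.exp_zero]
  calc P t = NormedSpace.exp ((t : ℝ) • G) * (NormedSpace.exp ((t : ℝ) • (-G)) * P t) := by
        rw [← mul_assoc, hinv, one_mul]
    _ = _ := by rw [hconst, mul_one]

end IsTransitionSemigroup

lemma exp_add_smul (M : Matrix ι ι ℝ) (a b : ℝ) :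
    NormedSpace.exp ((a + b) • M) = NormedSpace.exp (a • M) * NormedSpace.exp (b • M) := by
  rw [add_smul, Matrix.exp_add_of_commute]
  exact ((Commute.refl M).smul_left _).smul_right _

/-- `exp (h Q) - exp (h (Q - D)) - h D = o(h)` as `h ↓ 0`. -/
lemma exists_norm_exp_sub_exp_le (Q D : Matrix ι ι ℝ) {ε : ℝ} (hε : 0 < ε) :
    ∃ δ > 0, ∀ h : ℝ, 0 ≤ h → h < δ →
      ‖NormedSpace.exp (h • Q) - NormedSpace.exp (h • (Q - D)) - h • D‖ ≤ ε * h := by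
  -- At `h = 0` the combination has value zero and derivative `Q - (Q - D) - D = 0`.
  have h1 := ((hasDerivAt_exp_smul_matrix Q 0).sub (hasDerivAt_exp_smul_matrix (Q - D) 0)).sub
    ((hasDerivAt_id (0 : ℝ)).smul_const D)
  simp only [zero_smul, NormedSpace.exp_zero, one_mul, one_smul, sub_sub_cancel, sub_self] at h1
  have h2 := (hasDerivAt_iff_isLittleO.1 h1).def hε
  obtain ⟨δ, hδ, H⟩ := Metric.eventually_nhds_iff.1 h2
  refine ⟨δ, hδ, fun h h0 hh => ?_⟩
  have := H (y := h) (by rwa [dist_zero_right, Real.norm_of_nonneg h0])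
  simpa [NormedSpace.exp_zero, Real.norm_of_nonneg h0, abs_of_nonneg h0] using this

lemma exists_norm_exp_sub_one_le (Q : Matrix ι ι ℝ) {ε : ℝ} (hε : 0 < ε) :
    ∃ δ > 0, ∀ h : ℝ, 0 ≤ h → h < δ → ‖NormedSpace.exp (h • Q) - 1‖ ≤ ε := by
  have h2 := (hasDerivAt_exp_smul_matrix Q 0).continuousAt
  obtain ⟨δ, hδ, H⟩ := Metric.continuousAt_iff.1 h2 ε hε
  refine ⟨δ, hδ, fun h h0 hh => ?_⟩
  have := H (x := h) (by rwa [dist_zero_right, Real.norm_of_nonneg h0])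
  simpa [NormedSpace.exp_zero, dist_eq_norm] using this.le

lemma exists_norm_exp_le (Q : Matrix ι ι ℝ) (T : ℝ) :
    ∃ C > 0, ∀ h : ℝ, |h| ≤ T → ‖NormedSpace.exp (h • Q)‖ ≤ C := by
  have hc : Continuous fun u : ℝ => NormedSpace.exp (u • Q) :=
    continuous_iff_continuousAt.2 fun t => (hasDerivAt_exp_smul_matrix Q t).continuousAt
  obtain ⟨C, hC⟩ := (isCompact_Icc (a := -T) (b := T)).exists_bound_of_continuousOn hc.continuousOn
  exact ⟨max C 1, by positivity, fun h hh => (hC h (abs_le.1 hh)).trans (le_max_left _ _)⟩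

end Matrices

/-! ### Uniform partitions and simultaneous increments. -/

section Partitions

/-- The `k`-th point of the uniform partition of `[s, t]` into `m + 1` intervals. -/
noncomputable def gridPoint (s t : ℝ≥0) (m k : ℕ) : ℝ≥0 := s + (k / (m + 1)) * (t - s)

lemma gridPoint_zero (s t : ℝ≥0) (m : ℕ) : gridPoint s t m 0 = s := by simp [gridPoint]

lemma gridPoint_last {s t : ℝ≥0} (h : s ≤ t) (m : ℕ) : gridPoint s t m (m + 1) = t := by
  have : ((m : ℝ≥0) + 1) ≠ 0 := by positivity
  simp [gridPoint, add_tsub_cancel_of_le h]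

lemma gridPoint_mono (s t : ℝ≥0) (m : ℕ) : Monotone (gridPoint s t m) := by
  intro a b hab
  unfold gridPoint
  gcongr

lemma le_gridPoint (s t : ℝ≥0) (m k : ℕ) : s ≤ gridPoint s t m k := le_self_add

lemma gridPoint_le {s t : ℝ≥0} (h : s ≤ t) {m k : ℕ} (hk : k ≤ m + 1) : gridPoint s t m k ≤ t :=
  (gridPoint_mono s t m hk).trans_eq (gridPoint_last h m)

lemma gridPoint_succ_sub {s t : ℝ≥0} (h : s ≤ t) (m k : ℕ) :
    (gridPoint s t m (k + 1) : ℝ) - gridPoint s t m k = ((t : ℝ) - s) / (m + 1) := by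
  simp only [gridPoint]
  push_cast [NNReal.coe_sub h]
  ring

lemma tendsto_mesh (s t : ℝ≥0) :
    Tendsto (fun m : ℕ => ((t : ℝ) - s) / ((m : ℝ) + 1)) atTop (𝓝 0) := by
  have := (tendsto_const_div_atTop_nhds_zero_nat ((t : ℝ) - s)).comp (tendsto_add_atTop_nat 1)
  refine this.congr fun m => ?_
  simp

/-- The increments telescope along a uniform partition. The error `κ` need not be small compared
with the length of a single interval; only its sum over the partition must vanish, which is all that
is known for common increments of `X` and `Y`. -/
lemma eq_of_sum_increments_tendsto {E : Type*} [NormedAddCommGroup E] (g : ℝ≥0 → E) {s t : ℝ≥0}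
    (hst : s ≤ t) (κ : ℝ≥0 → ℝ≥0 → ℝ)
    (hg : ∀ ε > 0, ∃ δ > 0, ∀ u v : ℝ≥0, s ≤ u → u ≤ v → v ≤ t → (v : ℝ) - u < δ →
      ‖g v - g u‖ ≤ ε * ((v : ℝ) - u) + κ u v)
    (hκ : Tendsto (fun m : ℕ => ∑ k ∈ Finset.range (m + 1),
      κ (gridPoint s t m k) (gridPoint s t m (k + 1))) atTop (𝓝 0)) : g t = g s := by
  rw [← sub_eq_zero, ← norm_le_zero_iff]
  refine le_of_forall_pos_le_add fun ε hε => ?_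
  have hts : 0 ≤ (t : ℝ) - s := sub_nonneg.2 hst
  -- The `+ 1` keeps the denominator positive when `s = t`.
  obtain ⟨δ, hδ, H⟩ := hg (ε / ((t : ℝ) - s + 1)) (by positivity)
  have hlim : Tendsto (fun m : ℕ => ε + ∑ k ∈ Finset.range (m + 1),
      κ (gridPoint s t m k) (gridPoint s t m (k + 1))) atTop (𝓝 (0 + ε)) := by
    simpa [add_comm] using hκ.const_add ε
  refine ge_of_tendsto hlim ?_
  filter_upwards [(tendsto_mesh s t).eventually_lt_const hδ] with m hm
  have htel : g t - g s = ∑ k ∈ Finset.range (m + 1),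
      (g (gridPoint s t m (k + 1)) - g (gridPoint s t m k)) := by
    rw [Finset.sum_range_sub (fun k => g (gridPoint s t m k)), gridPoint_zero,
      gridPoint_last hst]
  rw [htel]
  calc _ ≤ ∑ k ∈ Finset.range (m + 1), (ε / ((t : ℝ) - s + 1) * (((t : ℝ) - s) / (m + 1)) +
        κ (gridPoint s t m k) (gridPoint s t m (k + 1))) := by
        refine norm_sum_le_of_le _ fun k hk => ?_
        have hk' : k + 1 ≤ m + 1 := Finset.mem_range.1 hk
        have := H (gridPoint s t m k) (gridPoint s t m (k + 1)) (le_gridPoint s t m k)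
          (gridPoint_mono s t m k.le_succ) (gridPoint_le hst hk')
          (by rw [gridPoint_succ_sub hst]; exact hm)
        rwa [gridPoint_succ_sub hst] at this
    _ ≤ _ := by
        rw [Finset.sum_add_distrib]
        gcongr
        rw [Finset.sum_const, Finset.card_range, nsmul_eq_mul]
        push_cast
        have h1 : ((m : ℝ) + 1) ≠ 0 := by positivity
        have h2 : ((t : ℝ) - s + 1) ≠ 0 := by positivity
        calc ((m : ℝ) + 1) * (ε / ((t : ℝ) - s + 1) * (((t : ℝ) - s) / (m + 1)))
            = ε * (((t : ℝ) - s) / ((t : ℝ) - s + 1)) := by field_simp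
          _ ≤ ε * 1 := by
              gcongr
              rw [div_le_one (by positivity)]
              linarith
          _ = ε := mul_one ε

lemma defaultInd_eq_ite {Ω : Type*} (τ : Ω → ℝ≥0∞) (t : ℝ≥0) (ω : Ω) [Decidable (τ ω ≤ t)] :
    defaultInd τ t ω = if τ ω ≤ t then 1 else 0 := by
  simp only [defaultInd, Set.indicator_apply, Set.mem_ofPred_eq, Pi.one_apply]

lemma defaultInd_eq_one {Ω : Type*} {τ : Ω → ℝ≥0∞} {t : ℝ≥0} {ω : Ω} (h : τ ω ≤ t) :
    defaultInd τ t ω = 1 := by classical rw [defaultInd_eq_ite, if_pos h]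

lemma defaultInd_eq_zero {Ω : Type*} {τ : Ω → ℝ≥0∞} {t : ℝ≥0} {ω : Ω} (h : (t : ℝ≥0∞) < τ ω) :
    defaultInd τ t ω = 0 := by classical rw [defaultInd_eq_ite, if_neg (not_le.2 h)]

lemma defaultInd_mono {Ω : Type*} (τ : Ω → ℝ≥0∞) (ω : Ω) {s t : ℝ≥0} (h : s ≤ t) :
    defaultInd τ s ω ≤ defaultInd τ t ω := by
  classical
  rcases le_or_gt (τ ω) s with h1 | h1
  · rw [defaultInd_eq_one h1, defaultInd_eq_one (h1.trans (by exact_mod_cast h))]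
  · rw [defaultInd_eq_zero h1, defaultInd_eq_ite]
    split_ifs <;> norm_num

lemma defaultInd_nonneg {Ω : Type*} (τ : Ω → ℝ≥0∞) (t : ℝ≥0) (ω : Ω) : 0 ≤ defaultInd τ t ω := by
  classical
  rw [defaultInd_eq_ite]; split_ifs <;> norm_num

lemma defaultInd_le_one {Ω : Type*} (τ : Ω → ℝ≥0∞) (t : ℝ≥0) (ω : Ω) : defaultInd τ t ω ≤ 1 := by
  classical
  rw [defaultInd_eq_ite]; split_ifs <;> norm_num

/-- A path without a jump at the default time varies little over the grid interval which contains
the default time. -/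
lemma tendsto_sum_common_increments {Ω E : Type*} [NormedAddCommGroup E] [Module ℝ E]
    [Module.IsTorsionFree ℝ E] {τ : Ω → ℝ≥0∞}
    {ω : Ω} {x : ℝ≥0 → E} (hx : IsCadlag x)
    (hj : ∀ t, jump (fun u => defaultInd τ u ω) t • jump x t = 0) {s t : ℝ≥0} (hst : s ≤ t) :
    Tendsto (fun m : ℕ => ∑ k ∈ Finset.range (m + 1),
      ‖x (gridPoint s t m (k + 1)) - x (gridPoint s t m k)‖ *
        (defaultInd τ (gridPoint s t m (k + 1)) ω - defaultInd τ (gridPoint s t m k) ω))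
      atTop (𝓝 0) := by
  have hnn : ∀ m k, 0 ≤ ‖x (gridPoint s t m (k + 1)) - x (gridPoint s t m k)‖ *
        (defaultInd τ (gridPoint s t m (k + 1)) ω - defaultInd τ (gridPoint s t m k) ω) :=
    fun m k => mul_nonneg (norm_nonneg _)
      (sub_nonneg.2 (defaultInd_mono τ ω (gridPoint_mono s t m k.le_succ)))
  rcases le_or_gt (τ ω) s with h1 | h1
  · refine tendsto_const_nhds.congr fun m => (Finset.sum_eq_zero fun k _ => ?_).symm
    have h2 : ∀ k, τ ω ≤ gridPoint s t m k := fun k =>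
      h1.trans (by exact_mod_cast le_gridPoint s t m k)
    rw [defaultInd_eq_one (h2 _), defaultInd_eq_one (h2 _), sub_self, mul_zero]
  rcases lt_or_ge (t : ℝ≥0∞) (τ ω) with h2 | h2
  · refine tendsto_const_nhds.congr fun m => (Finset.sum_eq_zero fun k hk => ?_).symm
    have h3 : ∀ k, k ≤ m + 1 → (gridPoint s t m k : ℝ≥0∞) < τ ω := fun k hk =>
      lt_of_le_of_lt (by exact_mod_cast gridPoint_le hst hk) h2
    have hk' := Finset.mem_range.1 hk
    rw [defaultInd_eq_zero (h3 _ (by omega)), defaultInd_eq_zero (h3 _ (by omega)), sub_self,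
      mul_zero]
  lift τ ω to ℝ≥0 using ne_top_of_le_ne_top ENNReal.coe_ne_top h2 with T hT
  have hsT : s < T := by exact_mod_cast h1
  -- The default time lies in `(s, t]`, so it has points to its left and the left limits are
  -- genuine.
  have : (𝓝[<] T).NeBot := nhdsLT_neBot_of_exists_lt ⟨s, hsT⟩
  obtain ⟨hr, l, hl⟩ := hx T
  -- The default indicator jumps by `1` at `T`, so the hypothesis forces the jump of `x` at `T` to
  -- vanish.
  have hjx : x T = l := by
    have hxl : Function.leftLim x T = l := leftLim_eq_of_tendsto hl
    have hyl : Function.leftLim (fun u => defaultInd τ u ω) T = 0 := by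
      refine leftLim_eq_of_tendsto (tendsto_const_nhds.congr' ?_)
      filter_upwards [self_mem_nhdsWithin] with u hu
      rw [defaultInd_eq_zero]
      rw [← hT]
      exact_mod_cast hu
    have := hj T
    rw [jump, jump, hxl, hyl, defaultInd_eq_one hT.ge, sub_zero, one_smul, sub_eq_zero] at this
    exact this
  rw [Metric.tendsto_atTop]
  intro ε hε
  obtain ⟨δ₁, hδ₁, H₁⟩ := Metric.continuousWithinAt_iff.1 hr (ε / 4) (by positivity)
  obtain ⟨δ₂, hδ₂, H₂⟩ := Metric.tendsto_nhdsWithin_nhds.1 hl (ε / 4) (by positivity)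
  obtain ⟨M, hM⟩ := eventually_atTop.1
    ((tendsto_mesh s t).eventually_lt_const (lt_min hδ₁ hδ₂))
  refine ⟨M, fun m hm => ?_⟩
  rw [dist_zero_right, Real.norm_of_nonneg (Finset.sum_nonneg fun k _ => hnn m k)]
  -- Only the interval containing `T` contributes. Its end points lie on the two sides of `T`, and
  -- `x` is within `ε / 4` of the common limit `l` at each of them.
  calc _ ≤ ∑ k ∈ Finset.range (m + 1), ε / 2 *
        (defaultInd τ (gridPoint s t m (k + 1)) ω - defaultInd τ (gridPoint s t m k) ω) := by
        refine Finset.sum_le_sum fun k hk => ?_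
        rcases le_or_gt (τ ω) (gridPoint s t m k) with h3 | h3
        · rw [defaultInd_eq_one h3, defaultInd_eq_one
            (h3.trans (by exact_mod_cast gridPoint_mono s t m k.le_succ))]
          simp
        rcases lt_or_ge (gridPoint s t m (k + 1) : ℝ≥0∞) (τ ω) with h4 | h4
        · rw [defaultInd_eq_zero h3, defaultInd_eq_zero h4]
          simp
        refine mul_le_mul_of_nonneg_right ?_
          (sub_nonneg.2 (defaultInd_mono τ ω (gridPoint_mono s t m k.le_succ)))
        rw [← hT] at h3 h4
        have h3' : gridPoint s t m k < T := by exact_mod_cast h3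
        have h4' : T ≤ gridPoint s t m (k + 1) := by exact_mod_cast h4
        have h3r : (gridPoint s t m k : ℝ) < T := h3'
        have h4r : (T : ℝ) ≤ gridPoint s t m (k + 1) := h4'
        have hmesh := hM m hm
        rw [← gridPoint_succ_sub hst m k] at hmesh
        have e1 := H₁ (x := gridPoint s t m (k + 1)) h4' (by
          rw [NNReal.dist_eq, abs_of_nonneg (by linarith)]
          linarith [min_le_left δ₁ δ₂])
        have e2 := H₂ (x := gridPoint s t m k) h3' (by
          rw [NNReal.dist_eq, abs_of_nonpos (by linarith)]
          linarith [min_le_right δ₁ δ₂])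
        rw [hjx] at e1
        rw [← dist_eq_norm]
        linarith [dist_triangle_right (x (gridPoint s t m (k + 1))) (x (gridPoint s t m k)) l]
    _ = ε / 2 * (defaultInd τ t ω - defaultInd τ s ω) := by
        rw [← Finset.mul_sum, Finset.sum_range_sub (fun k => defaultInd τ (gridPoint s t m k) ω),
          gridPoint_zero, gridPoint_last hst]
    _ ≤ ε / 2 * 1 := by
        gcongr
        linarith [defaultInd_le_one τ t ω, defaultInd_nonneg τ s ω]
    _ < ε := by linarith

end Partitions

/-! ### Joint measurability and time integrals of right-continuous processes. -/

section Measurability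

/-- Time is rounded up to a grid of step `1 / (n + 1)`. Each approximation takes countably many
times, and the rounded times approach `r` from the right, where the paths are continuous. -/
lemma measurable_uncurry_of_rightContinuous {Ω : Type*} {m : MeasurableSpace Ω}
    {f : ℝ≥0 → Ω → ℝ} (hf : ∀ r, Measurable (f r))
    (hc : ∀ ω r, ContinuousWithinAt (fun u => f u ω) (Set.Ici r) r) :
    Measurable fun p : Ω × ℝ≥0 => f p.2 p.1 := by
  let ρ : ℕ → ℝ≥0 → ℝ≥0 := fun n r => (⌊r * (n + 1)⌋₊ + 1) / (n + 1)
  have hρ : ∀ r, Tendsto (fun n => ρ n r) atTop (𝓝[≥] r) := by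
    intro r
    have hlow : ∀ n, r ≤ ρ n r := fun n => by
      rw [le_div_iff₀ (by positivity)]
      exact (Nat.lt_floor_add_one _).le
    refine tendsto_nhdsWithin_of_tendsto_nhds_of_eventually_within _ ?_
      (Eventually.of_forall hlow)
    have hup : ∀ n, ρ n r ≤ r + 1 / ((n : ℝ≥0) + 1) := fun n => by
      rw [div_le_iff₀ (by positivity), add_mul, one_div, inv_mul_cancel₀ (by positivity)]
      gcongr
      exact Nat.floor_le (by positivity)
    have hlim : Tendsto (fun n : ℕ => r + 1 / ((n : ℝ≥0) + 1)) atTop (𝓝 (r + 0)) := by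
      refine tendsto_const_nhds.add ?_
      rw [← NNReal.tendsto_coe]
      push_cast
      exact tendsto_one_div_add_atTop_nhds_zero_nat
    rw [add_zero] at hlim
    exact tendsto_of_tendsto_of_tendsto_of_le_of_le tendsto_const_nhds hlim hlow hup
  refine measurable_of_tendsto_metrizable (f := fun n (p : Ω × ℝ≥0) => f (ρ n p.2) p.1)
    (fun n => ?_) (tendsto_pi_nhds.2 fun p => ?_)
  · have h1 : Measurable (Function.uncurry fun (ω : Ω) (k : ℕ) => f ((k + 1) / (n + 1)) ω) :=
      measurable_from_prod_countable_left fun k : ℕ => hf ((k + 1) / (n + 1))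
    have h2 : Measurable fun p : Ω × ℝ≥0 => (p.1, ⌊p.2 * (n + 1)⌋₊) :=
      measurable_fst.prodMk (Nat.measurable_floor.comp (measurable_snd.mul_const _))
    simpa only [Function.comp_def, Function.uncurry_apply_pair] using h1.comp h2
  · exact (hc p.1 p.2).tendsto.comp (hρ p.2)

/-- The time integral over `[s, t]` of a bounded right-continuous process is measurable with
respect to every σ-algebra which measures the process up to time `t`. -/
lemma measurable_intervalIntegral_of_rightContinuous {Ω : Type*} {m : MeasurableSpace Ω}
    {f : ℝ≥0 → Ω → ℝ} {s t : ℝ≥0} (hst : s ≤ t) (hf : ∀ r ≤ t, Measurable (f r))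
    (hc : ∀ ω r, ContinuousWithinAt (fun u => f u ω) (Set.Ici r) r) :
    Measurable fun ω => ∫ r in (s : ℝ)..t, f r.toNNReal ω := by
  -- Freezing the process at time `t` makes every section measurable for `m`, although nothing is
  -- assumed after `t`.
  have h1 : Measurable fun p : Ω × ℝ≥0 => f (min p.2 t) p.1 := by
    refine measurable_uncurry_of_rightContinuous (f := fun r => f (min r t))
      (fun r => hf _ (min_le_right _ _)) fun ω r => ?_
    refine (hc ω (min r t)).comp (t := Set.Ici (min r t)) (f := fun u => min u t)
      (by fun_prop) fun u hu => ?_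
    exact min_le_min_right t hu
  have h2 : Measurable fun p : Ω × ℝ => f (min p.2.toNNReal t) p.1 :=
    h1.comp (measurable_fst.prodMk measurable_snd.real_toNNReal)
  have h3 : StronglyMeasurable fun ω => ∫ r in Set.Ioc (s : ℝ) t, f (min r.toNNReal t) ω :=
    h2.stronglyMeasurable.integral_prod_right
  convert h3.measurable using 1
  funext ω
  rw [intervalIntegral.integral_of_le (by exact_mod_cast hst)]
  refine setIntegral_congr_fun measurableSet_Ioc fun r hr => ?_
  have : r.toNNReal ≤ t := Real.toNNReal_le_iff_le_coe.2 hr.2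
  simp only [min_eq_left this]

lemma integrable_of_bounded {Ω : Type*} {mΩ : MeasurableSpace Ω} {μ : Measure Ω}
    [IsFiniteMeasure μ] {f : Ω → ℝ} (hf : Measurable f) {C : ℝ} (h : ∀ ω, |f ω| ≤ C) :
    Integrable f μ :=
  Integrable.of_bound hf.aestronglyMeasurable C (Eventually.of_forall h)

/-- The mean oscillation of a bounded process controls the error of the rectangle rule. -/
lemma integral_abs_intervalIntegral_sub_le {Ω : Type*} {mΩ : MeasurableSpace Ω} {μ : Measure Ω}
    [IsProbabilityMeasure μ] {V : ℝ≥0 → Ω → ℝ}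
    (hV : Measurable fun p : Ω × ℝ≥0 => V p.2 p.1) {K ε : ℝ} (hK : ∀ r ω, |V r ω| ≤ K)
    {u v : ℝ≥0} (huv : u ≤ v)
    (hε : ∀ r, u ≤ r → r ≤ v → ∫ ω, |V r ω - V u ω| ∂μ ≤ ε) :
    ∫ ω, |(∫ r in (u : ℝ)..v, V r.toNNReal ω) - ((v : ℝ) - u) * V u ω| ∂μ ≤
      ε * ((v : ℝ) - u) := by
  have huv' : (u : ℝ) ≤ v := huv
  have hVr : ∀ r, Measurable (V r) := fun r => hV.comp (measurable_id.prodMk measurable_const)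
  have hV2 : Measurable fun p : Ω × ℝ => V p.2.toNNReal p.1 :=
    hV.comp (measurable_fst.prodMk measurable_snd.real_toNNReal)
  have hD : Measurable fun p : Ω × ℝ => |V p.2.toNNReal p.1 - V u p.1| :=
    (hV2.sub ((hVr u).comp measurable_fst)).abs
  have hDb : ∀ r ω, |V r ω - V u ω| ≤ 2 * K := fun r ω =>
    (abs_sub _ _).trans (by linarith [hK r ω, hK u ω])
  have hint : ∀ ω, IntervalIntegrable (fun r : ℝ => V r.toNNReal ω) volume u v := by
    intro ω
    rw [intervalIntegrable_iff_integrableOn_Ioc_of_le huv']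
    refine Integrable.of_bound (hV2.comp
      (measurable_const.prodMk measurable_id)).aestronglyMeasurable K
      (Eventually.of_forall fun r => hK _ _)
  have hintD : Integrable (Function.uncurry fun (ω : Ω) (r : ℝ) => |V r.toNNReal ω - V u ω|)
      (μ.prod (volume.restrict (Set.Ioc (u : ℝ) v))) :=
    Integrable.of_bound hD.aestronglyMeasurable (2 * K) (Eventually.of_forall fun p => by
      rw [Function.uncurry, Real.norm_eq_abs, abs_abs]; exact hDb _ _)
  calc _ ≤ ∫ ω, (∫ r in Set.Ioc (u : ℝ) v, |V r.toNNReal ω - V u ω|) ∂μ := by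
        refine integral_mono_of_nonneg (Eventually.of_forall fun ω => abs_nonneg _)
          hintD.integral_prod_left (Eventually.of_forall fun ω => ?_)
        have e : ((v : ℝ) - u) * V u ω = ∫ _r in (u : ℝ)..v, V u ω := by
          rw [intervalIntegral.integral_const, smul_eq_mul]
        change |_ - _| ≤ ∫ r in Set.Ioc (u : ℝ) v, |V r.toNNReal ω - V u ω|
        rw [e, ← intervalIntegral.integral_sub (hint ω) intervalIntegrable_const,
          ← intervalIntegral.integral_of_le huv']
        exact intervalIntegral.abs_integral_le_integral_abs huv'
    _ = ∫ r in Set.Ioc (u : ℝ) v, (∫ ω, |V r.toNNReal ω - V u ω| ∂μ) :=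
        integral_integral_swap hintD
    _ ≤ ∫ _r in Set.Ioc (u : ℝ) v, ε := by
        refine setIntegral_mono_on hintD.integral_prod_right (integrable_const _)
          measurableSet_Ioc fun r hr => ?_
        exact hε _ (NNReal.le_toNNReal_of_coe_le hr.1.le) (Real.toNNReal_le_iff_le_coe.2 hr.2)
    _ = ε * ((v : ℝ) - u) := by
        simp [Measure.real, huv', mul_comm]

end Measurability

/-! ### Weighted means and conditional expectations. -/

section WeightedMean

variable {Ω : Type*} {mΩ : MeasurableSpace Ω} {ι : Type*} [Fintype ι]

/-- The mean of the random vector `Z` with the scalar weight `W`. -/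
noncomputable def weightedMean (μ : Measure Ω) (W : Ω → ℝ) (Z : Ω → ι → ℝ) : ι → ℝ :=
  fun i => ∫ ω, W ω * Z ω i ∂μ

lemma norm_weightedMean_le {μ : Measure Ω} {W B : Ω → ℝ} {Z : Ω → ι → ℝ} (hB : Integrable B μ)
    (h : ∀ ω i, |W ω * Z ω i| ≤ B ω) (h0 : 0 ≤ ∫ ω, B ω ∂μ) :
    ‖weightedMean μ W Z‖ ≤ ∫ ω, B ω ∂μ := by
  refine (pi_norm_le_iff_of_nonneg h0).2 fun i => ?_
  exact norm_integral_le_of_norm_le hB (Eventually.of_forall fun ω => h ω i)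

end WeightedMean

/-- A bounded `m`-measurable weight can be pulled through the conditional expectation. This puts
both the Markov and the martingale property into tested form. -/
lemma integral_mul_congr_of_condExp {Ω : Type*} {m mΩ : MeasurableSpace Ω} {μ : Measure Ω}
    [IsFiniteMeasure μ] (hm : m ≤ mΩ) {f g W : Ω → ℝ} (hf : Integrable f μ) (hg : Integrable g μ)
    (hW : Measurable[m] W) {C : ℝ} (hC : ∀ ω, |W ω| ≤ C) (h : μ[f|m] =ᵐ[μ] μ[g|m]) :
    ∫ ω, W ω * f ω ∂μ = ∫ ω, W ω * g ω ∂μ := by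
  have key : ∀ k : Ω → ℝ, Integrable k μ → ∫ ω, W ω * k ω ∂μ = ∫ ω, W ω * (μ[k|m]) ω ∂μ := by
    intro k hk
    have h1 : Integrable (W * k) μ :=
      hk.bdd_mul (hW.mono hm le_rfl).aestronglyMeasurable (Eventually.of_forall hC)
    have h2 := condExp_mul_of_stronglyMeasurable_left (μ := μ) hW.stronglyMeasurable h1 hk
    exact (integral_condExp hm).symm.trans (integral_congr_ae h2)
  rw [key f hf, key g hg]
  refine integral_congr_ae ?_
  filter_upwards [h] with ω hω
  rw [hω]

lemma apply_eq_one_iff_of_basis {ι : Type*} [DecidableEq ι] {x : ι → ℝ}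
    (hx : ∃ j, x = Pi.single j 1) (i : ι) : x i = 1 ↔ x = Pi.single i 1 := by
  refine ⟨fun h1 => ?_, fun h1 => by simp [h1]⟩
  obtain ⟨j, hj⟩ := hx
  rw [hj, Pi.single_apply] at h1
  split_ifs at h1 with hij
  · rw [hj, hij]
  · simp at h1

lemma indicator_eq_apply_of_basis {Ω ι : Type*} [DecidableEq ι] {Z : Ω → ι → ℝ}
    (hZ : ∀ ω, ∃ j, Z ω = Pi.single j 1) (i : ι) :
    ({ω | Z ω = Pi.single i 1}.indicator fun _ => (1 : ℝ)) = fun ω => Z ω i := by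
  funext ω
  by_cases h1 : Z ω = Pi.single i 1
  · rw [Set.indicator_of_mem (by exact h1), (apply_eq_one_iff_of_basis (hZ ω) i).2 h1]
  · rw [Set.indicator_of_notMem (by exact h1)]
    obtain ⟨j, hj⟩ := hZ ω
    have hij : i ≠ j := fun hij => h1 (hij ▸ hj)
    rw [hj, Pi.single_eq_of_ne hij]

/-! ### Finite Markov chains in tested form. -/

namespace IsMarkovChain

variable {Ω : Type*} {mΩ : MeasurableSpace Ω} {ι : Type*} [Fintype ι] [DecidableEq ι]
  {μ : Measure Ω} {𝓕 : Filtration ℝ≥0 mΩ} {X : ℝ≥0 → Ω → ι → ℝ} {Q : Matrix ι ι ℝ}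

lemma apply_eq_zero_or_one (h : IsMarkovChain μ 𝓕 X Q) (t : ℝ≥0) (ω : Ω) (i : ι) :
    X t ω i = 0 ∨ X t ω i = 1 := by
  obtain ⟨j, hj⟩ := h.basis t ω
  rw [hj, Pi.single_apply]
  split_ifs <;> simp

lemma nonneg (h : IsMarkovChain μ 𝓕 X Q) (t : ℝ≥0) (ω : Ω) (i : ι) : 0 ≤ X t ω i := by
  rcases h.apply_eq_zero_or_one t ω i with h | h <;> simp [h]

lemma le_one (h : IsMarkovChain μ 𝓕 X Q) (t : ℝ≥0) (ω : Ω) (i : ι) : X t ω i ≤ 1 := by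
  rcases h.apply_eq_zero_or_one t ω i with h | h <;> simp [h]

lemma abs_le_one (h : IsMarkovChain μ 𝓕 X Q) (t : ℝ≥0) (ω : Ω) (i : ι) : |X t ω i| ≤ 1 := by
  rw [abs_of_nonneg (h.nonneg t ω i)]; exact h.le_one t ω i

lemma sum_eq_one (h : IsMarkovChain μ 𝓕 X Q) (t : ℝ≥0) (ω : Ω) : ∑ i, X t ω i = 1 := by
  obtain ⟨j, hj⟩ := h.basis t ω
  simp [hj]

lemma eq_one_iff (h : IsMarkovChain μ 𝓕 X Q) (t : ℝ≥0) (ω : Ω) (i : ι) :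
    X t ω i = 1 ↔ X t ω = Pi.single i 1 :=
  apply_eq_one_iff_of_basis (h.basis t ω) i

lemma indicator_eq (h : IsMarkovChain μ 𝓕 X Q) (t : ℝ≥0) (i : ι) :
    ({ω | X t ω = Pi.single i 1}.indicator fun _ => (1 : ℝ)) = fun ω => X t ω i :=
  indicator_eq_apply_of_basis (h.basis t) i

lemma measurable_apply (h : IsMarkovChain μ 𝓕 X Q) (t : ℝ≥0) (i : ι) :
    Measurable[𝓕 t] fun ω => X t ω i :=
  (measurable_pi_apply i).comp (h.adapted t).measurable

lemma measurable_apply' (h : IsMarkovChain μ 𝓕 X Q) (t : ℝ≥0) (i : ι) :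
    Measurable fun ω => X t ω i :=
  (h.measurable_apply t i).mono (𝓕.le t) le_rfl

lemma integrable_apply [IsFiniteMeasure μ] (h : IsMarkovChain μ 𝓕 X Q) (t : ℝ≥0) (i : ι) :
    Integrable (fun ω => X t ω i) μ :=
  integrable_of_bounded (h.measurable_apply' t i) fun ω => h.abs_le_one t ω i

lemma rightContinuous_apply (h : IsMarkovChain μ 𝓕 X Q) (i : ι) (ω : Ω) (r : ℝ≥0) :
    ContinuousWithinAt (fun u => X u ω i) (Set.Ici r) r :=
  (continuous_apply i).continuousAt.comp_continuousWithinAt (h.cadlag ω r).1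

lemma condExp_apply (h : IsMarkovChain μ 𝓕 X Q) {s t : ℝ≥0} (hst : s ≤ t) (i : ι) :
    μ[fun ω => X t ω i | 𝓕 s] =ᵐ[μ]
      fun ω => (NormedSpace.exp (((t : ℝ) - s) • Q) *ᵥ X s ω) i := by
  obtain ⟨P, hP, hM⟩ := h.markov
  filter_upwards [hM s t hst i] with ω hω
  rw [h.indicator_eq] at hω
  obtain ⟨j, hj⟩ := h.basis s ω
  rw [hω j hj, hP.eq_exp, NNReal.coe_sub hst, hj, Matrix.mulVec_single_one]
  rfl

lemma generator_offDiag_nonneg (h : IsMarkovChain μ 𝓕 X Q) (i j : ι) (hij : i ≠ j) :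
    0 ≤ Q i j := by
  obtain ⟨P, hP, -⟩ := h.markov
  exact hP.offDiag_nonneg i j hij

lemma generator_col_sum (h : IsMarkovChain μ 𝓕 X Q) (j : ι) : ∑ i, Q i j = 0 := by
  obtain ⟨P, hP, -⟩ := h.markov
  exact hP.generator_col_sum j

/-- A chain stays a chain with respect to a smaller filtration to which it is adapted. -/
lemma of_le [IsProbabilityMeasure μ] (h : IsMarkovChain μ 𝓕 X Q) {𝓖 : Filtration ℝ≥0 mΩ}
    (hle : 𝓖 ≤ 𝓕) (ha : StronglyAdapted 𝓖 X) : IsMarkovChain μ 𝓖 X Q where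
  adapted := ha
  cadlag := h.cadlag
  basis := h.basis
  markov := by
    obtain ⟨P, hP, -⟩ := h.markov
    refine ⟨P, hP, fun s t hst i => ?_⟩
    rw [h.indicator_eq]
    have h1 := condExp_condExp_of_le (μ := μ) (f := fun ω => X t ω i) (hle s) (𝓕.le s)
    have h2 := condExp_congr_ae (m := 𝓖 s) (h.condExp_apply hst i)
    have hm : Measurable[𝓖 s] fun ω =>
        (NormedSpace.exp (((t : ℝ) - s) • Q) *ᵥ X s ω) i := by
      have : Continuous fun x : ι → ℝ => (NormedSpace.exp (((t : ℝ) - s) • Q) *ᵥ x) i := by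
        fun_prop
      exact this.measurable.comp (ha s).measurable
    have hint : Integrable (fun ω => (NormedSpace.exp (((t : ℝ) - s) • Q) *ᵥ X s ω) i) μ :=
      (integrable_congr (h.condExp_apply hst i)).1 integrable_condExp
    rw [condExp_of_stronglyMeasurable (𝓖.le s) hm.stronglyMeasurable hint] at h2
    filter_upwards [h1, h2] with ω h1 h2 j hj
    rw [← h1, h2, hP.eq_exp, NNReal.coe_sub hst, hj, Matrix.mulVec_single_one]
    rfl

/-- The Markov property integrated against a weight known at time `u`. The weight may involve any
information in the filtration, in particular the defaults. -/
lemma weightedMean_eq [IsProbabilityMeasure μ] (h : IsMarkovChain μ 𝓕 X Q) {u v : ℝ≥0}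
    (huv : u ≤ v) {W : Ω → ℝ} (hW : Measurable[𝓕 u] W) {C : ℝ} (hC : ∀ ω, |W ω| ≤ C) :
    weightedMean μ W (X v) =
      NormedSpace.exp (((v : ℝ) - u) • Q) *ᵥ weightedMean μ W (X u) := by
  funext i
  have hm : Measurable[𝓕 u] fun ω => (NormedSpace.exp (((v : ℝ) - u) • Q) *ᵥ X u ω) i := by
    have : Continuous fun x : ι → ℝ => (NormedSpace.exp (((v : ℝ) - u) • Q) *ᵥ x) i := by
      fun_prop
    exact this.measurable.comp (h.adapted u).measurable
  have hint : Integrable (fun ω => (NormedSpace.exp (((v : ℝ) - u) • Q) *ᵥ X u ω) i) μ :=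
    (integrable_congr (h.condExp_apply huv i)).1 integrable_condExp
  have h1 := integral_mul_congr_of_condExp (𝓕.le u) (h.integrable_apply v i) hint hW hC
    (by rw [condExp_of_stronglyMeasurable (𝓕.le u) hm.stronglyMeasurable hint]
        exact h.condExp_apply huv i)
  rw [weightedMean, h1]
  simp only [Matrix.mulVec, dotProduct, weightedMean, Finset.mul_sum]
  rw [integral_finsetSum]
  · refine Finset.sum_congr rfl fun j _ => ?_
    rw [← integral_const_mul]
    congr 1
    funext ω
    ring
  · intro j _
    exact ((h.integrable_apply u j).const_mul _).bdd_mul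
      (hW.mono (𝓕.le u) le_rfl).aestronglyMeasurable (Eventually.of_forall hC)

lemma norm_weightedMean_le_one [IsProbabilityMeasure μ] (h : IsMarkovChain μ 𝓕 X Q) (u : ℝ≥0)
    {W : Ω → ℝ} (hW : ∀ ω, |W ω| ≤ 1) : ‖weightedMean μ W (X u)‖ ≤ 1 := by
  have := norm_weightedMean_le (μ := μ) (W := W) (Z := X u) (B := fun _ => 1)
    (integrable_const _) (fun ω i => by
      rw [abs_mul]
      exact mul_le_one₀ (hW ω) (abs_nonneg _) (h.abs_le_one u ω i)) (by simp)
  simpa using this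

attribute [local instance] Matrix.linftyOpNormedRing Matrix.linftyOpNormedAlgebra

/-- The right-hand side is the indicator of `X u ω ≠ X v ω`. It is written with the products `X u ω
j * X v ω j`, whose means are weighted means of `X v` with a weight known at time `u`. -/
lemma norm_sub_le_sum (h : IsMarkovChain μ 𝓕 X Q) (u v : ℝ≥0) (ω : Ω) :
    ‖X v ω - X u ω‖ ≤ ∑ j, (X u ω j * X u ω j - X u ω j * X v ω j) := by
  obtain ⟨a, ha⟩ := h.basis u ω
  obtain ⟨b, hb⟩ := h.basis v ω
  rcases eq_or_ne a b with rfl | hab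
  · simp [ha, hb]
  · have : ∑ j, (X u ω j * X u ω j - X u ω j * X v ω j) = 1 := by
      simp [ha, hb, Pi.single_apply, hab.symm]
    rw [this]
    refine (pi_norm_le_iff_of_nonneg zero_le_one).2 fun i => ?_
    rw [Pi.sub_apply, Real.norm_eq_abs, abs_le]
    constructor <;> linarith [h.nonneg u ω i, h.le_one u ω i, h.nonneg v ω i, h.le_one v ω i]

lemma measurable_norm_sub (h : IsMarkovChain μ 𝓕 X Q) (u v : ℝ≥0) :
    Measurable fun ω => ‖X v ω - X u ω‖ :=
  (((h.adapted v).measurable.mono (𝓕.le v) le_rfl).sub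
    ((h.adapted u).measurable.mono (𝓕.le u) le_rfl)).norm

lemma norm_sub_le_one (h : IsMarkovChain μ 𝓕 X Q) (u v : ℝ≥0) (ω : Ω) :
    ‖X v ω - X u ω‖ ≤ 1 := by
  refine (pi_norm_le_iff_of_nonneg zero_le_one).2 fun i => ?_
  rw [Pi.sub_apply, Real.norm_eq_abs, abs_le]
  constructor <;> linarith [h.nonneg u ω i, h.le_one u ω i, h.nonneg v ω i, h.le_one v ω i]

lemma integrable_norm_sub [IsFiniteMeasure μ] (h : IsMarkovChain μ 𝓕 X Q) (u v : ℝ≥0) :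
    Integrable (fun ω => ‖X v ω - X u ω‖) μ :=
  integrable_of_bounded (h.measurable_norm_sub u v) (C := 1) fun ω => by
    rw [abs_norm]; exact h.norm_sub_le_one u v ω

lemma integral_norm_sub_le [IsProbabilityMeasure μ] (h : IsMarkovChain μ 𝓕 X Q) {u v : ℝ≥0}
    (huv : u ≤ v) : ∫ ω, ‖X v ω - X u ω‖ ∂μ ≤
      Fintype.card ι * ‖NormedSpace.exp (((v : ℝ) - u) • Q) - 1‖ := by
  have hi : ∀ j (w : ℝ≥0), Integrable (fun ω => X u ω j * X w ω j) μ := fun j w =>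
    integrable_of_bounded ((h.measurable_apply' u j).mul (h.measurable_apply' w j)) (C := 1)
      fun ω => by
        rw [abs_mul]
        exact mul_le_one₀ (h.abs_le_one u ω j) (abs_nonneg _) (h.abs_le_one w ω j)
  calc _ ≤ ∫ ω, ∑ j, (X u ω j * X u ω j - X u ω j * X v ω j) ∂μ :=
        integral_mono (h.integrable_norm_sub u v)
          (integrable_finsetSum _ fun j _ => (hi j u).sub (hi j v))
          fun ω => h.norm_sub_le_sum u v ω
    _ = ∑ j, (weightedMean μ (fun ω => X u ω j) (X u) j -
          weightedMean μ (fun ω => X u ω j) (X v) j) := by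
        rw [integral_finsetSum (f := fun j ω => X u ω j * X u ω j - X u ω j * X v ω j) _
          fun j _ => (hi j u).sub (hi j v)]
        exact Finset.sum_congr rfl fun j _ => integral_sub (hi j u) (hi j v)
    _ ≤ ∑ _j : ι, ‖NormedSpace.exp (((v : ℝ) - u) • Q) - 1‖ := by
        refine Finset.sum_le_sum fun j _ => ?_
        rw [h.weightedMean_eq huv (h.measurable_apply u j) (fun ω => h.abs_le_one u ω j)]
        set w := weightedMean μ (fun ω => X u ω j) (X u)
        have hw : ‖w‖ ≤ 1 := h.norm_weightedMean_le_one u fun ω => h.abs_le_one u ω j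
        have e : w j - (NormedSpace.exp (((v : ℝ) - u) • Q) *ᵥ w) j =
            -(((NormedSpace.exp (((v : ℝ) - u) • Q) - 1) *ᵥ w) j) := by
          rw [Matrix.sub_mulVec, Matrix.one_mulVec, Pi.sub_apply]; ring
        rw [e]
        calc _ ≤ ‖((NormedSpace.exp (((v : ℝ) - u) • Q) - 1) *ᵥ w) j‖ := neg_le_abs _
          _ ≤ ‖(NormedSpace.exp (((v : ℝ) - u) • Q) - 1) *ᵥ w‖ := norm_le_pi_norm _ j
          _ ≤ ‖NormedSpace.exp (((v : ℝ) - u) • Q) - 1‖ * ‖w‖ := Matrix.linfty_opNorm_mulVec _ _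
          _ ≤ ‖NormedSpace.exp (((v : ℝ) - u) • Q) - 1‖ * 1 := by gcongr
          _ = _ := mul_one _
    _ = _ := by simp

lemma exists_integral_norm_sub_le [IsProbabilityMeasure μ] (h : IsMarkovChain μ 𝓕 X Q) {ε : ℝ}
    (hε : 0 < ε) : ∃ δ > 0, ∀ u v : ℝ≥0, u ≤ v → (v : ℝ) - u < δ →
      ∫ ω, ‖X v ω - X u ω‖ ∂μ ≤ ε := by
  -- The `+ 1` covers an empty state space.
  obtain ⟨δ, hδ, H⟩ := exists_norm_exp_sub_one_le Q
    (ε := ε / (Fintype.card ι + 1)) (by positivity)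
  refine ⟨δ, hδ, fun u v huv hd => (h.integral_norm_sub_le huv).trans ?_⟩
  have h1 := H ((v : ℝ) - u) (sub_nonneg.2 huv) hd
  calc _ ≤ ((Fintype.card ι : ℝ) + 1) * (ε / (Fintype.card ι + 1)) := by
        gcongr
        linarith
    _ = ε := by field_simp

end IsMarkovChain

lemma abs_dotProduct_sub_le {Ω ι : Type*} [Fintype ι] {X : ℝ≥0 → Ω → ι → ℝ}
    {lam : ι → ℝ} (hlam : ∀ i, 0 ≤ lam i) (u v : ℝ≥0) (ω : Ω) :
    |lam ⬝ᵥ X v ω - lam ⬝ᵥ X u ω| ≤ (∑ i, lam i) * ‖X v ω - X u ω‖ := by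
  rw [← dotProduct_sub, dotProduct, Finset.sum_mul]
  refine (Finset.abs_sum_le_sum_abs _ _).trans (Finset.sum_le_sum fun i _ => ?_)
  rw [abs_mul, abs_of_nonneg (hlam i)]
  exact mul_le_mul_of_nonneg_left (norm_le_pi_norm (X v ω - X u ω) i) (hlam i)

namespace IsMarkovChain

variable {Ω : Type*} {mΩ : MeasurableSpace Ω} {ι : Type*} [Fintype ι] [DecidableEq ι]
  {μ : Measure Ω} {𝓕 : Filtration ℝ≥0 mΩ} {X : ℝ≥0 → Ω → ι → ℝ} {Q : Matrix ι ι ℝ}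

attribute [local instance] Matrix.linftyOpNormedRing Matrix.linftyOpNormedAlgebra

/-- If the weight `W` decreases at the rate `D`, up to an error `κ` which vanishes along the
uniform partitions, then the mean of `X` with weight `W` evolves with the generator `Q - D`. -/
lemma weightedMean_eq_exp_of_increments [IsProbabilityMeasure μ] (h : IsMarkovChain μ 𝓕 X Q)
    (D : Matrix ι ι ℝ) {s t : ℝ≥0} (hst : s ≤ t) (W : ℝ≥0 → Ω → ℝ)
    (hW : ∀ u, s ≤ u → u ≤ t → Measurable[𝓕 u] (W u)) (hb : ∀ u, s ≤ u → ∀ ω, |W u ω| ≤ 1)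
    (κ : ℝ≥0 → ℝ≥0 → ℝ)
    (hinc : ∀ ε > 0, ∃ δ > 0, ∀ u v : ℝ≥0, s ≤ u → u ≤ v → v ≤ t → (v : ℝ) - u < δ →
      ‖weightedMean μ (W v - W u) (X v) + ((v : ℝ) - u) • (D *ᵥ weightedMean μ (W u) (X u))‖ ≤
        ε * ((v : ℝ) - u) + κ u v)
    (hκ : Tendsto (fun m : ℕ => ∑ k ∈ Finset.range (m + 1),
      κ (gridPoint s t m k) (gridPoint s t m (k + 1))) atTop (𝓝 0)) :
    weightedMean μ (W t) (X t) =
      NormedSpace.exp (((t : ℝ) - s) • (Q - D)) *ᵥ weightedMean μ (W s) (X s) := by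
  set R := Q - D with hR
  set φ : ℝ≥0 → ι → ℝ := fun u => weightedMean μ (W u) (X u) with hφ
  obtain ⟨C, hC0, hC⟩ := exists_norm_exp_le R ((t : ℝ) - s)
  -- The mean of `X v` splits into the change of the weight and the flow of `Q`. The first is `-(v -
  -- u) D` up to the allowed error, and `exp (hQ) - hD` agrees with `exp (h(Q - D))` up to `o(h)`.
  have hkey : ∀ ε > 0, ∃ δ > 0, ∀ u v : ℝ≥0, s ≤ u → u ≤ v → v ≤ t → (v : ℝ) - u < δ →
      ‖φ v - NormedSpace.exp (((v : ℝ) - u) • R) *ᵥ φ u‖ ≤ ε * ((v : ℝ) - u) + κ u v := by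
    intro ε hε
    obtain ⟨δ₁, hδ₁, H₁⟩ := hinc (ε / 2) (by positivity)
    obtain ⟨δ₂, hδ₂, H₂⟩ := exists_norm_exp_sub_exp_le Q D (ε := ε / 2) (by positivity)
    refine ⟨min δ₁ δ₂, lt_min hδ₁ hδ₂, fun u v hsu huv hvt hd => ?_⟩
    have h1 := H₁ u v hsu huv hvt (hd.trans_le (min_le_left _ _))
    have h2 := H₂ ((v : ℝ) - u) (sub_nonneg.2 huv) (hd.trans_le (min_le_right _ _))
    have hint : ∀ w, s ≤ w → w ≤ t → ∀ i, Integrable (fun ω => W w ω * X v ω i) μ :=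
      fun w hsw hwt i => (h.integrable_apply v i).bdd_mul
        ((hW w hsw hwt).mono (𝓕.le w) le_rfl).aestronglyMeasurable
        (Eventually.of_forall (hb w hsw))
    have hsplit : φ v = weightedMean μ (W v - W u) (X v) +
        NormedSpace.exp (((v : ℝ) - u) • Q) *ᵥ φ u := by
      rw [hφ]
      simp only
      rw [← h.weightedMean_eq huv (hW u hsu (huv.trans hvt)) (hb u hsu)]
      funext i
      simp only [weightedMean, Pi.add_apply, Pi.sub_apply, sub_mul]
      rw [integral_sub (hint v (hsu.trans huv) hvt i) (hint u hsu (huv.trans hvt) i)]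
      ring
    have e : φ v - NormedSpace.exp (((v : ℝ) - u) • R) *ᵥ φ u =
        (weightedMean μ (W v - W u) (X v) + ((v : ℝ) - u) • (D *ᵥ φ u)) +
        (NormedSpace.exp (((v : ℝ) - u) • Q) - NormedSpace.exp (((v : ℝ) - u) • R) -
          ((v : ℝ) - u) • D) *ᵥ φ u := by
      rw [hsplit, Matrix.sub_mulVec, Matrix.sub_mulVec, Matrix.smul_mulVec]
      abel
    rw [e]
    have h3 : ‖(NormedSpace.exp (((v : ℝ) - u) • Q) - NormedSpace.exp (((v : ℝ) - u) • R) -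
          ((v : ℝ) - u) • D) *ᵥ φ u‖ ≤ ε / 2 * ((v : ℝ) - u) :=
      calc _ ≤ _ * ‖φ u‖ := Matrix.linfty_opNorm_mulVec _ _
        _ ≤ (ε / 2 * ((v : ℝ) - u)) * 1 :=
            mul_le_mul h2 (h.norm_weightedMean_le_one u (hb u hsu)) (norm_nonneg _)
              ((norm_nonneg _).trans h2)
        _ = _ := mul_one _
    refine (norm_add_le _ _).trans ((add_le_add h1 h3).trans (le_of_eq ?_))
    ring
  -- Pulling the mean back to time `s` along the expected flow turns the claim into the constancy of
  -- `g`.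
  let g : ℝ≥0 → ι → ℝ := fun u => NormedSpace.exp ((-((u : ℝ) - s)) • R) *ᵥ φ u
  have hg : g t = g s := by
    refine eq_of_sum_increments_tendsto g hst (fun u v => C * κ u v) (fun ε hε => ?_) ?_
    · obtain ⟨δ, hδ, H⟩ := hkey (ε / C) (by positivity)
      refine ⟨δ, hδ, fun u v hsu huv hvt hd => ?_⟩
      have e : g v - g u = NormedSpace.exp ((-((v : ℝ) - s)) • R) *ᵥ
          (φ v - NormedSpace.exp (((v : ℝ) - u) • R) *ᵥ φ u) := by
        rw [Matrix.mulVec_sub, Matrix.mulVec_mulVec, ← exp_add_smul]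
        simp only [g]
        congr 3
        ring_nf
      rw [e]
      calc _ ≤ ‖NormedSpace.exp ((-((v : ℝ) - s)) • R)‖ * _ := Matrix.linfty_opNorm_mulVec _ _
        _ ≤ C * (ε / C * ((v : ℝ) - u) + κ u v) := by
            refine mul_le_mul (hC _ ?_) (H u v hsu huv hvt hd) (norm_nonneg _) hC0.le
            have h1 : (s : ℝ) ≤ v := hsu.trans huv
            have h2 : (v : ℝ) ≤ t := hvt
            rw [abs_neg, abs_of_nonneg (sub_nonneg.2 h1)]
            linarith
        _ = _ := by field_simp
    · simpa [Finset.mul_sum] using hκ.const_mul C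
  simp only [g, sub_self, neg_zero, zero_smul, NormedSpace.exp_zero, Matrix.one_mulVec] at hg
  change φ t = _ *ᵥ φ s
  rw [← hg, Matrix.mulVec_mulVec, ← exp_add_smul, add_neg_cancel, zero_smul,
    NormedSpace.exp_zero, Matrix.one_mulVec]

lemma measurable_uncurry_apply (h : IsMarkovChain μ 𝓕 X Q) (i : ι) :
    Measurable fun p : Ω × ℝ≥0 => X p.2 p.1 i :=
  measurable_uncurry_of_rightContinuous (f := fun r ω => X r ω i) (fun r => h.measurable_apply' r i)
    (h.rightContinuous_apply i)

lemma measurable_uncurry_dotProduct (h : IsMarkovChain μ 𝓕 X Q) (lam : ι → ℝ) :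
    Measurable fun p : Ω × ℝ≥0 => lam ⬝ᵥ X p.2 p.1 := by
  simp only [dotProduct]
  exact Finset.measurable_fun_sum _ fun i _ => (h.measurable_uncurry_apply i).const_mul _

section Intensity

variable {lam : ι → ℝ}

lemma dotProduct_nonneg (h : IsMarkovChain μ 𝓕 X Q) (hlam : ∀ i, 0 ≤ lam i) (t : ℝ≥0) (ω : Ω) :
    0 ≤ lam ⬝ᵥ X t ω :=
  Finset.sum_nonneg fun i _ => mul_nonneg (hlam i) (h.nonneg t ω i)

lemma dotProduct_le (h : IsMarkovChain μ 𝓕 X Q) (hlam : ∀ i, 0 ≤ lam i) (t : ℝ≥0) (ω : Ω) :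
    lam ⬝ᵥ X t ω ≤ ∑ i, lam i :=
  Finset.sum_le_sum fun i _ => mul_le_of_le_one_right (hlam i) (h.le_one t ω i)

lemma abs_dotProduct_le (h : IsMarkovChain μ 𝓕 X Q) (hlam : ∀ i, 0 ≤ lam i) (t : ℝ≥0) (ω : Ω) :
    |lam ⬝ᵥ X t ω| ≤ ∑ i, lam i := by
  rw [abs_of_nonneg (h.dotProduct_nonneg hlam t ω)]
  exact h.dotProduct_le hlam t ω

/-- On basis vectors the random rate `λᵀX` acts as the constant matrix `diag(λ)`. This makes the
evolution equations linear and closed. -/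
lemma dotProduct_mul_apply (h : IsMarkovChain μ 𝓕 X Q) (lam : ι → ℝ) (t : ℝ≥0) (ω : Ω) (i : ι) :
    (lam ⬝ᵥ X t ω) * X t ω i = lam i * X t ω i := by
  obtain ⟨j, hj⟩ := h.basis t ω
  rw [hj, dotProduct_single_one, Pi.single_apply]
  split_ifs with hij
  · rw [hij]
  · simp

end Intensity

end IsMarkovChain

/-! ### The integrated intensity and the Feynman–Kac formula. -/

/-- The integrated intensity `∫ₛᵗ λᵀ X_r dr`. -/
noncomputable def intensityIntegral {Ω ι : Type*} [Fintype ι] (lam : ι → ℝ) (X : ℝ≥0 → Ω → ι → ℝ)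
    (s t : ℝ≥0) (ω : Ω) : ℝ :=
  ∫ r in (s : ℝ)..t, lam ⬝ᵥ X r.toNNReal ω

lemma intensityIntegral_self {Ω ι : Type*} [Fintype ι] (lam : ι → ℝ) (X : ℝ≥0 → Ω → ι → ℝ)
    (s : ℝ≥0) (ω : Ω) : intensityIntegral lam X s s ω = 0 := by
  simp [intensityIntegral]

namespace IsMarkovChain

variable {Ω : Type*} {mΩ : MeasurableSpace Ω} {ι : Type*} [Fintype ι] [DecidableEq ι]
  {μ : Measure Ω} {𝓕 : Filtration ℝ≥0 mΩ} {X : ℝ≥0 → Ω → ι → ℝ} {Q : Matrix ι ι ℝ} {lam : ι → ℝ}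

lemma measurable_intensityIntegral (h : IsMarkovChain μ 𝓕 X Q) {m : MeasurableSpace Ω}
    {s t : ℝ≥0} (hst : s ≤ t) (hm : ∀ r ≤ t, Measurable[m] (X r)) :
    Measurable[m] (intensityIntegral lam X s t) := by
  refine measurable_intervalIntegral_of_rightContinuous (m := m) (f := fun r ω => lam ⬝ᵥ X r ω) hst
    (fun r hr => ?_) fun ω r => ?_
  · have : Continuous fun x : ι → ℝ => lam ⬝ᵥ x := by fun_prop
    exact this.measurable.comp (hm r hr)
  · have : Continuous fun x : ι → ℝ => lam ⬝ᵥ x := by fun_prop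
    exact this.continuousAt.comp_continuousWithinAt (h.cadlag ω r).1

lemma measurable_intensityIntegral_filtration (h : IsMarkovChain μ 𝓕 X Q) {s t : ℝ≥0}
    (hst : s ≤ t) : Measurable[𝓕 t] (intensityIntegral lam X s t) :=
  h.measurable_intensityIntegral hst fun r hr =>
    (h.adapted r).measurable.mono (𝓕.mono hr) le_rfl

lemma intervalIntegrable_dotProduct (h : IsMarkovChain μ 𝓕 X Q) (hlam : ∀ i, 0 ≤ lam i) (ω : Ω)
    (a b : ℝ) : IntervalIntegrable (fun r : ℝ => lam ⬝ᵥ X r.toNNReal ω) volume a b := by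
  rw [intervalIntegrable_iff]
  have : IsFiniteMeasure (volume.restrict (Set.uIoc a b)) :=
    ⟨by simp [Set.uIoc]⟩
  exact Integrable.of_bound ((h.measurable_uncurry_dotProduct lam).comp
    (measurable_const.prodMk measurable_real_toNNReal)).aestronglyMeasurable (∑ i, lam i)
    (Eventually.of_forall fun r => h.abs_dotProduct_le hlam _ _)

lemma intensityIntegral_add (h : IsMarkovChain μ 𝓕 X Q) (hlam : ∀ i, 0 ≤ lam i) (s u t : ℝ≥0)
    (ω : Ω) : intensityIntegral lam X s u ω + intensityIntegral lam X u t ω =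
      intensityIntegral lam X s t ω :=
  intervalIntegral.integral_add_adjacent_intervals (h.intervalIntegrable_dotProduct hlam ω _ _)
    (h.intervalIntegrable_dotProduct hlam ω _ _)

lemma intensityIntegral_nonneg (h : IsMarkovChain μ 𝓕 X Q) (hlam : ∀ i, 0 ≤ lam i) {s t : ℝ≥0}
    (hst : s ≤ t) (ω : Ω) : 0 ≤ intensityIntegral lam X s t ω :=
  intervalIntegral.integral_nonneg (by exact_mod_cast hst) fun r _ => h.dotProduct_nonneg hlam _ _

lemma intensityIntegral_le (h : IsMarkovChain μ 𝓕 X Q) (hlam : ∀ i, 0 ≤ lam i) {s t : ℝ≥0}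
    (hst : s ≤ t) (ω : Ω) :
    intensityIntegral lam X s t ω ≤ (∑ i, lam i) * ((t : ℝ) - s) := by
  have hst' : (s : ℝ) ≤ t := hst
  have := intervalIntegral.integral_mono_on hst' (h.intervalIntegrable_dotProduct hlam ω _ _)
    (intervalIntegrable_const (c := ∑ i, lam i)) fun r _ => h.dotProduct_le hlam r.toNNReal ω
  rwa [intervalIntegral.integral_const, smul_eq_mul, mul_comm] at this

/-- `X` is continuous in mean, uniformly in time, so the rectangle rule has error `o(v - u)` in
mean, uniformly in the interval. -/
lemma exists_integral_abs_intensityIntegral_sub_le [IsProbabilityMeasure μ]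
    (h : IsMarkovChain μ 𝓕 X Q) (hlam : ∀ i, 0 ≤ lam i) {ε : ℝ} (hε : 0 < ε) :
    ∃ δ > 0, ∀ u v : ℝ≥0, u ≤ v → (v : ℝ) - u < δ →
      ∫ ω, |intensityIntegral lam X u v ω - ((v : ℝ) - u) * (lam ⬝ᵥ X u ω)| ∂μ ≤
        ε * ((v : ℝ) - u) := by
  have hL : 0 ≤ ∑ i, lam i := Finset.sum_nonneg fun i _ => hlam i
  obtain ⟨δ, hδ, H⟩ := h.exists_integral_norm_sub_le (ε := ε / (∑ i, lam i + 1)) (by positivity)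
  refine ⟨δ, hδ, fun u v huv hd => ?_⟩
  refine integral_abs_intervalIntegral_sub_le (V := fun r ω => lam ⬝ᵥ X r ω)
    (h.measurable_uncurry_dotProduct lam) (h.abs_dotProduct_le hlam) huv fun r hur hrv => ?_
  have hrv' : (r : ℝ) ≤ v := hrv
  calc _ ≤ ∫ ω, (∑ i, lam i) * ‖X r ω - X u ω‖ ∂μ :=
        integral_mono_of_nonneg (Eventually.of_forall fun ω => abs_nonneg _)
          ((h.integrable_norm_sub u r).const_mul _)
          (Eventually.of_forall fun ω => abs_dotProduct_sub_le hlam u r ω)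
    _ ≤ (∑ i, lam i) * (ε / (∑ i, lam i + 1)) := by
        rw [integral_const_mul]
        gcongr
        exact H u r hur (by linarith)
    _ ≤ (∑ i, lam i + 1) * (ε / (∑ i, lam i + 1)) := by gcongr; linarith
    _ = ε := by field_simp

lemma smul_diagonal_mulVec_weightedMean (h : IsMarkovChain μ 𝓕 X Q) (c : ℝ) (W : Ω → ℝ) (u : ℝ≥0)
    (i : ι) : ((c • Matrix.diagonal lam) *ᵥ weightedMean μ W (X u)) i =
      ∫ ω, W ω * (c * (lam ⬝ᵥ X u ω)) * X u ω i ∂μ := by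
  rw [Matrix.smul_mulVec, Pi.smul_apply, Matrix.mulVec_diagonal, weightedMean, smul_eq_mul,
    ← mul_assoc, ← integral_const_mul]
  congr 1
  funext ω
  linear_combination (-c * W ω) * h.dotProduct_mul_apply lam u ω i

/-- The Feynman–Kac formula for a finite Markov chain. -/
lemma weightedMean_exp_neg_intensityIntegral [IsProbabilityMeasure μ]
    (h : IsMarkovChain μ 𝓕 X Q) (hlam : ∀ i, 0 ≤ lam i) {c : ℝ} (hc : 0 ≤ c) {s u v : ℝ≥0}
    (hsu : s ≤ u) (huv : u ≤ v) {V : Ω → ℝ} (hV : Measurable[𝓕 u] V) (hV1 : ∀ ω, |V ω| ≤ 1) :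
    weightedMean μ (fun ω => V ω * Real.exp (-c * intensityIntegral lam X s v ω)) (X v) =
      NormedSpace.exp (((v : ℝ) - u) • (Q - c • Matrix.diagonal lam)) *ᵥ
        weightedMean μ (fun ω => V ω * Real.exp (-c * intensityIntegral lam X s u ω)) (X u) := by
  have hL : 0 ≤ ∑ i, lam i := Finset.sum_nonneg fun i _ => hlam i
  set L := ∑ i, lam i with hLdef
  set W : ℝ≥0 → Ω → ℝ := fun r ω => V ω * Real.exp (-c * intensityIntegral lam X s r ω) with hWdef
  have hWm : ∀ r, u ≤ r → Measurable[𝓕 r] (W r) := fun r hur =>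
    (hV.mono (𝓕.mono hur) le_rfl).mul (Real.measurable_exp.comp
      ((h.measurable_intensityIntegral_filtration (hsu.trans hur)).const_mul (-c)))
  have hWb : ∀ r, u ≤ r → ∀ ω, |W r ω| ≤ 1 := by
    intro r hur ω
    rw [hWdef, abs_mul, Real.abs_exp]
    refine mul_le_one₀ (hV1 ω) (Real.exp_pos _).le (Real.exp_le_one_iff.2 ?_)
    have := mul_nonneg hc (h.intensityIntegral_nonneg hlam (hsu.trans hur) ω)
    linarith
  refine h.weightedMean_eq_exp_of_increments (c • Matrix.diagonal lam) huv W
    (fun r hr _ => hWm r hr) hWb (fun _ _ => 0) (fun ε hε => ?_) (by simp)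
  obtain ⟨δ₁, hδ₁, H₁⟩ := h.exists_integral_norm_sub_le (ε := ε / (3 * (c * L + 1)))
    (by positivity)
  obtain ⟨δ₂, hδ₂, H₂⟩ := h.exists_integral_abs_intensityIntegral_sub_le hlam
    (ε := ε / (3 * (c + 1))) (by positivity)
  -- The bound `1` brings the exponent into the range where the quadratic estimate of `exp` holds;
  -- the bound `ε / 3` absorbs the resulting second-order term.
  set δ₃ := min 1 (ε / 3) / ((c * L + 1) * (c * L + 1)) with hδ₃
  have hδ₃0 : 0 < δ₃ := by positivity
  refine ⟨min δ₁ (min δ₂ δ₃), by positivity, fun a b hua hab hbv hd => ?_⟩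
  have hd1 := hd.trans_le (min_le_left _ _)
  have hd2 := hd.trans_le ((min_le_right _ _).trans (min_le_left _ _))
  have hd3 := hd.trans_le ((min_le_right _ _).trans (min_le_right _ _))
  have h1 := H₁ a b hab hd1
  have h2 := H₂ a b hab hd2
  have hη0 : 0 ≤ (b : ℝ) - a := sub_nonneg.2 hab
  set η := (b : ℝ) - a with hη
  set J := intensityIntegral lam X a b with hJ
  have hJ0 : ∀ ω, 0 ≤ J ω := h.intensityIntegral_nonneg hlam hab
  have hJ1 : ∀ ω, J ω ≤ L * η := h.intensityIntegral_le hlam hab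
  have hcL : (c * L) ≤ (c * L + 1) * (c * L + 1) := by
    have : 0 ≤ c * L := by positivity
    nlinarith
  have hcL2 : (c * L) * (c * L) ≤ (c * L + 1) * (c * L + 1) := by gcongr <;> linarith
  have hcLη : (c * L) * η ≤ 1 := by
    calc _ ≤ ((c * L + 1) * (c * L + 1)) * δ₃ := by gcongr
      _ = min 1 (ε / 3) := by rw [hδ₃]; field_simp
      _ ≤ 1 := min_le_left _ _
  have hcLη2 : (c * L) * (c * L) * η ≤ ε / 3 := by
    calc _ ≤ ((c * L + 1) * (c * L + 1)) * δ₃ := by gcongr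
      _ = min 1 (ε / 3) := by rw [hδ₃]; field_simp
      _ ≤ ε / 3 := min_le_right _ _
  have hJm : Measurable J := (h.measurable_intensityIntegral_filtration hab).mono (𝓕.le b) le_rfl
  have hDm : Measurable fun ω => J ω - η * (lam ⬝ᵥ X a ω) := hJm.sub
    (((h.measurable_uncurry_dotProduct lam).comp
      (measurable_id.prodMk (measurable_const (a := a)))).const_mul _)
  have hDi : Integrable (fun ω => |J ω - η * (lam ⬝ᵥ X a ω)|) μ := by
    refine integrable_of_bounded hDm.abs (C := L * η) fun ω => ?_
    have e1 := mul_nonneg hη0 (h.dotProduct_nonneg hlam a ω)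
    have e2 := mul_le_mul_of_nonneg_left (h.dotProduct_le hlam a ω) hη0
    rw [abs_abs, abs_le]
    constructor <;> nlinarith [hJ0 ω, hJ1 ω]
  -- The three terms dominate the Taylor remainder of the exponential, the motion of `X` during `[a,
  -- b]`, and the error of the rectangle rule. Each has mean at most `ε / 3 * η`.
  set B : Ω → ℝ := fun ω => (c * L) * (c * L) * η * η + ((c * L * η) * ‖X b ω - X a ω‖ +
    c * |J ω - η * (lam ⬝ᵥ X a ω)|) with hB
  have hBi2 : Integrable (fun ω => (c * L * η) * ‖X b ω - X a ω‖ +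
      c * |J ω - η * (lam ⬝ᵥ X a ω)|) μ :=
    ((h.integrable_norm_sub a b).const_mul _).add (hDi.const_mul _)
  have hBi : Integrable B μ := (integrable_const _).add hBi2
  have hBint : ∫ ω, B ω ∂μ ≤ ε * η := by
    rw [hB, integral_add (integrable_const _) hBi2, integral_add
      ((h.integrable_norm_sub a b).const_mul _) (hDi.const_mul _), integral_const_mul (c * L * η),
      integral_const_mul c, integral_const, probReal_univ, one_smul]
    have e1 : (c * L) * (c * L) * η * η ≤ ε / 3 * η := by gcongr
    have e2 : c * L * η * ∫ ω, ‖X b ω - X a ω‖ ∂μ ≤ ε / 3 * η := by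
      calc _ ≤ ((c * L + 1) * η) * (ε / (3 * (c * L + 1))) := by gcongr; linarith
        _ = ε / 3 * η := by field_simp
    have e3 : c * ∫ ω, |J ω - η * (lam ⬝ᵥ X a ω)| ∂μ ≤ ε / 3 * η := by
      calc _ ≤ (c + 1) * (ε / (3 * (c + 1)) * η) := by gcongr; linarith
        _ = ε / 3 * η := by field_simp
    linarith
  rw [add_zero]
  refine le_trans ?_ hBint
  refine (pi_norm_le_iff_of_nonneg (integral_nonneg fun ω => ?_)).2 fun i => ?_
  · have := hJ0 ω
    simp only [hB, Pi.zero_apply]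
    positivity
  have hWXi : ∀ r, u ≤ r → Integrable (fun ω => W r ω * X b ω i) μ := fun r hur =>
    (h.integrable_apply b i).bdd_mul ((hWm r hur).mono (𝓕.le r) le_rfl).aestronglyMeasurable
      (Eventually.of_forall (hWb r hur))
  have hi2 : Integrable (fun ω => W a ω * (c * (lam ⬝ᵥ X a ω)) * X a ω i) μ := by
    have : (fun ω => W a ω * (c * (lam ⬝ᵥ X a ω)) * X a ω i) =
        fun ω => (c * lam i) * (W a ω * X a ω i) := by
      funext ω
      linear_combination (c * W a ω) * h.dotProduct_mul_apply lam a ω i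
    rw [this]
    exact ((h.integrable_apply a i).bdd_mul
      ((hWm a hua).mono (𝓕.le a) le_rfl).aestronglyMeasurable
      (Eventually.of_forall (hWb a hua))).const_mul _
  have hi1 : Integrable (fun ω => (W b - W a) ω * X b ω i) μ := by
    simp only [Pi.sub_apply, sub_mul]
    exact (hWXi b (hua.trans hab)).sub (hWXi a hua)
  rw [Pi.add_apply, Pi.smul_apply, h.smul_diagonal_mulVec_weightedMean, weightedMean, smul_eq_mul,
    ← integral_const_mul, ← integral_add hi1 (hi2.const_mul _)]
  refine norm_integral_le_of_norm_le hBi (Eventually.of_forall fun ω => ?_)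
  have hWab : W b ω = W a ω * Real.exp (-(c * J ω)) := by
    simp only [hWdef, hJ, ← h.intensityIntegral_add hlam s a b ω, mul_assoc, ← Real.exp_add]
    congr 2
    ring
  have hcJ : c * J ω ≤ c * L * η := by
    calc c * J ω ≤ c * (L * η) := by gcongr; exact hJ1 ω
      _ = _ := by ring
  have hcJ0 : 0 ≤ c * J ω := mul_nonneg hc (hJ0 ω)
  have hexp : |Real.exp (-(c * J ω)) - 1 - -(c * J ω)| ≤ (-(c * J ω)) ^ 2 :=
    Real.abs_exp_sub_one_sub_id_le (by rw [abs_neg, abs_of_nonneg hcJ0]; linarith)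
  have hexp' : |Real.exp (-(c * J ω)) - 1 - -(c * J ω)| ≤ (c * L) * (c * L) * η * η := by
    refine hexp.trans ?_
    calc (-(c * J ω)) ^ 2 = (c * J ω) * (c * J ω) := by ring
      _ ≤ (c * L * η) * (c * L * η) := by gcongr
      _ = _ := by ring
  have hXi : |X b ω i - X a ω i| ≤ ‖X b ω - X a ω‖ := norm_le_pi_norm (X b ω - X a ω) i
  have e : (W b - W a) ω * X b ω i + η * (W a ω * (c * (lam ⬝ᵥ X a ω)) * X a ω i) =
      W a ω * ((Real.exp (-(c * J ω)) - 1 - -(c * J ω)) * X b ω i +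
        (-(c * J ω) * (X b ω i - X a ω i) + -(c * (J ω - η * (lam ⬝ᵥ X a ω))) * X a ω i)) := by
    rw [Pi.sub_apply, hWab]; ring
  rw [e, Real.norm_eq_abs, abs_mul]
  calc _ ≤ 1 * |_| := by gcongr; exact hWb a hua ω
    _ ≤ |Real.exp (-(c * J ω)) - 1 - -(c * J ω)| * |X b ω i| +
        (|-(c * J ω)| * |X b ω i - X a ω i| +
          |-(c * (J ω - η * (lam ⬝ᵥ X a ω)))| * |X a ω i|) := by
        rw [one_mul, ← abs_mul, ← abs_mul, ← abs_mul]
        exact (abs_add_le _ _).trans (add_le_add_right (abs_add_le _ _) _)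
    _ ≤ (c * L) * (c * L) * η * η * 1 + ((c * L * η) * ‖X b ω - X a ω‖ +
          c * |J ω - η * (lam ⬝ᵥ X a ω)| * 1) := by
        rw [abs_neg, abs_neg, abs_of_nonneg hcJ0, abs_mul c, abs_of_nonneg hc]
        gcongr
        · exact h.abs_le_one b ω i
        · exact h.abs_le_one a ω i
    _ = B ω := by rw [hB]; ring

end IsMarkovChain

/-! ### A single obligor: compensator and killing. -/

section Default

variable {Ω : Type*} {mΩ : MeasurableSpace Ω} {d : ℕ} {μ : Measure Ω}
  {𝓕 : Filtration ℝ≥0 mΩ} {X : ℝ≥0 → Ω → Fin d → ℝ} {Q : Matrix (Fin d) (Fin d) ℝ}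
  {lam : Fin d → ℝ} {τ : Ω → ℝ≥0∞}

lemma measurable_uncurry_defaultInd (hτ : Measurable τ) :
    Measurable fun p : Ω × ℝ≥0 => defaultInd τ p.2 p.1 := by
  classical
  simp only [defaultInd_eq_ite]
  exact Measurable.ite (measurableSet_le (hτ.comp measurable_fst)
    (measurable_coe_nnreal_ennreal.comp measurable_snd)) measurable_const measurable_const

lemma abs_one_sub_defaultInd_le (τ : Ω → ℝ≥0∞) (t : ℝ≥0) (ω : Ω) :
    |1 - defaultInd τ t ω| ≤ 1 := by
  rw [abs_le]
  constructor <;> linarith [defaultInd_nonneg τ t ω, defaultInd_le_one τ t ω]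

lemma integrable_defaultInd_sub [IsFiniteMeasure μ] (hτ : Measurable τ) (u v : ℝ≥0) :
    Integrable (fun ω => defaultInd τ v ω - defaultInd τ u ω) μ := by
  refine integrable_of_bounded (f := fun ω => defaultInd τ v ω - defaultInd τ u ω)
    ((measurable_defaultInd hτ v).sub (measurable_defaultInd hτ u)) (C := 1) fun ω => ?_
  rw [abs_le]
  constructor <;> linarith [defaultInd_nonneg τ v ω, defaultInd_le_one τ v ω,
    defaultInd_nonneg τ u ω, defaultInd_le_one τ u ω]

/-- The default intensity `λᵀ X_t (1 - Y_t)`. -/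
noncomputable def defaultIntensity (lam : Fin d → ℝ) (X : ℝ≥0 → Ω → Fin d → ℝ) (τ : Ω → ℝ≥0∞)
    (t : ℝ≥0) (ω : Ω) : ℝ :=
  (lam ⬝ᵥ X t ω) * (1 - defaultInd τ t ω)

namespace IsMarkovChain

lemma measurable_uncurry_defaultIntensity (h : IsMarkovChain μ 𝓕 X Q) (hτ : Measurable τ) :
    Measurable fun p : Ω × ℝ≥0 => defaultIntensity lam X τ p.2 p.1 :=
  (h.measurable_uncurry_dotProduct lam).mul ((measurable_uncurry_defaultInd hτ).const_sub 1)

lemma abs_defaultIntensity_le (h : IsMarkovChain μ 𝓕 X Q) (hlam : ∀ i, 0 ≤ lam i) (t : ℝ≥0)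
    (ω : Ω) : |defaultIntensity lam X τ t ω| ≤ ∑ i, lam i := by
  rw [defaultIntensity, abs_mul, ← mul_one (∑ i, lam i)]
  exact mul_le_mul (h.abs_dotProduct_le hlam t ω) (abs_one_sub_defaultInd_le τ t ω) (abs_nonneg _)
    (Finset.sum_nonneg fun i _ => hlam i)

lemma compensated_sub (h : IsMarkovChain μ 𝓕 X Q) (hlam : ∀ i, 0 ≤ lam i) (hτ : Measurable τ)
    (u v : ℝ≥0) (ω : Ω) : compensated lam X τ v ω - compensated lam X τ u ω =
      (defaultInd τ v ω - defaultInd τ u ω) -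
        ∫ r in (u : ℝ)..v, defaultIntensity lam X τ r.toNNReal ω := by
  have hi : ∀ a b : ℝ, IntervalIntegrable (fun r : ℝ => defaultIntensity lam X τ r.toNNReal ω)
      volume a b := by
    intro a b
    rw [intervalIntegrable_iff]
    have : IsFiniteMeasure (volume.restrict (Set.uIoc a b)) := ⟨by simp [Set.uIoc]⟩
    exact Integrable.of_bound ((h.measurable_uncurry_defaultIntensity hτ).comp
      (measurable_const.prodMk measurable_real_toNNReal)).aestronglyMeasurable (∑ i, lam i)
      (Eventually.of_forall fun r => h.abs_defaultIntensity_le hlam _ _)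
  have e := intervalIntegral.integral_add_adjacent_intervals (hi 0 u) (hi u v)
  simp only [compensated]
  simp only [defaultIntensity] at e ⊢
  linarith

lemma measurable_integral_defaultIntensity (h : IsMarkovChain μ 𝓕 X Q) (hτ : Measurable τ)
    {u v : ℝ≥0} (huv : u ≤ v) :
    Measurable fun ω => ∫ r in (u : ℝ)..v, defaultIntensity lam X τ r.toNNReal ω := by
  have h1 : Measurable fun p : Ω × ℝ => defaultIntensity lam X τ p.2.toNNReal p.1 :=
    (h.measurable_uncurry_defaultIntensity hτ).comp
      (measurable_fst.prodMk measurable_snd.real_toNNReal)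
  have huv' : (u : ℝ) ≤ v := huv
  simp only [intervalIntegral.integral_of_le huv']
  exact h1.stronglyMeasurable.integral_prod_right.measurable

lemma abs_integral_defaultIntensity_le (h : IsMarkovChain μ 𝓕 X Q) (hlam : ∀ i, 0 ≤ lam i)
    {u v : ℝ≥0} (huv : u ≤ v) (ω : Ω) :
    |∫ r in (u : ℝ)..v, defaultIntensity lam X τ r.toNNReal ω| ≤
      (∑ i, lam i) * ((v : ℝ) - u) := by
  have huv' : (u : ℝ) ≤ v := huv
  have := intervalIntegral.norm_integral_le_of_norm_le_const (a := (u : ℝ)) (b := v)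
    (f := fun r : ℝ => defaultIntensity lam X τ r.toNNReal ω) (C := ∑ i, lam i)
    fun r _ => h.abs_defaultIntensity_le hlam r.toNNReal ω
  rwa [Real.norm_eq_abs, abs_of_nonneg (sub_nonneg.2 huv')] at this

/-- The martingale property in terms of a bounded weight known at time `u`. -/
lemma integral_mul_defaultInd_sub [IsProbabilityMeasure μ] (h : IsMarkovChain μ 𝓕 X Q)
    (hlam : ∀ i, 0 ≤ lam i) (hτ : Measurable τ) (hm : Martingale (compensated lam X τ) 𝓕 μ)
    {u v : ℝ≥0} (huv : u ≤ v) {W : Ω → ℝ} (hW : Measurable[𝓕 u] W) (hW1 : ∀ ω, |W ω| ≤ 1) :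
    ∫ ω, W ω * (defaultInd τ v ω - defaultInd τ u ω) ∂μ =
      ∫ ω, W ω * (∫ r in (u : ℝ)..v, defaultIntensity lam X τ r.toNNReal ω) ∂μ := by
  have hW' : AEStronglyMeasurable W μ := (hW.mono (𝓕.le u) le_rfl).aestronglyMeasurable
  have hb : ∀ᵐ ω ∂μ, ‖W ω‖ ≤ 1 := Eventually.of_forall hW1
  have h1 := integral_mul_congr_of_condExp (𝓕.le u) (hm.integrable v) (hm.integrable u) hW hW1
    ((hm.condExp_ae_eq huv).trans (by
      rw [condExp_of_stronglyMeasurable (𝓕.le u) (hm.stronglyMeasurable u) (hm.integrable u)]))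
  have hY : Integrable (fun ω => W ω * (defaultInd τ v ω - defaultInd τ u ω)) μ :=
    (integrable_defaultInd_sub hτ u v).bdd_mul hW' hb
  have hI : Integrable (fun ω => W ω *
      ∫ r in (u : ℝ)..v, defaultIntensity lam X τ r.toNNReal ω) μ :=
    (integrable_of_bounded (h.measurable_integral_defaultIntensity hτ huv)
      (h.abs_integral_defaultIntensity_le hlam huv)).bdd_mul hW' hb
  rw [← sub_eq_zero, ← integral_sub hY hI]
  rw [← sub_eq_zero, ← integral_sub ((hm.integrable v).bdd_mul hW' hb)
    ((hm.integrable u).bdd_mul hW' hb)] at h1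
  rw [← h1]
  congr 1
  funext ω
  rw [← mul_sub, ← mul_sub, h.compensated_sub hlam hτ]

/-- The intensity changes only if `X` moves or the obligor defaults. The former is rare by
continuity in mean, and the latter has probability at most `L * (r - u)`, by the martingale property
with weight `1`. -/
lemma exists_integral_abs_defaultIntensity_sub_le [IsProbabilityMeasure μ]
    (h : IsMarkovChain μ 𝓕 X Q) (hlam : ∀ i, 0 ≤ lam i) (hτ : Measurable τ)
    (hm : Martingale (compensated lam X τ) 𝓕 μ) {ε : ℝ} (hε : 0 < ε) :
    ∃ δ > 0, ∀ u v : ℝ≥0, u ≤ v → (v : ℝ) - u < δ →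
      ∫ ω, |(∫ r in (u : ℝ)..v, defaultIntensity lam X τ r.toNNReal ω) -
        ((v : ℝ) - u) * defaultIntensity lam X τ u ω| ∂μ ≤ ε * ((v : ℝ) - u) := by
  have hL : 0 ≤ ∑ i, lam i := Finset.sum_nonneg fun i _ => hlam i
  set L := ∑ i, lam i with hLdef
  obtain ⟨δ, hδ, H⟩ := h.exists_integral_norm_sub_le (ε := ε / (2 * (L + 1))) (by positivity)
  refine ⟨min δ (ε / (2 * ((L + 1) * (L + 1)))), by positivity, fun u v huv hd => ?_⟩
  refine integral_abs_intervalIntegral_sub_le (h.measurable_uncurry_defaultIntensity hτ)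
    (h.abs_defaultIntensity_le hlam) huv fun r hur hrv => ?_
  have hrv' : (r : ℝ) ≤ v := hrv
  have hur' : (u : ℝ) ≤ r := hur
  have hYi : Integrable (fun ω => defaultInd τ r ω - defaultInd τ u ω) μ :=
    integrable_defaultInd_sub hτ u r
  have hY : ∫ ω, (defaultInd τ r ω - defaultInd τ u ω) ∂μ ≤ L * ((r : ℝ) - u) := by
    have e := h.integral_mul_defaultInd_sub hlam hτ hm hur (W := fun _ => 1) measurable_const
      (by simp)
    simp only [one_mul] at e
    rw [e]
    calc _ ≤ ∫ _ω, L * ((r : ℝ) - u) ∂μ :=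
          integral_mono (integrable_of_bounded (h.measurable_integral_defaultIntensity hτ hur)
            (h.abs_integral_defaultIntensity_le hlam hur)) (integrable_const _)
            fun ω => (le_abs_self _).trans (h.abs_integral_defaultIntensity_le hlam hur ω)
      _ = _ := by simp
  calc _ ≤ ∫ ω, (L * ‖X r ω - X u ω‖ + L * (defaultInd τ r ω - defaultInd τ u ω)) ∂μ := by
        refine integral_mono_of_nonneg (Eventually.of_forall fun ω => abs_nonneg _)
          (((h.integrable_norm_sub u r).const_mul _).add (hYi.const_mul _))
          (Eventually.of_forall fun ω => ?_)
        have e : defaultIntensity lam X τ r ω - defaultIntensity lam X τ u ω =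
            (lam ⬝ᵥ X r ω - lam ⬝ᵥ X u ω) * (1 - defaultInd τ r ω) +
              (lam ⬝ᵥ X u ω) * -(defaultInd τ r ω - defaultInd τ u ω) := by
          simp only [defaultIntensity]; ring
        have hmono := sub_nonneg.2 (defaultInd_mono τ ω hur)
        simp only [e]
        refine (abs_add_le _ _).trans ?_
        rw [abs_mul, abs_mul, abs_neg, abs_of_nonneg hmono]
        refine add_le_add ?_ (mul_le_mul_of_nonneg_right (h.abs_dotProduct_le hlam u ω) hmono)
        calc _ ≤ (L * ‖X r ω - X u ω‖) * 1 :=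
              mul_le_mul (abs_dotProduct_sub_le hlam u r ω) (abs_one_sub_defaultInd_le τ r ω)
                (abs_nonneg _) (by positivity)
          _ = _ := mul_one _
    _ ≤ L * (ε / (2 * (L + 1))) + L * (L * ((r : ℝ) - u)) := by
        rw [integral_add ((h.integrable_norm_sub u r).const_mul _) (hYi.const_mul _),
          integral_const_mul, integral_const_mul]
        gcongr
        exact H u r hur (by linarith [min_le_left δ (ε / (2 * ((L + 1) * (L + 1))))])
    _ ≤ (L + 1) * (ε / (2 * (L + 1))) +
          (L + 1) * ((L + 1) * (ε / (2 * ((L + 1) * (L + 1))))) := by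
        have : (r : ℝ) - u ≤ ε / (2 * ((L + 1) * (L + 1))) := by
          linarith [min_le_right δ (ε / (2 * ((L + 1) * (L + 1))))]
        have h0 : 0 ≤ (r : ℝ) - u := sub_nonneg.2 hur'
        gcongr <;> linarith
    _ = ε := by field_simp; ring

/-- Dominated convergence applied to the pathwise statement. As `X` moves by at most `1` in norm,
the sums are bounded by the telescoping increment of `Y`. -/
lemma tendsto_sum_integral_common_increments [IsProbabilityMeasure μ]
    (h : IsMarkovChain μ 𝓕 X Q) (hτ : Measurable τ)
    (hj : ∀ᵐ ω ∂μ, ∀ t : ℝ≥0, jump (fun u => defaultInd τ u ω) t • jump (fun u => X u ω) t = 0)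
    {s t : ℝ≥0} (hst : s ≤ t) :
    Tendsto (fun m : ℕ => ∑ k ∈ Finset.range (m + 1),
      ∫ ω, ‖X (gridPoint s t m (k + 1)) ω - X (gridPoint s t m k) ω‖ *
        (defaultInd τ (gridPoint s t m (k + 1)) ω - defaultInd τ (gridPoint s t m k) ω) ∂μ)
      atTop (𝓝 0) := by
  have hmeas : ∀ a b : ℝ≥0, Measurable fun ω => ‖X b ω - X a ω‖ *
      (defaultInd τ b ω - defaultInd τ a ω) := fun a b =>
    (h.measurable_norm_sub a b).mul ((measurable_defaultInd hτ b).sub (measurable_defaultInd hτ a))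
  have hbd : ∀ a b : ℝ≥0, a ≤ b → ∀ ω, |‖X b ω - X a ω‖ *
      (defaultInd τ b ω - defaultInd τ a ω)| ≤ defaultInd τ b ω - defaultInd τ a ω := by
    intro a b hab ω
    have h0 := sub_nonneg.2 (defaultInd_mono τ ω hab)
    rw [abs_of_nonneg (mul_nonneg (norm_nonneg _) h0)]
    exact mul_le_of_le_one_left h0 (h.norm_sub_le_one a b ω)
  have hint : ∀ a b : ℝ≥0, a ≤ b → Integrable (fun ω => ‖X b ω - X a ω‖ *
      (defaultInd τ b ω - defaultInd τ a ω)) μ := fun a b hab =>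
    integrable_of_bounded (hmeas a b) (C := 1) fun ω => (hbd a b hab ω).trans (by
      linarith [defaultInd_nonneg τ a ω, defaultInd_le_one τ b ω])
  have hlim := tendsto_integral_of_dominated_convergence (μ := μ)
    (F := fun (m : ℕ) ω => ∑ k ∈ Finset.range (m + 1),
      ‖X (gridPoint s t m (k + 1)) ω - X (gridPoint s t m k) ω‖ *
        (defaultInd τ (gridPoint s t m (k + 1)) ω - defaultInd τ (gridPoint s t m k) ω))
    (f := fun _ => (0 : ℝ)) (fun _ => 1)
    (fun m => (Finset.measurable_fun_sum _ fun k _ => hmeas _ _).aestronglyMeasurable)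
    (integrable_const _)
    (fun m => Eventually.of_forall fun ω => by
      refine (norm_sum_le_of_le _ fun k _ =>
        hbd _ _ (gridPoint_mono s t m k.le_succ) ω).trans ?_
      rw [Finset.sum_range_sub (fun k => defaultInd τ (gridPoint s t m k) ω)]
      linarith [defaultInd_nonneg τ (gridPoint s t m 0) ω,
        defaultInd_le_one τ (gridPoint s t m (m + 1)) ω])
    (by
      filter_upwards [hj] with ω hω
      exact tendsto_sum_common_increments (h.cadlag ω) hω hst)
  rw [integral_zero] at hlim
  refine hlim.congr fun m => ?_
  exact integral_finsetSum _ fun k _ => hint _ _ (gridPoint_mono s t m k.le_succ)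

/-- Without common jumps, the default intensity acts as killing at the rate `λᵀ X`. -/
lemma weightedMean_survival [IsProbabilityMeasure μ] (h : IsMarkovChain μ 𝓕 X Q)
    (hlam : ∀ i, 0 ≤ lam i) (hτ : Measurable τ) (hY : ∀ u, Measurable[𝓕 u] (defaultInd τ u))
    (hm : Martingale (compensated lam X τ) 𝓕 μ)
    (hj : ∀ᵐ ω ∂μ, ∀ t : ℝ≥0, jump (fun u => defaultInd τ u ω) t • jump (fun u => X u ω) t = 0)
    {u v : ℝ≥0} (huv : u ≤ v) {V : Ω → ℝ} (hV : Measurable[𝓕 u] V) (hV1 : ∀ ω, |V ω| ≤ 1) :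
    weightedMean μ (fun ω => V ω * (1 - defaultInd τ v ω)) (X v) =
      NormedSpace.exp (((v : ℝ) - u) • (Q - (1 : ℝ) • Matrix.diagonal lam)) *ᵥ
        weightedMean μ (fun ω => V ω * (1 - defaultInd τ u ω)) (X u) := by
  set W : ℝ≥0 → Ω → ℝ := fun r ω => V ω * (1 - defaultInd τ r ω) with hWdef
  have hWm : ∀ r, u ≤ r → Measurable[𝓕 r] (W r) := fun r hur =>
    (hV.mono (𝓕.mono hur) le_rfl).mul ((hY r).const_sub 1)
  have hWb : ∀ r ω, |W r ω| ≤ 1 := by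
    intro r ω
    rw [hWdef, abs_mul]
    exact mul_le_one₀ (hV1 ω) (abs_nonneg _) (abs_one_sub_defaultInd_le τ r ω)
  refine h.weightedMean_eq_exp_of_increments ((1 : ℝ) • Matrix.diagonal lam) huv W
    (fun r hr _ => hWm r hr) (fun r _ => hWb r)
    (fun a b => ∫ ω, ‖X b ω - X a ω‖ * (defaultInd τ b ω - defaultInd τ a ω) ∂μ)
    (fun ε hε => ?_) (h.tendsto_sum_integral_common_increments hτ hj huv)
  obtain ⟨δ, hδ, H⟩ := h.exists_integral_abs_defaultIntensity_sub_le hlam hτ hm hε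
  refine ⟨δ, hδ, fun a b hua hab hbv hd => ?_⟩
  have h1 := H a b hab hd
  have hη0 : 0 ≤ (b : ℝ) - a := sub_nonneg.2 hab
  set η := (b : ℝ) - a with hη
  have hVa : Measurable[𝓕 a] V := hV.mono (𝓕.mono hua) le_rfl
  have hVae : AEStronglyMeasurable V μ := (hV.mono (𝓕.le u) le_rfl).aestronglyMeasurable
  have hVb : ∀ᵐ ω ∂μ, ‖V ω‖ ≤ 1 := Eventually.of_forall hV1
  have hDY0 : ∀ ω, 0 ≤ defaultInd τ b ω - defaultInd τ a ω := fun ω =>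
    sub_nonneg.2 (defaultInd_mono τ ω hab)
  have hDY1 : ∀ ω, defaultInd τ b ω - defaultInd τ a ω ≤ 1 := fun ω => by
    linarith [defaultInd_nonneg τ a ω, defaultInd_le_one τ b ω]
  have hDYm : Measurable fun ω => defaultInd τ b ω - defaultInd τ a ω :=
    (measurable_defaultInd hτ b).sub (measurable_defaultInd hτ a)
  set I : Ω → ℝ := fun ω => ∫ r in (a : ℝ)..b, defaultIntensity lam X τ r.toNNReal ω with hI
  have hIi : Integrable I μ := integrable_of_bounded
    (h.measurable_integral_defaultIntensity hτ hab) (h.abs_integral_defaultIntensity_le hlam hab)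
  have hdi : Integrable (defaultIntensity lam X τ a) μ := integrable_of_bounded
    ((h.measurable_uncurry_defaultIntensity hτ).comp (measurable_id.prodMk measurable_const))
    (h.abs_defaultIntensity_le hlam a)
  have hKi : Integrable (fun ω => ‖X b ω - X a ω‖ * (defaultInd τ b ω - defaultInd τ a ω)) μ :=
    integrable_of_bounded ((h.measurable_norm_sub a b).mul hDYm) (C := 1) fun ω => by
      rw [abs_of_nonneg (mul_nonneg (norm_nonneg _) (hDY0 ω))]
      exact mul_le_one₀ (h.norm_sub_le_one a b ω) (hDY0 ω) (hDY1 ω)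
  have hAi : Integrable (fun ω => |I ω - η * defaultIntensity lam X τ a ω|) μ :=
    (hIi.sub (hdi.const_mul η)).abs
  have hB : Integrable (fun ω => |I ω - η * defaultIntensity lam X τ a ω| +
      ‖X b ω - X a ω‖ * (defaultInd τ b ω - defaultInd τ a ω)) μ := hAi.add hKi
  refine le_trans ?_ (add_le_add_left h1 _)
  rw [← integral_add hAi hKi]
  refine (pi_norm_le_iff_of_nonneg (integral_nonneg fun ω => ?_)).2 fun i => ?_
  · exact add_nonneg (abs_nonneg _) (mul_nonneg (norm_nonneg _) (hDY0 ω))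
  have hXV : ∀ r, Integrable (fun ω => V ω * X r ω i) μ := fun r =>
    (h.integrable_apply r i).bdd_mul hVae hVb
  have hVX1 : ∀ r ω, |V ω * X r ω i| ≤ 1 := fun r ω => by
    rw [abs_mul]; exact mul_le_one₀ (hV1 ω) (abs_nonneg _) (h.abs_le_one r ω i)
  have hVXm : Measurable[𝓕 a] fun ω => V ω * X a ω i := hVa.mul (h.measurable_apply a i)
  have hVXm' : ∀ r, AEStronglyMeasurable (fun ω => V ω * X r ω i) μ := fun r =>
    (hXV r).aestronglyMeasurable
  have hmart := h.integral_mul_defaultInd_sub hlam hτ hm hab hVXm (hVX1 a)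
  have hDYi : Integrable (fun ω => defaultInd τ b ω - defaultInd τ a ω) μ :=
    integrable_defaultInd_sub hτ a b
  have hi1 : ∀ r, Integrable (fun ω =>
      V ω * X r ω i * (defaultInd τ b ω - defaultInd τ a ω)) μ := fun r =>
    hDYi.bdd_mul (hVXm' r) (Eventually.of_forall (hVX1 r))
  have hi2 : Integrable (fun ω => V ω * X a ω i * I ω) μ :=
    hIi.bdd_mul (hVXm' a) (Eventually.of_forall (hVX1 a))
  have hi3 : Integrable (fun ω => V ω * X a ω i * (η * defaultIntensity lam X τ a ω)) μ :=
    (hdi.const_mul η).bdd_mul (hVXm' a) (Eventually.of_forall (hVX1 a))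
  have e1 : weightedMean μ (W b - W a) (X b) i =
      -∫ ω, V ω * X b ω i * (defaultInd τ b ω - defaultInd τ a ω) ∂μ := by
    rw [weightedMean, ← integral_neg]
    congr 1
    funext ω
    simp only [Pi.sub_apply, hWdef]
    ring
  have e2 : η * ((((1 : ℝ) • Matrix.diagonal lam) *ᵥ weightedMean μ (W a) (X a)) i) =
      ∫ ω, V ω * X a ω i * (η * defaultIntensity lam X τ a ω) ∂μ := by
    rw [h.smul_diagonal_mulVec_weightedMean, ← integral_const_mul]
    congr 1
    funext ω
    simp only [hWdef, defaultIntensity]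
    ring
  -- The martingale property needs a weight known at time `a`, whereas the loss of mass carries `X
  -- b`. Hence the term with `X a` is added and subtracted, and `hmart` exchanges its default
  -- increment for the integrated intensity `I`.
  have e3 : weightedMean μ (W b - W a) (X b) i +
      η * ((((1 : ℝ) • Matrix.diagonal lam) *ᵥ weightedMean μ (W a) (X a)) i) =
      ∫ ω, ((V ω * X a ω i * (η * defaultIntensity lam X τ a ω) - V ω * X a ω i * I ω) +
        (V ω * X a ω i * (defaultInd τ b ω - defaultInd τ a ω) -
          V ω * X b ω i * (defaultInd τ b ω - defaultInd τ a ω))) ∂μ := by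
    have e := integral_add (hi3.sub hi2) ((hi1 a).sub (hi1 b))
    simp only [Pi.sub_apply] at e
    rw [e, integral_sub hi3 hi2, integral_sub (hi1 a) (hi1 b), hmart, e1, e2]
    ring
  rw [Pi.add_apply, Pi.smul_apply, smul_eq_mul, e3]
  refine norm_integral_le_of_norm_le hB (Eventually.of_forall fun ω => ?_)
  have hXi : |X b ω i - X a ω i| ≤ ‖X b ω - X a ω‖ := norm_le_pi_norm (X b ω - X a ω) i
  -- The first term is the error of the rectangle rule; the second is a product of simultaneous
  -- increments, controlled by `κ`.
  have e4 : (V ω * X a ω i * (η * defaultIntensity lam X τ a ω) - V ω * X a ω i * I ω) +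
        (V ω * X a ω i * (defaultInd τ b ω - defaultInd τ a ω) -
          V ω * X b ω i * (defaultInd τ b ω - defaultInd τ a ω)) =
      -(V ω * X a ω i) * (I ω - η * defaultIntensity lam X τ a ω) +
        -V ω * ((X b ω i - X a ω i) * (defaultInd τ b ω - defaultInd τ a ω)) := by ring
  rw [e4]
  refine (norm_add_le _ _).trans ?_
  simp only [Real.norm_eq_abs]
  rw [abs_mul, abs_neg, abs_mul (-V ω), abs_neg, abs_mul (X b ω i - X a ω i),
    abs_of_nonneg (hDY0 ω)]
  refine add_le_add (mul_le_of_le_one_left (abs_nonneg _) (hVX1 a ω)) ?_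
  refine (mul_le_of_le_one_left (mul_nonneg (abs_nonneg _) (hDY0 ω)) (hV1 ω)).trans ?_
  exact mul_le_mul_of_nonneg_right hXi (hDY0 ω)

end IsMarkovChain

end Default

/-! ### From the past of `X` to its whole path. -/

section PathSigma

lemma measurable_indicator_one {Ω : Type*} {m : MeasurableSpace Ω} {G : Set Ω} (hG : MeasurableSet[m] G) :
    Measurable[m] (G.indicator fun _ => (1 : ℝ)) :=
  measurable_const.indicator hG

lemma abs_indicator_one_le {Ω : Type*} (G : Set Ω) (ω : Ω) : |G.indicator (fun _ => (1 : ℝ)) ω| ≤ 1 := by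
  by_cases h : ω ∈ G <;> simp [h]

/-- A π-λ argument. The condition `huniv` serves complements, as the whole space need not belong to
`C`. -/
lemma setIntegral_eq_zero_of_isPiSystem {Ω : Type*} {m mΩ : MeasurableSpace Ω} {μ : Measure Ω}
    (hm : m ≤ mΩ) {C : Set (Set Ω)} (hC : m = MeasurableSpace.generateFrom C) (hpi : IsPiSystem C)
    {f : Ω → ℝ} (hf : Integrable f μ) (h : ∀ G ∈ C, ∫ ω in G, f ω ∂μ = 0)
    (huniv : ∫ ω, f ω ∂μ = 0) (G : Set Ω) (hG : MeasurableSet[m] G) : ∫ ω in G, f ω ∂μ = 0 := by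
  induction G, hG using MeasurableSpace.induction_on_inter hC hpi with
  | empty => simp
  | basic G hG => exact h G hG
  | compl G hG ih =>
    have := integral_add_compl (hm _ hG) hf
    rw [ih, huniv] at this
    linarith
  | iUnion F hd hF ih =>
    rw [integral_iUnion (fun i => hm _ (hF i)) hd hf.integrableOn]
    simp [ih]

/-- The σ-algebra generated by the path of `X` up to time `t`. -/
@[reducible] def pastSigma {Ω ι : Type*} (X : ℝ≥0 → Ω → ι → ℝ) (t : ℝ≥0) : MeasurableSpace Ω :=
  ⨆ u ∈ Set.Iic t, MeasurableSpace.comap (X u) inferInstance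

lemma comap_le_pastSigma {Ω ι : Type*} (X : ℝ≥0 → Ω → ι → ℝ) {u t : ℝ≥0} (hu : u ≤ t) :
    MeasurableSpace.comap (X u) inferInstance ≤ pastSigma X t :=
  le_iSup₂_of_le (f := fun u (_ : u ∈ Set.Iic t) => MeasurableSpace.comap (X u) inferInstance)
    u hu le_rfl

lemma measurableSet_biInter_pastSigma {Ω ι : Type*} {X : ℝ≥0 → Ω → ι → ℝ} {U : Finset ℝ≥0} {f : ℝ≥0 → Set Ω}
    (hf : ∀ x ∈ U, MeasurableSet[MeasurableSpace.comap (X x) inferInstance] (f x)) {t : ℝ≥0}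
    (hU : ∀ x ∈ U, x ≤ t) : MeasurableSet[pastSigma X t] (⋂ x ∈ U, f x) :=
  @Finset.measurableSet_biInter _ _ (pastSigma X t) _ U fun x hx =>
    comap_le_pastSigma X (hU x hx) _ (hf x hx)

variable {Ω : Type*} {mΩ : MeasurableSpace Ω} {ι : Type*} [Fintype ι] [DecidableEq ι]
  {μ : Measure Ω} {𝓕 : Filtration ℝ≥0 mΩ} {X : ℝ≥0 → Ω → ι → ℝ} {Q : Matrix ι ι ℝ}

lemma weightedMean_sub {ι : Type*} {W W' : Ω → ℝ} {Z : Ω → ι → ℝ}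
    (h : ∀ i, Integrable (fun ω => W ω * Z ω i) μ)
    (h' : ∀ i, Integrable (fun ω => W' ω * Z ω i) μ) :
    weightedMean μ (fun ω => W ω - W' ω) Z = weightedMean μ W Z - weightedMean μ W' Z := by
  funext i
  simp only [weightedMean, Pi.sub_apply, sub_mul]
  exact integral_sub (h i) (h' i)

lemma weightedMean_indicator_mul {ι : Type*} {G : Set Ω} (hG : MeasurableSet G) (W : Ω → ℝ)
    (Z : Ω → ι → ℝ) (i : ι) :
    weightedMean μ (fun ω => G.indicator (fun _ => 1) ω * W ω) Z i =
      ∫ ω in G, W ω * Z ω i ∂μ := by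
  rw [weightedMean, ← integral_indicator hG]
  congr 1
  funext ω
  by_cases h : ω ∈ G <;> simp [h]

namespace IsMarkovChain

lemma pastSigma_le (h : IsMarkovChain μ 𝓕 X Q) (t : ℝ≥0) : pastSigma X t ≤ 𝓕 t :=
  iSup₂_le fun u hu => ((h.adapted u).measurable.mono (𝓕.mono hu) le_rfl).comap_le

/-- A weight which vanishes at time `s` in the mean given the past of `X`, and whose mean evolves
linearly, vanishes at all later times in the mean given the past of `X`. -/
lemma setIntegral_mul_eq_zero_of_evolution [IsProbabilityMeasure μ] (h : IsMarkovChain μ 𝓕 X Q)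
    {s : ℝ≥0} {D : ℝ≥0 → Ω → ℝ} (hDm : ∀ v, s ≤ v → Measurable (D v)) {c : ℝ}
    (hDb : ∀ v, s ≤ v → ∀ ω, |D v ω| ≤ c) (K : ℝ≥0 → ℝ≥0 → Matrix ι ι ℝ)
    (hK : ∀ u v, s ≤ u → u ≤ v → ∀ V : Ω → ℝ, Measurable[𝓕 u] V → (∀ ω, |V ω| ≤ 1) →
      weightedMean μ (fun ω => V ω * D v ω) (X v) =
        K u v *ᵥ weightedMean μ (fun ω => V ω * D u ω) (X u))
    (hs : ∀ G, MeasurableSet[pastSigma X s] G → ∀ i, ∫ ω in G, D s ω * X s ω i ∂μ = 0)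
    {v : ℝ≥0} (hv : s ≤ v) (G : Set Ω) (hG : MeasurableSet[pastSigma X v] G) (i : ι) :
    ∫ ω in G, D v ω * X v ω i ∂μ = 0 := by
  have hle : ∀ t, pastSigma X t ≤ mΩ := fun t => (h.pastSigma_le t).trans (𝓕.le t)
  have hs' : ∀ G, MeasurableSet[pastSigma X s] G →
      weightedMean μ (fun ω => G.indicator (fun _ => 1) ω * D s ω) (X s) = 0 := by
    intro G hG
    funext j
    rw [weightedMean_indicator_mul (hle _ _ hG), hs G hG, Pi.zero_apply]
  -- An event observed by time `s` is an admissible weight at time `s`, so its vanishing mean is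
  -- carried forward linearly.
  have hearly : ∀ v, s ≤ v → ∀ G, MeasurableSet[pastSigma X s] G →
      weightedMean μ (fun ω => G.indicator (fun _ => 1) ω * D v ω) (X v) = 0 := by
    intro v hv G hG
    rw [hK s v le_rfl hv _ (measurable_indicator_one (h.pastSigma_le s _ hG))
      (abs_indicator_one_le G), hs' G hG, Matrix.mulVec_zero]
  -- Induction over the observation times, removing the last one: the evolution from that time `a`
  -- to `v` reduces the claim to `v = a`.
  have key : ∀ (U : Finset ℝ≥0) (f : ℝ≥0 → Set Ω),
      (∀ x ∈ U, MeasurableSet[MeasurableSpace.comap (X x) inferInstance] (f x)) →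
      ∀ v, s ≤ v → (∀ x ∈ U, x ≤ v) →
      weightedMean μ (fun ω => (⋂ x ∈ U, f x).indicator (fun _ => 1) ω * D v ω) (X v) = 0 := by
    intro U f
    induction U using Finset.induction_on_max with
    | empty =>
      intro _ v hv _
      exact hearly v hv _ (by simp)
    | insert a U haU ih =>
      intro hf v hv hUv
      rcases le_or_gt a s with has | has
      · refine hearly v hv _ (measurableSet_biInter_pastSigma hf fun x hx => ?_)
        rcases Finset.mem_insert.1 hx with rfl | hx
        · exact has
        · exact (haU x hx).le.trans has
      · have hIa := measurableSet_biInter_pastSigma (t := a) hf fun x hx => by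
          rcases Finset.mem_insert.1 hx with rfl | hx
          · exact le_rfl
          · exact (haU x hx).le
        rw [hK a v has.le (hUv a (Finset.mem_insert_self a U)) _
          (measurable_indicator_one (h.pastSigma_le a _ hIa)) (abs_indicator_one_le _)]
        have ih' := ih (fun x hx => hf x (Finset.mem_insert_of_mem hx)) a has.le
          fun x hx => (haU x hx).le
        suffices hz : weightedMean μ (fun ω =>
            (⋂ x ∈ insert a U, f x).indicator (fun _ => 1) ω * D a ω) (X a) = 0 by
          rw [hz, Matrix.mulVec_zero]
        obtain ⟨B, -, hB⟩ := hf a (Finset.mem_insert_self a U)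
        funext j
        have hj := congrFun ih' j
        simp only [weightedMean, Pi.zero_apply] at hj ⊢
        rw [Finset.set_biInter_insert, ← hB]
        -- In the `j`-th coordinate only paths with `X a ω = e_j` count. There the last observation
        -- is decided: either it imposes nothing and the induction hypothesis applies, or the
        -- integrand is zero.
        by_cases hjB : Pi.single j 1 ∈ B
        · rw [← hj]
          congr 1
          funext ω
          rcases h.apply_eq_zero_or_one a ω j with h0 | h1
          · rw [h0, mul_zero, mul_zero]
          · have hm : ω ∈ X a ⁻¹' B := by
              rw [Set.mem_preimage, (h.eq_one_iff a ω j).1 h1]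
              exact hjB
            congr 2
            by_cases hω : ω ∈ ⋂ x ∈ U, f x
            · rw [Set.indicator_of_mem hω, Set.indicator_of_mem (Set.mem_inter hm hω)]
            · rw [Set.indicator_of_notMem hω, Set.indicator_of_notMem fun hh => hω hh.2]
        · rw [← integral_zero Ω ℝ (μ := μ)]
          congr 1
          funext ω
          rcases h.apply_eq_zero_or_one a ω j with h0 | h1
          · rw [h0, mul_zero]
          · have hm : ω ∉ X a ⁻¹' B := by
              rw [Set.mem_preimage, (h.eq_one_iff a ω j).1 h1]
              exact hjB
            rw [Set.indicator_of_notMem fun hh => hm hh.1, zero_mul, zero_mul]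
  have hint : Integrable (fun ω => D v ω * X v ω i) μ :=
    (h.integrable_apply v i).bdd_mul (hDm v hv).aestronglyMeasurable
      (Eventually.of_forall (hDb v hv))
  refine setIntegral_eq_zero_of_isPiSystem (hle v)
    (generateFrom_piiUnionInter_measurableSet
      (fun u => MeasurableSpace.comap (X u) inferInstance) (Set.Iic v)).symm
    (isPiSystem_piiUnionInter _ (fun u => @MeasurableSpace.isPiSystem_measurableSet _
      (MeasurableSpace.comap (X u) inferInstance)) _) hint ?_ ?_ G hG
  · rintro _ ⟨U, hU, f, hf, rfl⟩
    have := congrFun (key U f hf v hv fun x hx => hU hx) i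
    rwa [weightedMean_indicator_mul (hle v _ (measurableSet_biInter_pastSigma hf
      fun x hx => hU hx))] at this
  · have := congrFun (hearly v hv Set.univ MeasurableSet.univ) i
    rwa [weightedMean_indicator_mul MeasurableSet.univ, setIntegral_univ] at this

/-- A variable known at time `t`, which vanishes in the mean on every event of the past of `X` and
every state of `X_t`, vanishes in the mean on all events generated by the path of `X`. -/
lemma setIntegral_eq_zero_of_past [IsProbabilityMeasure μ] (h : IsMarkovChain μ 𝓕 X Q)
    {t : ℝ≥0} {D : Ω → ℝ} (hD : Measurable[𝓕 t] D) (hDb : ∀ ω, |D ω| ≤ 1)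
    (hs : ∀ G, MeasurableSet[pastSigma X t] G → ∀ i, ∫ ω in G, D ω * X t ω i ∂μ = 0)
    (G : Set Ω) (hG : MeasurableSet[⨆ u, MeasurableSpace.comap (X u) inferInstance] G) :
    ∫ ω in G, D ω ∂μ = 0 := by
  have hD' : Measurable D := hD.mono (𝓕.le t) le_rfl
  have hint : Integrable D μ := integrable_of_bounded hD' hDb
  have hle : ∀ t, pastSigma X t ≤ mΩ := fun t => (h.pastSigma_le t).trans (𝓕.le t)
  have key : ∀ v, t ≤ v → ∀ G, MeasurableSet[pastSigma X v] G → ∫ ω in G, D ω ∂μ = 0 := by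
    intro v hv G hG
    have h1 : ∀ i, ∫ ω in G, D ω * X v ω i ∂μ = 0 := fun i =>
      -- After time `t` the weight is frozen, and `X` flows with `Q` even on weights involving
      -- defaults, since it is Markov for `𝓕`.
      h.setIntegral_mul_eq_zero_of_evolution (D := fun _ => D) (fun _ _ => hD') (fun _ _ => hDb)
        (fun u v => NormedSpace.exp (((v : ℝ) - u) • Q))
        (fun u v hu huv V hV hV1 => h.weightedMean_eq huv (C := 1)
          (hV.mul (hD.mono (𝓕.mono hu) le_rfl)) fun ω => by
            rw [abs_mul]; exact mul_le_one₀ (hV1 ω) (abs_nonneg _) (hDb ω))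
        hs hv G hG i
    have h2 : ∀ ω, D ω = ∑ i, D ω * X v ω i := fun ω => by
      rw [← Finset.mul_sum, h.sum_eq_one, mul_one]
    rw [integral_congr_ae (Eventually.of_forall h2), integral_finsetSum]
    · exact Finset.sum_eq_zero fun i _ => h1 i
    · exact fun i _ => ((h.integrable_apply v i).bdd_mul hD'.aestronglyMeasurable
        (Eventually.of_forall hDb)).integrableOn
  have hpath : (⨆ u, MeasurableSpace.comap (X u) inferInstance) ≤ mΩ :=
    iSup_le fun u => ((h.adapted u).measurable.mono (𝓕.le u) le_rfl).comap_le
  refine setIntegral_eq_zero_of_isPiSystem hpath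
    (C := piiUnionInter (fun u => {s | MeasurableSet[MeasurableSpace.comap (X u) inferInstance] s})
      Set.univ) ?_
    (isPiSystem_piiUnionInter _ (fun u => @MeasurableSpace.isPiSystem_measurableSet _
      (MeasurableSpace.comap (X u) inferInstance)) _) hint ?_ ?_ G hG
  · rw [generateFrom_piiUnionInter_measurableSet
      (fun u => MeasurableSpace.comap (X u) inferInstance) Set.univ]
    simp
  · rintro _ ⟨U, -, f, hf, rfl⟩
    -- One time beyond `t` and all the finitely many observations.
    refine key (max t (U.sup id)) (le_max_left _ _) _ (measurableSet_biInter_pastSigma hf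
      fun x hx => ?_)
    exact (Finset.le_sup (f := id) hx).trans (le_max_right _ _)
  · have := key t le_rfl Set.univ MeasurableSet.univ
    rwa [setIntegral_univ] at this

end IsMarkovChain

end PathSigma

/-! ### Survival of one obligor given the path of `X`. -/

section Survival

variable {Ω : Type*} {mΩ : MeasurableSpace Ω} {d : ℕ} {μ : Measure Ω}
  {𝓕 : Filtration ℝ≥0 mΩ} {X : ℝ≥0 → Ω → Fin d → ℝ} {Q : Matrix (Fin d) (Fin d) ℝ}
  {lam : Fin d → ℝ} {τ : Ω → ℝ≥0∞}

namespace IsMarkovChain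

/-- Both parts of the difference evolve with the generator `Q - diag(λ)`, one by killing and the
other by Feynman–Kac, and the difference is zero at time `s`. The factors `-1` and `1` match the
general constant `c` of the Feynman–Kac formula. -/
lemma setIntegral_survival [IsProbabilityMeasure μ] (h : IsMarkovChain μ 𝓕 X Q)
    (hlam : ∀ i, 0 ≤ lam i) (hτ : Measurable τ) (hY : ∀ u, Measurable[𝓕 u] (defaultInd τ u))
    (hm : Martingale (compensated lam X τ) 𝓕 μ)
    (hj : ∀ᵐ ω ∂μ, ∀ t : ℝ≥0, jump (fun u => defaultInd τ u ω) t • jump (fun u => X u ω) t = 0)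
    {s t : ℝ≥0} (hst : s ≤ t) (G : Set Ω) (hG : MeasurableSet[pathSigma X] G) :
    ∫ ω in G, ((1 - defaultInd τ t ω) - (1 - defaultInd τ s ω) *
      Real.exp (-1 * intensityIntegral lam X s t ω)) ∂μ = 0 := by
  set D : ℝ≥0 → Ω → ℝ := fun v ω => (1 - defaultInd τ v ω) - (1 - defaultInd τ s ω) *
      Real.exp (-1 * intensityIntegral lam X s v ω) with hDdef
  have hE : ∀ v, s ≤ v → Measurable[𝓕 v] fun ω => (1 - defaultInd τ s ω) *
      Real.exp (-1 * intensityIntegral lam X s v ω) := fun v hv =>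
    (((hY s).const_sub 1).mono (𝓕.mono hv) le_rfl).mul
      (Real.measurable_exp.comp ((h.measurable_intensityIntegral_filtration hv).const_mul (-1)))
  have hDm : ∀ v, s ≤ v → Measurable[𝓕 v] (D v) := fun v hv => ((hY v).const_sub 1).sub (hE v hv)
  have hexp0 : ∀ v ω, 0 ≤ Real.exp (-1 * intensityIntegral lam X s v ω) := fun v ω =>
    (Real.exp_pos _).le
  have hexp1 : ∀ v, s ≤ v → ∀ ω, Real.exp (-1 * intensityIntegral lam X s v ω) ≤ 1 := by
    intro v hv ω
    have := h.intensityIntegral_nonneg hlam hv ω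
    exact Real.exp_le_one_iff.2 (by linarith)
  have hE0 : ∀ v ω, 0 ≤ (1 - defaultInd τ s ω) *
      Real.exp (-1 * intensityIntegral lam X s v ω) := fun v ω =>
    mul_nonneg (sub_nonneg.2 (defaultInd_le_one τ s ω)) (hexp0 v ω)
  have hE1 : ∀ v, s ≤ v → ∀ ω, (1 - defaultInd τ s ω) *
      Real.exp (-1 * intensityIntegral lam X s v ω) ≤ 1 := fun v hv ω =>
    mul_le_one₀ (by linarith [defaultInd_nonneg τ s ω]) (hexp0 v ω) (hexp1 v hv ω)
  have hDb : ∀ v, s ≤ v → ∀ ω, |D v ω| ≤ 1 := by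
    intro v hv ω
    rw [abs_le]
    constructor <;> linarith [hE0 v ω, hE1 v hv ω, defaultInd_nonneg τ v ω,
      defaultInd_le_one τ v ω]
  refine h.setIntegral_eq_zero_of_past (hDm t hst) (hDb t hst) (fun G hG i => ?_) G hG
  refine h.setIntegral_mul_eq_zero_of_evolution (D := D)
    (fun v hv => (hDm v hv).mono (𝓕.le v) le_rfl) hDb
    (fun u v => NormedSpace.exp (((v : ℝ) - u) • (Q - (1 : ℝ) • Matrix.diagonal lam)))
    (fun u v hu huv V hV hV1 => ?_) (fun G _ i => ?_) hst G hG i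
  · have hsplit : ∀ w, u ≤ w → weightedMean μ (fun ω => V ω * D w ω) (X w) =
        weightedMean μ (fun ω => V ω * (1 - defaultInd τ w ω)) (X w) -
        weightedMean μ (fun ω => (V ω * (1 - defaultInd τ s ω)) *
          Real.exp (-1 * intensityIntegral lam X s w ω)) (X w) := by
      intro w hw
      have hVm : Measurable V := hV.mono (𝓕.le u) le_rfl
      rw [← weightedMean_sub]
      · congr 1
        funext ω
        simp only [hDdef]
        ring
      · intro j
        refine (h.integrable_apply w j).bdd_mul
          (hVm.mul ((measurable_defaultInd hτ w).const_sub 1)).aestronglyMeasurable (c := 1)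
          (Eventually.of_forall fun ω => ?_)
        rw [Real.norm_eq_abs, abs_mul]
        exact mul_le_one₀ (hV1 ω) (abs_nonneg _) (abs_one_sub_defaultInd_le τ w ω)
      · intro j
        refine (h.integrable_apply w j).bdd_mul
          (f := fun ω => (V ω * (1 - defaultInd τ s ω)) *
            Real.exp (-1 * intensityIntegral lam X s w ω)) (c := 1) ?_
          (Eventually.of_forall fun ω => ?_)
        · simp only [mul_assoc (V _)]
          exact (hVm.mul ((hE w (hu.trans hw)).mono (𝓕.le w) le_rfl)).aestronglyMeasurable
        · rw [Real.norm_eq_abs, mul_assoc, abs_mul, abs_of_nonneg (hE0 w ω)]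
          exact mul_le_one₀ (hV1 ω) (hE0 w ω) (hE1 w (hu.trans hw) ω)
    rw [hsplit v huv, hsplit u le_rfl, Matrix.mulVec_sub,
      h.weightedMean_survival hlam hτ hY hm hj huv hV hV1,
      h.weightedMean_exp_neg_intensityIntegral hlam zero_le_one hu huv
        (V := fun ω => V ω * (1 - defaultInd τ s ω)) (hV.mul (((hY s).const_sub 1).mono (𝓕.mono hu) le_rfl)) fun ω => by
          rw [abs_mul]
          exact mul_le_one₀ (hV1 ω) (abs_nonneg _) (abs_one_sub_defaultInd_le τ s ω)]
  · simp [hDdef, intensityIntegral_self]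

end IsMarkovChain

lemma indicator_lt_eq (τ : Ω → ℝ≥0∞) (t : ℝ≥0) :
    ((τ ⁻¹' Set.Ioi (t : ℝ≥0∞)).indicator fun _ => (1 : ℝ)) = fun ω => 1 - defaultInd τ t ω := by
  funext ω
  rcases le_or_gt (τ ω) t with h1 | h1
  · rw [defaultInd_eq_one h1, Set.indicator_of_notMem (by simpa using h1), sub_self]
  · rw [defaultInd_eq_zero h1, Set.indicator_of_mem (by exact h1), sub_zero]

/-- Given the path of `X`, the survival probability decays at the rate `λᵀ X`. -/
lemma condExp_survival [IsProbabilityMeasure μ] (h : IsMarkovChain μ 𝓕 X Q)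
    (hlam : ∀ i, 0 ≤ lam i) (hτ : Measurable τ) (hY : ∀ u, Measurable[𝓕 u] (defaultInd τ u))
    (hm : Martingale (compensated lam X τ) 𝓕 μ)
    (hj : ∀ᵐ ω ∂μ, ∀ t : ℝ≥0, jump (fun u => defaultInd τ u ω) t • jump (fun u => X u ω) t = 0)
    {s t : ℝ≥0} (hst : s ≤ t) :
    μ⟦τ ⁻¹' Set.Ioi (t : ℝ≥0∞) | pathSigma X⟧ =ᵐ[μ] fun ω =>
      Real.exp (-1 * intensityIntegral lam X s t ω) *
        (μ⟦τ ⁻¹' Set.Ioi (s : ℝ≥0∞) | pathSigma X⟧) ω := by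
  have hle : pathSigma X ≤ mΩ :=
    iSup_le fun u => ((h.adapted u).measurable.mono (𝓕.le u) le_rfl).comap_le
  have hX : ∀ r ≤ t, Measurable[pathSigma X] (X r) := fun r _ =>
    Measurable.of_comap_le (le_iSup (fun u => MeasurableSpace.comap (X u) inferInstance) r)
  set e : Ω → ℝ := fun ω => Real.exp (-1 * intensityIntegral lam X s t ω) with he
  have hem : Measurable[pathSigma X] e :=
    Real.measurable_exp.comp ((h.measurable_intensityIntegral hst hX).const_mul (-1))
  have heb : ∀ ω, |e ω| ≤ 1 := by
    intro ω
    have := h.intensityIntegral_nonneg hlam hst ω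
    rw [he, Real.abs_exp]
    exact Real.exp_le_one_iff.2 (by linarith)
  have hS : ∀ r, Integrable (fun ω => 1 - defaultInd τ r ω) μ := fun r =>
    integrable_of_bounded ((measurable_defaultInd hτ r).const_sub 1)
      (abs_one_sub_defaultInd_le τ r)
  have heS : Integrable (e * fun ω => 1 - defaultInd τ s ω) μ :=
    (hS s).bdd_mul (hem.mono hle le_rfl).aestronglyMeasurable (Eventually.of_forall heb)
  rw [indicator_lt_eq, indicator_lt_eq]
  refine EventuallyEq.trans ?_ (condExp_mul_of_stronglyMeasurable_left hem.stronglyMeasurable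
    heS (hS s))
  refine (ae_eq_condExp_of_forall_setIntegral_eq hle (hS t)
    (fun _ _ _ => integrable_condExp.integrableOn) (fun G hG _ => ?_)
    stronglyMeasurable_condExp.aestronglyMeasurable).symm
  rw [setIntegral_condExp hle heS hG]
  have h1 := h.setIntegral_survival hlam hτ hY hm hj hst G hG
  have heS' : Integrable (fun ω => (1 - defaultInd τ s ω) *
      Real.exp (-1 * intensityIntegral lam X s t ω)) μ := by
    refine heS.congr (Eventually.of_forall fun ω => ?_)
    simp only [Pi.mul_apply, he, mul_comm]
  rw [integral_sub (hS t).integrableOn heS'.integrableOn, sub_eq_zero] at h1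
  rw [h1]
  refine setIntegral_congr_fun (hle _ hG) fun ω _ => ?_
  simp only [Pi.mul_apply, he, mul_comm]

end Survival

/-! ### Joint survival of several obligors. -/

section Product

variable {Ω : Type*} {mΩ : MeasurableSpace Ω} {n d : ℕ} {μ : Measure Ω}
  {𝓕 : Filtration ℝ≥0 mΩ} {X : ℝ≥0 → Ω → Fin d → ℝ} {Q : Matrix (Fin d) (Fin d) ℝ}
  {lam : Fin d → ℝ} {τ : Fin n → Ω → ℝ≥0∞}

/-- Survival past `r ≥ s` implies membership in `B i`, so the past constraint on an obligor of `I`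
is absorbed. What remains is one product event in the default times, to which conditional
independence applies. -/
lemma indicator_mul_prod_survival (A : Set Ω) {B : Fin n → Set ℝ≥0∞} {s r : ℝ≥0} (hsr : s ≤ r)
    (hB : ∀ i, Set.Ioi (s : ℝ≥0∞) ⊆ B i) (I : Finset (Fin n)) (ω : Ω) :
    (A ∩ ⋂ i, τ i ⁻¹' B i).indicator (fun _ => (1 : ℝ)) ω * ∏ i ∈ I, (1 - defaultInd (τ i) r ω) =
      A.indicator (fun _ => 1) ω *
        (⋂ i, τ i ⁻¹' (if i ∈ I then Set.Ioi (r : ℝ≥0∞) else B i)).indicator (fun _ => 1) ω := by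
  by_cases h : ∃ i ∈ I, τ i ω ≤ r
  · obtain ⟨i, hi, hτ⟩ := h
    rw [Finset.prod_eq_zero hi (by rw [defaultInd_eq_one hτ, sub_self]), mul_zero,
      eq_comm, mul_eq_zero]
    refine Or.inr (Set.indicator_of_notMem ?_ _)
    intro hω
    have := Set.mem_iInter.1 hω i
    rw [if_pos hi] at this
    exact absurd hτ (not_le.2 this)
  · push Not at h
    rw [Finset.prod_eq_one fun i hi => by rw [defaultInd_eq_zero (h i hi), sub_zero], mul_one]
    have hiff : ω ∈ (⋂ i, τ i ⁻¹' B i) ↔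
        ω ∈ ⋂ i, τ i ⁻¹' (if i ∈ I then Set.Ioi (r : ℝ≥0∞) else B i) := by
      simp only [Set.mem_iInter, Set.mem_preimage]
      refine forall_congr' fun i => ?_
      by_cases hi : i ∈ I
      · simp only [if_pos hi, Set.mem_Ioi]
        exact ⟨fun _ => h i hi, fun hr => hB i (lt_of_le_of_lt (by exact_mod_cast hsr) hr)⟩
      · rw [if_neg hi]
    by_cases h1 : ω ∈ A
    · by_cases h2 : ω ∈ ⋂ i, τ i ⁻¹' B i
      · rw [Set.indicator_of_mem (Set.mem_inter h1 h2), Set.indicator_of_mem h1,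
          Set.indicator_of_mem (hiff.1 h2), mul_one]
      · rw [Set.indicator_of_notMem fun hh => h2 hh.2,
          Set.indicator_of_notMem fun hh => h2 (hiff.2 hh), mul_zero]
    · rw [Set.indicator_of_notMem fun hh => h1 hh.1, Set.indicator_of_notMem h1, zero_mul]

lemma integral_mul_indicator_of_condIndepTimes [IsProbabilityMeasure μ] {𝓖 : MeasurableSpace Ω}
    (hle : 𝓖 ≤ mΩ) (hτ : ∀ i, Measurable[mΩ] (τ i)) (hind : CondIndepTimes μ 𝓖 τ)
    {B : Fin n → Set ℝ≥0∞} (hB : ∀ i, MeasurableSet (B i)) {W : Ω → ℝ} (hW : Measurable[𝓖] W)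
    (hW1 : ∀ ω, |W ω| ≤ 1) :
    ∫ ω, W ω * (⋂ i, τ i ⁻¹' B i).indicator (fun _ => 1) ω ∂μ =
      ∫ ω, W ω * ∏ i, (μ⟦τ i ⁻¹' B i | 𝓖⟧) ω ∂μ := by
  have hS : MeasurableSet[mΩ] (⋂ i, τ i ⁻¹' B i) := MeasurableSet.iInter fun i => hτ i (hB i)
  have hi : Integrable ((⋂ i, τ i ⁻¹' B i).indicator fun _ => (1 : ℝ)) μ :=
    (integrable_const _).indicator hS
  rw [integral_mul_congr_of_condExp hle hi
    (g := μ⟦⋂ i, τ i ⁻¹' B i | 𝓖⟧) integrable_condExp hW hW1 (by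
      rw [condExp_of_stronglyMeasurable hle stronglyMeasurable_condExp integrable_condExp])]
  refine integral_congr_ae ?_
  filter_upwards [hind B hB] with ω hω
  rw [hω]

/-- The mean of `X` on the event that all the obligors of `I` survive. -/
lemma weightedMean_prod_survival [IsProbabilityMeasure μ] (h : IsMarkovChain μ 𝓕 X Q)
    (hlam : ∀ i, 0 ≤ lam i) (hτ : ∀ i, Measurable (τ i))
    (hY : ∀ i u, Measurable[𝓕 u] (defaultInd (τ i) u))
    (hind : CondIndepTimes μ (pathSigma X) τ) {s t : ℝ≥0} (hst : s ≤ t)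
    (hsurv : ∀ i, μ⟦τ i ⁻¹' Set.Ioi (t : ℝ≥0∞) | pathSigma X⟧ =ᵐ[μ] fun ω =>
      Real.exp (-1 * intensityIntegral lam X s t ω) *
        (μ⟦τ i ⁻¹' Set.Ioi (s : ℝ≥0∞) | pathSigma X⟧) ω)
    {A : Set Ω} (hA : MeasurableSet[pastSigma X s] A) {B : Fin n → Set ℝ≥0∞}
    (hB : ∀ i, B i = Set.univ ∨ ∃ r : ℝ≥0, r ≤ s ∧ B i = Set.Ioi (r : ℝ≥0∞))
    (I : Finset (Fin n)) :
    weightedMean μ (fun ω => (A ∩ ⋂ i, τ i ⁻¹' B i).indicator (fun _ => 1) ω *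
        ∏ i ∈ I, (1 - defaultInd (τ i) t ω)) (X t) =
      NormedSpace.exp (((t : ℝ) - s) • (Q - (I.card : ℝ) • Matrix.diagonal lam)) *ᵥ
        weightedMean μ (fun ω => (A ∩ ⋂ i, τ i ⁻¹' B i).indicator (fun _ => 1) ω *
          ∏ i ∈ I, (1 - defaultInd (τ i) s ω)) (X s) := by
  have hle : pathSigma X ≤ mΩ :=
    iSup_le fun u => ((h.adapted u).measurable.mono (𝓕.le u) le_rfl).comap_le
  have hXp : ∀ r, Measurable[pathSigma X] (X r) := fun r =>
    Measurable.of_comap_le (le_iSup (fun u => MeasurableSpace.comap (X u) inferInstance) r)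
  have hAp : MeasurableSet[pathSigma X] A :=
    (iSup₂_le fun u _ => (hXp u).comap_le : pastSigma X s ≤ pathSigma X) A hA
  have hBs : ∀ i, Set.Ioi (s : ℝ≥0∞) ⊆ B i := by
    intro i
    rcases hB i with hi | ⟨r, hr, hi⟩
    · rw [hi]; exact Set.subset_univ _
    · rw [hi]; exact Set.Ioi_subset_Ioi (by exact_mod_cast hr)
  have hBm : ∀ i, MeasurableSet (B i) := by
    intro i
    rcases hB i with hi | ⟨r, -, hi⟩
    · rw [hi]; exact MeasurableSet.univ
    · rw [hi]; exact measurableSet_Ioi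
  set B' : ℝ≥0 → Fin n → Set ℝ≥0∞ := fun r i => if i ∈ I then Set.Ioi (r : ℝ≥0∞) else B i with hB'
  have hB'm : ∀ r i, MeasurableSet (B' r i) := by
    intro r i
    simp only [hB']
    split_ifs
    · exact measurableSet_Ioi
    · exact hBm i
  set N : ℝ≥0 → Ω → ℝ := fun r => (⋂ i, τ i ⁻¹' B' r i).indicator fun _ => 1 with hN
  have hw : ∀ r, s ≤ r → (fun ω => (A ∩ ⋂ i, τ i ⁻¹' B i).indicator (fun _ => (1 : ℝ)) ω *
      ∏ i ∈ I, (1 - defaultInd (τ i) r ω)) = fun ω => A.indicator (fun _ => 1) ω * N r ω :=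
    fun r hr => funext fun ω => indicator_mul_prod_survival A hr hBs I ω
  rw [hw t hst, hw s le_rfl]
  have hS : MeasurableSet[𝓕 s] (⋂ i, τ i ⁻¹' B' s i) := by
    have hIoi : ∀ i, ∀ r ≤ s, MeasurableSet[𝓕 s] (τ i ⁻¹' Set.Ioi (r : ℝ≥0∞)) := by
      intro i r hr
      have e : τ i ⁻¹' Set.Ioi (r : ℝ≥0∞) = defaultInd (τ i) r ⁻¹' {0} := by
        ext ω
        rcases le_or_gt (τ i ω) r with h1 | h1
        · simp [defaultInd_eq_one h1, h1]
        · simp [defaultInd_eq_zero h1, h1]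
      rw [e]
      exact ((hY i r).mono (𝓕.mono hr) le_rfl) (measurableSet_singleton 0)
    refine @MeasurableSet.iInter _ _ (𝓕 s) _ _ fun i => ?_
    simp only [hB']
    split_ifs
    · exact hIoi i s le_rfl
    · rcases hB i with hi | ⟨r, hr, hi⟩
      · rw [hi]; exact @MeasurableSet.univ _ (𝓕 s)
      · rw [hi]; exact hIoi i r hr
  set V : Ω → ℝ := fun ω => A.indicator (fun _ => 1) ω * N s ω with hV
  have hVm : Measurable[𝓕 s] V :=
    (measurable_indicator_one (h.pastSigma_le s A hA)).mul (measurable_indicator_one hS)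
  have hVb : ∀ ω, |V ω| ≤ 1 := fun ω => by
    rw [hV, abs_mul]
    exact mul_le_one₀ (abs_indicator_one_le A ω) (abs_nonneg _) (abs_indicator_one_le _ ω)
  -- Feynman–Kac with killing at `I.card` times the single rate, started from the event as seen at
  -- time `s`.
  have hFK := h.weightedMean_exp_neg_intensityIntegral hlam (Nat.cast_nonneg I.card) le_rfl hst
    hVm hVb
  simp only [intensityIntegral_self, mul_zero, Real.exp_zero, mul_one] at hFK
  rw [← hFK]
  funext j
  set e : Ω → ℝ := fun ω => Real.exp (-(I.card : ℝ) * intensityIntegral lam X s t ω) with he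
  have hem : Measurable[pathSigma X] e := Real.measurable_exp.comp
    ((h.measurable_intensityIntegral hst fun r _ => hXp r).const_mul _)
  have heb : ∀ ω, |e ω| ≤ 1 := by
    intro ω
    have := mul_nonneg (Nat.cast_nonneg (α := ℝ) I.card) (h.intensityIntegral_nonneg hlam hst ω)
    rw [he, Real.abs_exp]
    exact Real.exp_le_one_iff.2 (by linarith)
  set W : Ω → ℝ := fun ω => A.indicator (fun _ => 1) ω * X t ω j with hW
  have hWm : Measurable[pathSigma X] W :=
    (measurable_indicator_one hAp).mul ((measurable_pi_apply j).comp (hXp t))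
  have hWb : ∀ ω, |W ω| ≤ 1 := fun ω => by
    rw [hW, abs_mul]
    exact mul_le_one₀ (abs_indicator_one_le A ω) (abs_nonneg _) (h.abs_le_one t ω j)
  have hWe : ∀ ω, |W ω * e ω| ≤ 1 := fun ω => by
    rw [abs_mul]
    exact mul_le_one₀ (hWb ω) (abs_nonneg _) (heb ω)
  -- Each obligor in `I` contributes one factor `exp(-∫ λᵀX)`; for the others the event is the same
  -- at both times.
  have hp : ∀ᵐ ω ∂μ, ∏ i, (μ⟦τ i ⁻¹' B' t i | pathSigma X⟧) ω =
      e ω * ∏ i, (μ⟦τ i ⁻¹' B' s i | pathSigma X⟧) ω := by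
    filter_upwards [ae_all_iff.2 hsurv] with ω hω
    have h1 : ∀ i, (μ⟦τ i ⁻¹' B' t i | pathSigma X⟧) ω =
        (if i ∈ I then Real.exp (-1 * intensityIntegral lam X s t ω) else 1) *
          (μ⟦τ i ⁻¹' B' s i | pathSigma X⟧) ω := by
      intro i
      by_cases hi : i ∈ I
      · simp only [hB', if_pos hi]
        exact hω i
      · simp only [hB', if_neg hi, one_mul]
    rw [Finset.prod_congr rfl fun i _ => h1 i, Finset.prod_mul_distrib]
    congr 1
    rw [Finset.prod_ite_mem, Finset.univ_inter, Finset.prod_const, ← Real.exp_nat_mul, he]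
    congr 1
    ring
  -- Conditional independence is used twice: to factor the event at time `t`, and, after extracting
  -- the path-measurable exponential, to reassemble the event at time `s`.
  calc weightedMean μ (fun ω => A.indicator (fun _ => 1) ω * N t ω) (X t) j
      = ∫ ω, W ω * N t ω ∂μ := by
        rw [weightedMean]
        congr 1
        funext ω
        simp only [hW]
        ring
    _ = ∫ ω, W ω * ∏ i, (μ⟦τ i ⁻¹' B' t i | pathSigma X⟧) ω ∂μ :=
        integral_mul_indicator_of_condIndepTimes hle hτ hind (hB'm t) hWm hWb
    _ = ∫ ω, (W ω * e ω) * ∏ i, (μ⟦τ i ⁻¹' B' s i | pathSigma X⟧) ω ∂μ := by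
        refine integral_congr_ae ?_
        filter_upwards [hp] with ω hω
        rw [hω, ← mul_assoc]
    _ = ∫ ω, (W ω * e ω) * N s ω ∂μ :=
        (integral_mul_indicator_of_condIndepTimes hle hτ hind (hB'm s) (hWm.mul hem) hWe).symm
    _ = _ := by
        rw [weightedMean]
        congr 1
        funext ω
        simp only [hW, hV, he]
        ring

end Product

/-! ### Binomial eigenvectors and the lumped generator. -/

section Lumping

variable {n d : ℕ}

/-- With `m = n - l` survivors this reads `m (C(m-1,k) - C(m,k)) = -k C(m,k)`: every set of `k`
survivors is broken at the rate `k`. -/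
lemma sum_choose_mul_deathMatrix (n k : ℕ) (l : Fin (n + 1)) :
    ∑ a : Fin (n + 1), ((n - (a : ℕ)).choose k : ℝ) * deathMatrix n a l =
      -(k : ℝ) * ((n - (l : ℕ)).choose k : ℝ) := by
  have hl : (l : ℕ) ≤ n := Nat.lt_succ_iff.1 l.2
  have hterm : ∀ a : Fin (n + 1), ((n - (a : ℕ)).choose k : ℝ) * deathMatrix n a l =
      (if a = l then -(((n - (l : ℕ)).choose k : ℝ) * ((n : ℝ) - (l : ℕ))) else 0) +
      (if (a : ℕ) = l + 1 then ((n - ((l : ℕ) + 1)).choose k : ℝ) * ((n : ℝ) - (l : ℕ)) else 0) := by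
    intro a
    simp only [deathMatrix, Matrix.of_apply, Fin.ext_iff]
    by_cases h1 : (a : ℕ) = l
    · rw [if_pos h1, if_pos h1, if_neg (by omega), h1]; ring
    · by_cases h2 : (a : ℕ) = l + 1
      · rw [if_neg h1, if_pos h2, if_neg h1, if_pos h2, h2]; ring
      · rw [if_neg h1, if_neg h2, if_neg h1, if_neg h2]; ring
  rw [Finset.sum_congr rfl fun a _ => hterm a, Finset.sum_add_distrib, Finset.sum_ite_eq',
    if_pos (Finset.mem_univ _)]
  have hsecond : (∑ a : Fin (n + 1), if (a : ℕ) = l + 1 then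
      ((n - ((l : ℕ) + 1)).choose k : ℝ) * ((n : ℝ) - (l : ℕ)) else 0) =
      ((n - ((l : ℕ) + 1)).choose k : ℝ) * ((n : ℝ) - (l : ℕ)) := by
    rcases lt_or_eq_of_le hl with hlt | heq
    · rw [Finset.sum_eq_single (⟨l + 1, by omega⟩ : Fin (n + 1))]
      · simp
      · intro b _ hb
        rw [if_neg]
        intro hb'
        exact hb (Fin.ext hb')
      · intro hh; exact absurd (Finset.mem_univ _) hh
    -- In the last column there is no row `l + 1`, but the rate `n - l` is zero as well.
    · rw [heq, sub_self, mul_zero]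
      simp
  rw [hsecond]
  have hsub : (n : ℝ) - (l : ℕ) = ((n - (l : ℕ) : ℕ) : ℝ) := (Nat.cast_sub hl).symm
  rw [hsub, ← Nat.sub_sub]
  generalize n - (l : ℕ) = m
  rcases m with _ | m
  · rcases k with _ | k <;> simp
  rcases k with _ | k
  · simp
  · have h1 : ((m : ℝ) + 1) * (m.choose k) = ((m + 1).choose (k + 1)) * ((k : ℝ) + 1) := by
      exact_mod_cast Nat.add_one_mul_choose_eq m k
    have h2 : ((m + 1).choose (k + 1) : ℝ) = m.choose k + m.choose (k + 1) := by
      exact_mod_cast Nat.choose_succ_succ m k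
    rw [Nat.add_sub_cancel]
    push_cast
    linear_combination (-1 : ℝ) * h1 - ((m : ℝ) + 1) * h2

lemma deathMatrix_col_sum (n : ℕ) (l : Fin (n + 1)) : ∑ a, deathMatrix n a l = 0 := by
  simpa using sum_choose_mul_deathMatrix n 0 l

lemma deathMatrix_offDiag_nonneg (n : ℕ) (a l : Fin (n + 1)) (h : a ≠ l) :
    0 ≤ deathMatrix n a l := by
  have hl : ((l : ℕ) : ℝ) ≤ n := by exact_mod_cast Nat.lt_succ_iff.1 l.2
  simp only [deathMatrix, Matrix.of_apply, if_neg (Fin.val_ne_of_ne h)]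
  split_ifs
  · linarith
  · exact le_rfl

lemma bigQ_apply (n : ℕ) {d : ℕ} (lam : Fin d → ℝ) (Q : Matrix (Fin d) (Fin d) ℝ)
    (p q : Fin (n + 1) × Fin d) : bigQ n lam Q p q =
      deathMatrix n p.1 q.1 * Matrix.diagonal lam p.2 q.2 +
        (1 : Matrix (Fin (n + 1)) (Fin (n + 1)) ℝ) p.1 q.1 * Q p.2 q.2 := rfl

lemma bigQ_offDiag_nonneg {lam : Fin d → ℝ} (hlam : ∀ i, 0 ≤ lam i)
    {Q : Matrix (Fin d) (Fin d) ℝ} (hQ : ∀ i j, i ≠ j → 0 ≤ Q i j)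
    (p q : Fin (n + 1) × Fin d) (hpq : p ≠ q) : 0 ≤ bigQ n lam Q p q := by
  rw [bigQ_apply]
  by_cases h1 : p.1 = q.1
  · have h2 : p.2 ≠ q.2 := fun h2 => hpq (Prod.ext h1 h2)
    rw [Matrix.diagonal_apply_ne _ h2, mul_zero, zero_add, h1, Matrix.one_apply_eq, one_mul]
    exact hQ _ _ h2
  · rw [Matrix.one_apply_ne h1, zero_mul, add_zero]
    refine mul_nonneg (deathMatrix_offDiag_nonneg n _ _ h1) ?_
    rw [Matrix.diagonal_apply]
    split_ifs
    · exact hlam _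
    · exact le_rfl

lemma bigQ_col_sum {lam : Fin d → ℝ} {Q : Matrix (Fin d) (Fin d) ℝ} (hQ : ∀ j, ∑ i, Q i j = 0)
    (q : Fin (n + 1) × Fin d) : ∑ p, bigQ n lam Q p q = 0 := by
  have h1 : ∀ a b, bigQ n lam Q (a, b) q = deathMatrix n a q.1 * Matrix.diagonal lam b q.2 +
      (1 : Matrix (Fin (n + 1)) (Fin (n + 1)) ℝ) a q.1 * Q b q.2 := fun _ _ => rfl
  rw [Fintype.sum_prod_type]
  simp only [h1, Finset.sum_add_distrib, ← Finset.mul_sum, hQ,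
    mul_zero, add_zero, ← Finset.sum_mul, deathMatrix_col_sum, zero_mul]

/-- The matrix which maps `ν ⊗ x` to `C(n - N, k) x` when `ν` is the `N`-th basis vector. -/
def choosePool (n d k : ℕ) : Matrix (Fin d) (Fin (n + 1) × Fin d) ℝ :=
  Matrix.of fun i p => ((n - (p.1 : ℕ)).choose k : ℝ) * (1 : Matrix (Fin d) (Fin d) ℝ) i p.2

lemma choosePool_mul_bigQ (k : ℕ) (lam : Fin d → ℝ) (Q : Matrix (Fin d) (Fin d) ℝ) :
    choosePool n d k * bigQ n lam Q =
      (Q - (k : ℝ) • Matrix.diagonal lam) * choosePool n d k := by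
  ext i ⟨l, j⟩
  have h1 : (choosePool n d k * bigQ n lam Q) i (l, j) =
      (∑ a : Fin (n + 1), ((n - (a : ℕ)).choose k : ℝ) * deathMatrix n a l) *
        Matrix.diagonal lam i j + ((n - (l : ℕ)).choose k : ℝ) * Q i j := by
    simp only [Matrix.mul_apply, choosePool, Matrix.of_apply, bigQ_apply, Fintype.sum_prod_type,
      Matrix.one_apply, mul_ite, mul_one, mul_zero, ite_mul, zero_mul, one_mul,
      Finset.sum_ite_eq, Finset.mem_univ, if_true, mul_add, Finset.sum_add_distrib,
      Finset.sum_mul, mul_assoc, Finset.sum_ite_irrel, Finset.sum_const_zero, Finset.sum_ite_eq']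
  have h2 : ((Q - (k : ℝ) • Matrix.diagonal lam) * choosePool n d k) i (l, j) =
      ((n - (l : ℕ)).choose k : ℝ) * (Q i j - k * Matrix.diagonal lam i j) := by
    simp only [Matrix.mul_apply, choosePool, Matrix.of_apply, Matrix.one_apply, mul_ite, mul_one,
      mul_zero, Finset.sum_ite_eq', Finset.mem_univ, if_true, Matrix.sub_apply,
      Matrix.smul_apply, smul_eq_mul]
    ring
  rw [h1, h2, sum_choose_mul_deathMatrix]
  ring

/-- For `k = n - m` the coefficient `C(n - l, k)` is `1` at `l = m` and `0` for `l > m`. The system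
is triangular and is solved by strong induction on the number of defaults. -/
lemma eq_zero_of_choosePool_mulVec {v : Fin (n + 1) × Fin d → ℝ}
    (h : ∀ k, choosePool n d k *ᵥ v = 0) : v = 0 := by
  have key : ∀ m : ℕ, ∀ l : Fin (n + 1), (l : ℕ) = m → ∀ j, v (l, j) = 0 := by
    intro m
    induction m using Nat.strong_induction_on with
    | _ m ih =>
      intro l hl j
      have h1 := congrFun (h (n - m)) j
      simp only [Matrix.mulVec, dotProduct, choosePool, Matrix.of_apply, Fintype.sum_prod_type,
        Matrix.one_apply, mul_ite, mul_one, mul_zero, ite_mul, zero_mul, Finset.sum_ite_eq,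
        Finset.mem_univ, if_true, Pi.zero_apply] at h1
      rw [Finset.sum_eq_single l] at h1
      · rw [hl, Nat.choose_self] at h1
        simpa using h1
      · intro a _ hal
        have hne : (a : ℕ) ≠ m := fun ha => hal (Fin.ext (ha.trans hl.symm))
        rcases lt_or_gt_of_ne hne with hlt | hgt
        · rw [ih a hlt a rfl j, mul_zero]
        · have ha : (a : ℕ) ≤ n := Nat.lt_succ_iff.1 a.2
          rw [Nat.choose_eq_zero_of_lt (by omega), Nat.cast_zero, zero_mul]
      · intro hh; exact absurd (Finset.mem_univ _) hh
  funext ⟨l, j⟩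
  exact key l l rfl j

end Lumping

/-! ### Paths of `ζ` and counting of survivors. -/

section Paths

lemma eventually_right_defaultInd {Ω : Type*} (τ : Ω → ℝ≥0∞) (ω : Ω) (t : ℝ≥0) :
    ∀ᶠ u in 𝓝[≥] t, defaultInd τ u ω = defaultInd τ t ω := by
  rcases le_or_gt (τ ω) t with h | h
  · filter_upwards [self_mem_nhdsWithin] with u hu
    have hu' : t ≤ u := hu
    rw [defaultInd_eq_one h, defaultInd_eq_one (h.trans (by exact_mod_cast hu'))]
  · have : ∀ᶠ u : ℝ≥0 in 𝓝 t, (u : ℝ≥0∞) < τ ω :=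
      ENNReal.continuous_coe.continuousAt.eventually_lt_const h
    filter_upwards [nhdsWithin_le_nhds this] with u hu
    rw [defaultInd_eq_zero h, defaultInd_eq_zero hu]

lemma exists_eventually_left_defaultInd {Ω : Type*} (τ : Ω → ℝ≥0∞) (ω : Ω) (t : ℝ≥0) :
    ∃ c, ∀ᶠ u in 𝓝[<] t, defaultInd τ u ω = c := by
  rcases lt_or_ge (τ ω) t with h | h
  · refine ⟨1, ?_⟩
    have : ∀ᶠ u : ℝ≥0 in 𝓝 t, τ ω < (u : ℝ≥0∞) :=
      ENNReal.continuous_coe.continuousAt.eventually_const_lt h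
    filter_upwards [nhdsWithin_le_nhds this] with u hu
    exact defaultInd_eq_one hu.le
  · refine ⟨0, ?_⟩
    filter_upwards [self_mem_nhdsWithin] with u hu
    have hu' : u < t := hu
    exact defaultInd_eq_zero (lt_of_lt_of_le (by exact_mod_cast hu') h)

variable {Ω : Type*} {n d : ℕ}

lemma nu_eq_ite (τ : Fin n → Ω → ℝ≥0∞) (t : ℝ≥0) (ω : Ω) (k : Fin (n + 1)) :
    nu τ t ω k = if defaultCount τ t ω = ((k : ℕ) : ℝ) then 1 else 0 := by
  simp only [nu, Set.indicator_apply, Set.mem_ofPred_eq, Pi.one_apply]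

/-- Every default indicator is constant on a short interval on either side of `t`, hence so is `ν`,
and the regularity of `X` suffices. -/
lemma isCadlag_zeta {X : ℝ≥0 → Ω → Fin d → ℝ} (τ : Fin n → Ω → ℝ≥0∞) (ω : Ω)
    (hX : IsCadlag fun t => X t ω) : IsCadlag fun t => zeta X τ t ω := by
  intro t
  obtain ⟨hr, l, hl⟩ := hX t
  constructor
  · have h1 : ∀ᶠ u in 𝓝[≥] t, ∀ i, defaultInd (τ i) u ω = defaultInd (τ i) t ω :=
      eventually_all.2 fun i => eventually_right_defaultInd (τ i) ω t
    refine tendsto_pi_nhds.2 fun p => ?_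
    have h2 : Tendsto (fun u => nu τ t ω p.1 * X u ω p.2) (𝓝[≥] t)
        (𝓝 (nu τ t ω p.1 * X t ω p.2)) :=
      ((tendsto_pi_nhds.1 hr) p.2).const_mul _
    refine h2.congr' ?_
    filter_upwards [h1] with u hu
    have hu' : defaultCount τ u ω = defaultCount τ t ω := Finset.sum_congr rfl fun i _ => hu i
    rw [zeta, nu_eq_ite, nu_eq_ite, hu']
  · choose c hc using fun i => exists_eventually_left_defaultInd (τ i) ω t
    refine ⟨fun p => (if ∑ i, c i = ((p.1 : ℕ) : ℝ) then 1 else 0) * l p.2,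
      tendsto_pi_nhds.2 fun p => ?_⟩
    refine (((tendsto_pi_nhds.1 hl) p.2).const_mul _).congr' ?_
    filter_upwards [eventually_all.2 hc] with u hu
    have hu' : defaultCount τ u ω = ∑ i, c i := Finset.sum_congr rfl fun i _ => hu i
    rw [zeta, nu_eq_ite, hu']

open Classical in
/-- The set of obligors which survive time `t`. -/
noncomputable def survivors (τ : Fin n → Ω → ℝ≥0∞) (t : ℝ≥0) (ω : Ω) : Finset (Fin n) :=
  Finset.univ.filter fun i => (t : ℝ≥0∞) < τ i ω

lemma mem_survivors {τ : Fin n → Ω → ℝ≥0∞} {t : ℝ≥0} {ω : Ω} {i : Fin n} :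
    i ∈ survivors τ t ω ↔ (t : ℝ≥0∞) < τ i ω := by simp [survivors]

lemma one_sub_defaultInd_eq (τ : Fin n → Ω → ℝ≥0∞) (t : ℝ≥0) (ω : Ω) (i : Fin n) :
    1 - defaultInd (τ i) t ω = if i ∈ survivors τ t ω then 1 else 0 := by
  split_ifs with h
  · rw [defaultInd_eq_zero (mem_survivors.1 h), sub_zero]
  · rw [defaultInd_eq_one (not_lt.1 fun hh => h (mem_survivors.2 hh)), sub_self]

lemma card_survivors_le (τ : Fin n → Ω → ℝ≥0∞) (t : ℝ≥0) (ω : Ω) :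
    (survivors τ t ω).card ≤ n := by simpa using (survivors τ t ω).card_le_univ

lemma defaultCount_eq (τ : Fin n → Ω → ℝ≥0∞) (t : ℝ≥0) (ω : Ω) :
    defaultCount τ t ω = ((n - (survivors τ t ω).card : ℕ) : ℝ) := by
  have h : ∑ i, (1 - defaultInd (τ i) t ω) = ((survivors τ t ω).card : ℝ) := by
    simp only [one_sub_defaultInd_eq, Finset.sum_ite_mem, Finset.univ_inter]
    simp
  rw [Finset.sum_sub_distrib] at h
  rw [Nat.cast_sub (card_survivors_le τ t ω), ← h, defaultCount]
  simp

/-- The number of defaults as an element of `{0, …, n}`. -/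
noncomputable def defaultIndex (τ : Fin n → Ω → ℝ≥0∞) (t : ℝ≥0) (ω : Ω) : Fin (n + 1) :=
  ⟨n - (survivors τ t ω).card, Nat.lt_succ_of_le (Nat.sub_le _ _)⟩

lemma nu_eq_single (τ : Fin n → Ω → ℝ≥0∞) (t : ℝ≥0) (ω : Ω) :
    nu τ t ω = Pi.single (defaultIndex τ t ω) 1 := by
  funext k
  rw [nu_eq_ite, defaultCount_eq, Pi.single_apply]
  refine if_congr ?_ rfl rfl
  rw [Nat.cast_inj, Fin.ext_iff, defaultIndex, eq_comm]

lemma zeta_eq_single {X : ℝ≥0 → Ω → Fin d → ℝ} (τ : Fin n → Ω → ℝ≥0∞) {t : ℝ≥0} {ω : Ω}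
    {j : Fin d} (hj : X t ω = Pi.single j 1) :
    zeta X τ t ω = Pi.single (defaultIndex τ t ω, j) 1 := by
  funext p
  rw [zeta, nu_eq_single, hj]
  simp only [Pi.single_apply, Prod.ext_iff]
  split_ifs <;> simp_all

/-- A product is `1` exactly when `I` consists of survivors, so the sum counts the sets of `k`
survivors. -/
lemma sum_prod_survival (τ : Fin n → Ω → ℝ≥0∞) (t : ℝ≥0) (ω : Ω) (k : ℕ) :
    ∑ I ∈ Finset.univ.powersetCard k, ∏ i ∈ I, (1 - defaultInd (τ i) t ω) =
      ((survivors τ t ω).card.choose k : ℝ) := by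
  classical
  have h1 : ∀ I : Finset (Fin n), ∏ i ∈ I, (1 - defaultInd (τ i) t ω) =
      if I ⊆ survivors τ t ω then 1 else 0 := by
    intro I
    simp only [one_sub_defaultInd_eq, Finset.prod_ite_zero, Finset.prod_const_one]
    exact if_congr Iff.rfl rfl rfl
  simp only [h1, Finset.sum_ite, Finset.sum_const_zero, add_zero, Finset.sum_const, nsmul_eq_mul,
    mul_one]
  rw [← Finset.card_powersetCard]
  congr 2
  ext I
  simp only [Finset.mem_filter, Finset.mem_powersetCard, Finset.subset_univ, true_and]
  exact and_comm

lemma choosePool_mulVec_zeta (X : ℝ≥0 → Ω → Fin d → ℝ) (τ : Fin n → Ω → ℝ≥0∞) (t : ℝ≥0)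
    (ω : Ω) (k : ℕ) (i : Fin d) :
    (choosePool n d k *ᵥ zeta X τ t ω) i =
      ∑ I ∈ Finset.univ.powersetCard k, (∏ i ∈ I, (1 - defaultInd (τ i) t ω)) * X t ω i := by
  rw [← Finset.sum_mul, sum_prod_survival]
  simp only [Matrix.mulVec, dotProduct, choosePool, Matrix.of_apply, Fintype.sum_prod_type,
    Matrix.one_apply, mul_ite, mul_one, mul_zero, ite_mul, zero_mul, one_mul, zeta, nu_eq_single,
    Pi.single_apply, Finset.sum_ite_irrel, Finset.sum_const_zero, Finset.sum_ite_eq,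
    Finset.sum_ite_eq', Finset.mem_univ, if_true]
  rw [defaultIndex, Nat.sub_sub_self (card_survivors_le τ t ω)]

end Paths

/-! ### A π-system of survival events for the full filtration. -/

section Events

variable {Ω : Type*} {n d : ℕ}

lemma measurable_prodMk_defaultInd {m : MeasurableSpace Ω} {ξ : Ω → Fin d → ℝ}
    (τ : Fin n → Ω → ℝ≥0∞) (u : ℝ≥0) (hξ : Measurable ξ)
    (hτ : ∀ i, MeasurableSet (τ i ⁻¹' Set.Ioi (u : ℝ≥0∞))) :
    Measurable fun ω => (ξ ω, fun i => defaultInd (τ i) u ω) := by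
  refine hξ.prodMk (measurable_pi_lambda _ fun i => ?_)
  have h : defaultInd (τ i) u = fun ω =>
      1 - (τ i ⁻¹' Set.Ioi (u : ℝ≥0∞)).indicator (fun _ => (1 : ℝ)) ω := by
    rw [indicator_lt_eq]
    funext ω
    ring
  rw [h]
  exact (measurable_indicator_one (hτ i)).const_sub 1

variable {mΩ : MeasurableSpace Ω}

/-- The events `A ∩ ⋂ᵢ {τ i ∈ B i}`, where `A` belongs to the past of `X` at time `s` and each
`B i` is everything or a half-line `(r, ∞]` with `r ≤ s`. -/
def survivalEvents (X : ℝ≥0 → Ω → Fin d → ℝ) (τ : Fin n → Ω → ℝ≥0∞) (s : ℝ≥0) : Set (Set Ω) :=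
  {G | ∃ A, MeasurableSet[pastSigma X s] A ∧ ∃ B : Fin n → Set ℝ≥0∞,
    (∀ i, B i = Set.univ ∨ ∃ r : ℝ≥0, r ≤ s ∧ B i = Set.Ioi (r : ℝ≥0∞)) ∧
      G = A ∩ ⋂ i, τ i ⁻¹' B i}

lemma isPiSystem_survivalEvents (X : ℝ≥0 → Ω → Fin d → ℝ) (τ : Fin n → Ω → ℝ≥0∞) (s : ℝ≥0) :
    IsPiSystem (survivalEvents X τ s) := by
  rintro _ ⟨A, hA, B, hB, rfl⟩ _ ⟨A', hA', B', hB', rfl⟩ -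
  refine ⟨A ∩ A', @MeasurableSet.inter _ (pastSigma X s) _ _ hA hA', fun i => B i ∩ B' i,
    fun i => ?_, ?_⟩
  · change B i ∩ B' i = Set.univ ∨ ∃ r : ℝ≥0, r ≤ s ∧ B i ∩ B' i = Set.Ioi (r : ℝ≥0∞)
    rcases hB i with h | ⟨r, hr, h⟩
    · rw [h, Set.univ_inter]; exact hB' i
    · rcases hB' i with h' | ⟨r', hr', h'⟩
      · rw [h, h', Set.inter_univ]; exact Or.inr ⟨r, hr, rfl⟩
      · refine Or.inr ⟨max r r', max_le hr hr', ?_⟩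
        rw [h, h', Set.Ioi_inter_Ioi, ENNReal.coe_max]
  · simp only [Set.preimage_inter, Set.iInter_inter_distrib]
    exact Set.inter_inter_inter_comm _ _ _ _

lemma univ_mem_survivalEvents (X : ℝ≥0 → Ω → Fin d → ℝ) (τ : Fin n → Ω → ℝ≥0∞) (s : ℝ≥0) :
    Set.univ ∈ survivalEvents X τ s :=
  ⟨Set.univ, @MeasurableSet.univ _ (pastSigma X s), fun _ => Set.univ, fun _ => Or.inl rfl,
    by simp⟩

/-- The indicator at time `u` is determined by the half-line event `{τ i > u}`. Only this inclusion
is needed to extend identities from survival events to the filtration. -/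
lemma fullFiltration_le_generateFrom (X : ℝ≥0 → Ω → Fin d → ℝ) (τ : Fin n → Ω → ℝ≥0∞)
    (hX : ∀ t, Measurable (X t)) (hτ : ∀ i, Measurable (τ i)) (s : ℝ≥0) :
    fullFiltration X τ hX hτ s ≤ MeasurableSpace.generateFrom (survivalEvents X τ s) := by
  refine iSup₂_le fun u hu => Measurable.comap_le ?_
  have h1 : Measurable[MeasurableSpace.generateFrom (survivalEvents X τ s)] (X u) := by
    intro S hS
    refine MeasurableSpace.measurableSet_generateFrom ⟨X u ⁻¹' S,
      comap_le_pastSigma X hu _ ⟨S, hS, rfl⟩, fun _ => Set.univ, fun _ => Or.inl rfl, by simp⟩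
  refine measurable_prodMk_defaultInd τ u h1 fun i => ?_
  classical
  refine MeasurableSpace.measurableSet_generateFrom ⟨Set.univ,
    @MeasurableSet.univ _ (pastSigma X s), Function.update (fun _ => Set.univ) i (Set.Ioi u),
    fun k => ?_, ?_⟩
  · rcases eq_or_ne k i with rfl | hk
    · exact Or.inr ⟨u, hu, by simp⟩
    · exact Or.inl (by simp [hk])
  · rw [Set.univ_inter]
    ext ω
    simp only [Set.mem_preimage, Set.mem_iInter]
    refine ⟨fun h k => ?_, fun h => by simpa using h i⟩
    rcases eq_or_ne k i with rfl | hk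
    · simpa using h
    · simp [hk]

lemma measurable_fullFiltration (X : ℝ≥0 → Ω → Fin d → ℝ) (τ : Fin n → Ω → ℝ≥0∞)
    (hX : ∀ t, Measurable (X t)) (hτ : ∀ i, Measurable (τ i)) (t : ℝ≥0) :
    Measurable[fullFiltration X τ hX hτ t]
      fun ω => (X t ω, fun i => defaultInd (τ i) t ω) :=
  ((Filtration.stronglyAdapted_natural fun t => ((hX t).prodMk (measurable_pi_lambda _ fun i =>
    measurable_defaultInd (hτ i) t)).stronglyMeasurable) t).measurable

lemma measurable_defaultInd_fullFiltration (X : ℝ≥0 → Ω → Fin d → ℝ) (τ : Fin n → Ω → ℝ≥0∞)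
    (hX : ∀ t, Measurable (X t)) (hτ : ∀ i, Measurable (τ i)) (i : Fin n) (t : ℝ≥0) :
    Measurable[fullFiltration X τ hX hτ t] (defaultInd (τ i) t) :=
  (measurable_pi_apply i).comp (measurable_snd.comp (measurable_fullFiltration X τ hX hτ t))

lemma measurable_obligorFiltration (X : ℝ≥0 → Ω → Fin d → ℝ) (τ : Ω → ℝ≥0∞)
    (hX : ∀ t, Measurable (X t)) (hτ : Measurable τ) (t : ℝ≥0) :
    Measurable[obligorFiltration X τ hX hτ t] fun ω => (X t ω, defaultInd τ t ω) :=
  ((Filtration.stronglyAdapted_natural fun t =>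
    ((hX t).prodMk (measurable_defaultInd hτ t)).stronglyMeasurable) t).measurable

lemma obligorFiltration_le_fullFiltration (X : ℝ≥0 → Ω → Fin d → ℝ) (τ : Fin n → Ω → ℝ≥0∞)
    (hX : ∀ t, Measurable (X t)) (hτ : ∀ i, Measurable (τ i)) (i : Fin n) :
    obligorFiltration X (τ i) hX (hτ i) ≤ fullFiltration X τ hX hτ := by
  intro t
  refine iSup₂_le fun u hu => Measurable.comap_le ?_
  have h1 := (measurable_fullFiltration X τ hX hτ u).mono
    ((fullFiltration X τ hX hτ).mono hu) le_rfl
  exact (measurable_fst.comp h1).prodMk ((measurable_pi_apply i).comp (measurable_snd.comp h1))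

end Events

/-! ### Assembly of the evolution of `ζ`. -/

section Main

variable {Ω : Type*} {mΩ : MeasurableSpace Ω} {n d : ℕ} {μ : Measure Ω}

lemma mulVec_weightedMean {ι κ : Type*} [Fintype ι] (M : Matrix κ ι ℝ) {W : Ω → ℝ}
    {Z : Ω → ι → ℝ} (h : ∀ i, Integrable (fun ω => W ω * Z ω i) μ) :
    M *ᵥ weightedMean μ W Z = weightedMean μ W fun ω => M *ᵥ Z ω := by
  funext k
  simp only [Matrix.mulVec, dotProduct, weightedMean, Finset.mul_sum]
  rw [integral_finsetSum]
  · refine Finset.sum_congr rfl fun i _ => ?_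
    rw [← integral_const_mul]
    congr 1
    funext ω
    ring
  · intro i _
    refine ((h i).const_mul (M k i)).congr (Eventually.of_forall fun ω => ?_)
    simp only
    ring

lemma weightedMean_indicator {ι : Type*} {G : Set Ω} (hG : MeasurableSet G) (Z : Ω → ι → ℝ)
    (i : ι) : weightedMean μ (G.indicator fun _ => 1) Z i = ∫ ω in G, Z ω i ∂μ := by
  simpa using weightedMean_indicator_mul (μ := μ) hG (fun _ => 1) Z i

lemma measurableSet_of_mem_survivalEvents {𝓕 : Filtration ℝ≥0 mΩ} {X : ℝ≥0 → Ω → Fin d → ℝ}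
    {Q : Matrix (Fin d) (Fin d) ℝ} (h : IsMarkovChain μ 𝓕 X Q) {τ : Fin n → Ω → ℝ≥0∞}
    (hτ : ∀ i, Measurable (τ i)) {s : ℝ≥0} {G : Set Ω} (hG : G ∈ survivalEvents X τ s) :
    MeasurableSet G := by
  obtain ⟨A, hA, B, hB, rfl⟩ := hG
  refine (((h.pastSigma_le s).trans (𝓕.le s)) A hA).inter (MeasurableSet.iInter fun i => hτ i ?_)
  rcases hB i with hi | ⟨r, -, hi⟩
  · rw [hi]; exact MeasurableSet.univ
  · rw [hi]; exact measurableSet_Ioi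

lemma measurable_zeta {m : MeasurableSpace Ω} {X : ℝ≥0 → Ω → Fin d → ℝ}
    {τ : Fin n → Ω → ℝ≥0∞} {t : ℝ≥0} (hX : Measurable (X t))
    (hY : ∀ i, Measurable (defaultInd (τ i) t)) : Measurable (zeta X τ t) := by
  refine measurable_pi_lambda _ fun p => ?_
  have h1 : Measurable (defaultCount τ t) := by
    unfold defaultCount
    exact Finset.measurable_fun_sum _ fun i _ => hY i
  have h2 : Measurable fun ω => nu τ t ω p.1 := by
    simp only [nu_eq_ite]
    exact Measurable.ite (h1 (measurableSet_singleton _)) measurable_const measurable_const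
  exact h2.mul ((measurable_pi_apply p.2).comp hX)

/-- This splits a lumped mean of `ζ` into means over joint survival of fixed sets of obligors, whose
evolution is known. -/
lemma choosePool_mulVec_weightedMean [IsProbabilityMeasure μ] {𝓕 : Filtration ℝ≥0 mΩ}
    {X : ℝ≥0 → Ω → Fin d → ℝ} {Q : Matrix (Fin d) (Fin d) ℝ} (h : IsMarkovChain μ 𝓕 X Q)
    {τ : Fin n → Ω → ℝ≥0∞} (hτ : ∀ i, Measurable (τ i)) {G : Set Ω} (hG : MeasurableSet G)
    (k : ℕ) (t : ℝ≥0) :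
    choosePool n d k *ᵥ weightedMean μ (G.indicator fun _ => 1) (zeta X τ t) =
      ∑ I ∈ Finset.univ.powersetCard k, weightedMean μ (fun ω => G.indicator (fun _ => 1) ω *
        ∏ i ∈ I, (1 - defaultInd (τ i) t ω)) (X t) := by
  have hXt : Measurable (X t) := (h.adapted t).measurable.mono (𝓕.le t) le_rfl
  have hz := measurable_zeta hXt fun i => measurable_defaultInd (hτ i) t
  rw [mulVec_weightedMean _ fun p => ?_]
  · funext i
    simp only [weightedMean, choosePool_mulVec_zeta, Finset.sum_apply, Finset.mul_sum]
    rw [integral_finsetSum]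
    · refine Finset.sum_congr rfl fun I _ => ?_
      congr 1
      funext ω
      ring
    · intro I _
      refine Integrable.bdd_mul (c := 1) ((h.integrable_apply t i).bdd_mul (c := 1) ?_ ?_)
        (measurable_indicator_one hG).aestronglyMeasurable
        (Eventually.of_forall (abs_indicator_one_le G))
      · exact (Finset.measurable_fun_prod _ fun j _ =>
          (measurable_defaultInd (hτ j) t).const_sub 1).aestronglyMeasurable
      · refine Eventually.of_forall fun ω => ?_
        rw [Real.norm_eq_abs, Finset.abs_prod]
        exact Finset.prod_le_one (fun _ _ => abs_nonneg _)
          fun j _ => abs_one_sub_defaultInd_le (τ j) t ω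
  · obtain ⟨a, b⟩ := p
    refine integrable_of_bounded ((measurable_indicator_one hG).mul
      ((measurable_pi_apply _).comp hz)) (C := 1) fun ω => ?_
    rw [abs_mul]
    refine mul_le_one₀ (abs_indicator_one_le G ω) (abs_nonneg _) ?_
    obtain ⟨j, hj⟩ := h.basis t ω
    rw [zeta_eq_single τ hj, Pi.single_apply]
    split_ifs <;> simp

end Main

end MMDefault

theorem mainTheorem1 {Ω : Type*} {mΩ : MeasurableSpace Ω} (μ : Measure Ω) [IsProbabilityMeasure μ]
    (n d : ℕ) (Q : Matrix (Fin d) (Fin d) ℝ) (lam : Fin d → ℝ) (hlam : ∀ j, 0 ≤ lam j)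
    (X : ℝ≥0 → Ω → Fin d → ℝ) (τ : Fin n → Ω → ℝ≥0∞)
    (hX : ∀ t, Measurable (X t)) (hτ : ∀ i, Measurable (τ i))
    (hchain : MMDefault.IsMarkovChain μ (MMDefault.fullFiltration X τ hX hτ) X Q)
    (hmart : ∀ i, Martingale (MMDefault.compensated lam X (τ i))
      (MMDefault.obligorFiltration X (τ i) hX (hτ i)) μ)
    (hindep : MMDefault.CondIndepTimes μ (MMDefault.pathSigma X) τ)
    (hjump : ∀ᵐ ω ∂μ, ∀ (i : Fin n) (t : ℝ≥0),
      MMDefault.jump (fun u => MMDefault.defaultInd (τ i) u ω) t •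
        MMDefault.jump (fun u => X u ω) t = 0) :
    MMDefault.IsMarkovChain μ (MMDefault.fullFiltration X τ hX hτ) (MMDefault.zeta X τ)
      (MMDefault.bigQ n lam Q) ∧
    ∀ s t : ℝ≥0, s ≤ t →
      μ[MMDefault.zeta X τ t | MMDefault.fullFiltration X τ hX hτ s] =ᵐ[μ]
        fun ω => NormedSpace.exp (((t : ℝ) - s) • MMDefault.bigQ n lam Q) *ᵥ
          MMDefault.zeta X τ s ω := by
  open MMDefault in
  set 𝓕 := fullFiltration X τ hX hτ with h𝓕
  have hYm := measurable_defaultInd_fullFiltration X τ hX hτ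
  have hsurv : ∀ s t : ℝ≥0, s ≤ t → ∀ i, μ⟦τ i ⁻¹' Set.Ioi (t : ℝ≥0∞) | pathSigma X⟧ =ᵐ[μ]
      fun ω => Real.exp (-1 * intensityIntegral lam X s t ω) *
        (μ⟦τ i ⁻¹' Set.Ioi (s : ℝ≥0∞) | pathSigma X⟧) ω := by
    intro s t hst i
    have hm := measurable_obligorFiltration X (τ i) hX (hτ i)
    -- The martingale property is available only in the filtration of a single obligor, so the chain
    -- is first restricted to that filtration.
    have hi := hchain.of_le (obligorFiltration_le_fullFiltration X τ hX hτ i)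
      fun t => (measurable_fst.comp (hm t)).stronglyMeasurable
    exact condExp_survival hi hlam (hτ i) (fun u => measurable_snd.comp (hm u)) (hmart i)
      (hjump.mono fun ω hω => hω i) hst
  have hbasis : ∀ t ω, ∃ p, zeta X τ t ω = Pi.single p 1 := by
    intro t ω
    obtain ⟨j, hj⟩ := hchain.basis t ω
    exact ⟨_, zeta_eq_single τ hj⟩
  have hzm : ∀ t, Measurable[𝓕 t] (zeta X τ t) := fun t =>
    measurable_zeta (hchain.adapted t).measurable fun i => hYm i t
  have hz1 : ∀ t ω p, |zeta X τ t ω p| ≤ 1 := by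
    intro t ω p
    obtain ⟨q, hq⟩ := hbasis t ω
    rw [hq, Pi.single_apply]
    split_ifs <;> simp
  have hzpm : ∀ t p, Measurable fun ω => zeta X τ t ω p := fun t p =>
    (measurable_pi_apply p).comp ((hzm t).mono (𝓕.le t) le_rfl)
  have hzi : ∀ t p, Integrable (fun ω => zeta X τ t ω p) μ := fun t p =>
    integrable_of_bounded (hzpm t p) fun ω => hz1 t ω p
  set E : ℝ≥0 → ℝ≥0 → Matrix (Fin (n + 1) × Fin d) (Fin (n + 1) × Fin d) ℝ := fun s t =>
    NormedSpace.exp (((t : ℝ) - s) • bigQ n lam Q) with hE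
  have hEm : ∀ s t, Measurable[𝓕 s] fun ω => E s t *ᵥ zeta X τ s ω := by
    intro s t
    have : Continuous fun x : Fin (n + 1) × Fin d → ℝ => E s t *ᵥ x := by fun_prop
    exact this.measurable.comp (hzm s)
  have hEi : ∀ s t p, Integrable (fun ω => (E s t *ᵥ zeta X τ s ω) p) μ := by
    intro s t p
    simp only [Matrix.mulVec, dotProduct]
    exact integrable_finsetSum _ fun q _ => (hzi s q).const_mul _
  have hevents : ∀ s t : ℝ≥0, s ≤ t → ∀ G ∈ survivalEvents X τ s,
      weightedMean μ (G.indicator fun _ => 1) (zeta X τ t) =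
        E s t *ᵥ weightedMean μ (G.indicator fun _ => 1) (zeta X τ s) := by
    rintro s t hst _ ⟨A, hA, B, hB, rfl⟩
    have hG := measurableSet_of_mem_survivalEvents hchain hτ ⟨A, hA, B, hB, rfl⟩
    rw [← sub_eq_zero]
    refine eq_zero_of_choosePool_mulVec fun k => ?_
    -- The intertwining of the generators passes to the exponentials, so the claim may be checked
    -- for each `k` with the `d`-dimensional generator `Q - k diag(λ)`.
    have hexp : choosePool n d k * E s t =
        NormedSpace.exp (((t : ℝ) - s) • (Q - (k : ℝ) • Matrix.diagonal lam)) *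
          choosePool n d k := by
      refine exp_mul_eq_mul_exp _ _ _ ?_
      rw [Matrix.mul_smul, choosePool_mul_bigQ, Matrix.smul_mul]
    rw [Matrix.mulVec_sub, Matrix.mulVec_mulVec, hexp, ← Matrix.mulVec_mulVec,
      choosePool_mulVec_weightedMean hchain hτ hG, choosePool_mulVec_weightedMean hchain hτ hG,
      Matrix.mulVec_sum, sub_eq_zero]
    refine Finset.sum_congr rfl fun I hI => ?_
    rw [weightedMean_prod_survival hchain hlam hτ hYm hindep hst (hsurv s t hst) hA hB I,
      (Finset.mem_powersetCard.1 hI).2]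
  have hset : ∀ s t : ℝ≥0, s ≤ t → ∀ p G, MeasurableSet[𝓕 s] G →
      ∫ ω in G, (zeta X τ t ω p - (E s t *ᵥ zeta X τ s ω) p) ∂μ = 0 := by
    intro s t hst p G hG
    have hbasic : ∀ G ∈ survivalEvents X τ s,
        ∫ ω in G, (zeta X τ t ω p - (E s t *ᵥ zeta X τ s ω) p) ∂μ = 0 := by
      intro G hG
      have hGm := measurableSet_of_mem_survivalEvents hchain hτ hG
      have h1 := congrFun (hevents s t hst G hG) p
      rw [mulVec_weightedMean _ fun q => (hzi s q).bdd_mul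
        (measurable_indicator_one hGm).aestronglyMeasurable
        (Eventually.of_forall (abs_indicator_one_le G)), weightedMean_indicator hGm,
        weightedMean_indicator hGm] at h1
      rw [integral_sub (hzi t p).integrableOn (hEi s t p).integrableOn, h1, sub_self]
    -- The identity is proved on the σ-algebra generated by the survival events, which contains `𝓕
    -- s`.
    refine setIntegral_eq_zero_of_isPiSystem (MeasurableSpace.generateFrom_le fun G hG =>
      measurableSet_of_mem_survivalEvents hchain hτ hG) rfl (isPiSystem_survivalEvents X τ s)
      ((hzi t p).sub (hEi s t p)) hbasic ?_ G (fullFiltration_le_generateFrom X τ hX hτ s _ hG)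
    rw [← setIntegral_univ]
    exact hbasic _ (univ_mem_survivalEvents X τ s)
  have hcond : ∀ s t : ℝ≥0, s ≤ t → ∀ p, μ[fun ω => zeta X τ t ω p | 𝓕 s] =ᵐ[μ]
      fun ω => (E s t *ᵥ zeta X τ s ω) p := by
    intro s t hst p
    refine (ae_eq_condExp_of_forall_setIntegral_eq (𝓕.le s) (hzi t p)
      (fun _ _ _ => (hEi s t p).integrableOn) (fun G hG _ => ?_)
      ((measurable_pi_apply p).comp (hEm s t)).stronglyMeasurable.aestronglyMeasurable).symm
    have h1 := hset s t hst p G hG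
    rw [integral_sub (hzi t p).integrableOn (hEi s t p).integrableOn, sub_eq_zero] at h1
    exact h1.symm
  refine ⟨⟨fun t => (hzm t).stronglyMeasurable, fun ω => isCadlag_zeta τ ω (hchain.cadlag ω),
    hbasis, fun t => NormedSpace.exp ((t : ℝ) • bigQ n lam Q), isTransitionSemigroup_exp
      (bigQ_offDiag_nonneg hlam hchain.generator_offDiag_nonneg)
      (bigQ_col_sum hchain.generator_col_sum), fun s t hst p => ?_⟩, fun s t hst => ?_⟩
  · rw [indicator_eq_apply_of_basis (hbasis t)]
    filter_upwards [hcond s t hst p] with ω hω q hq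
    rw [hω, hq, Matrix.mulVec_single_one, NNReal.coe_sub hst]
    rfl
  -- The vector-valued conditional expectation is compared coordinatewise; finitely many null sets
  -- are discarded.
  · have hproj : ∀ p, ∀ᵐ ω ∂μ, (μ[zeta X τ t | 𝓕 s]) ω p = (E s t *ᵥ zeta X τ s ω) p := by
      intro p
      have h1 := (ContinuousLinearMap.proj (R := ℝ) (φ := fun _ : Fin (n + 1) × Fin d => ℝ)
        p).comp_condExp_comm (m := 𝓕 s) (μ := μ) (Integrable.of_eval fun q => hzi t q)
      filter_upwards [h1, hcond s t hst p] with ω h2 h3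
      rw [← h3]
      exact h2
    filter_upwards [ae_all_iff.2 hproj] with ω hω
    exact funext hω
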